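/- **Protocol.** Let $\mathsf{KEM}_{stat}$ and $\mathsf{KEM}_{eph}$ be key encapsulation mechanisms, let $\mathsf{MAC}^{(qkd)}$ and $\mathsf{MAC}^{(pqc)}$ be canonical message authentication codes (tags are computed deterministically from uniformly random bit-string keys and verified by recomputation), and let $\mathsf{KDF}$ be a function whose values are bit strings. The authenticated key exchange protocol $\Pi$ between an initiator $i_I$ and a responder $i_R$, each with a static key pair of $\mathsf{KEM}_{stat}$, is the following. * *Init.* The initiator samples $(c_b,k_b)\leftarrow\mathsf{Encaps}_{stat}(pk_{i_R})$ and $(pk_e,sk_e)\leftarrow\mathsf{KeyGen}_{eph}$, sends $m_1=(c_b,pk_e)$ and keeps the state $(k_b,sk_e,m_1)$. * *SendM1.* On $m_1=(c_b,pk_e)$ the responder computes $k_b'=\mathsf{Decaps}_{stat}(sk_{i_R},c_b)$, samples $(c_a,k_a)\leftarrow\mathsf{Encaps}_{stat}(pk_{i_I})$ and $(c_e,k_e)\leftarrow\mathsf{Encaps}_{eph}(pk_e)$, sets $k_{pqc}=\mathsf{KDF}(k_b',k_a,k_e)$, and obtains a fresh key with its identifier $(kid,k_{qkd})$ from the QKD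 oracle. With $t=(m_1,(c_a,c_e,kid))$ it computes $(k_{sess},\tau_1,\tau_2)=\mathsf{Combine}(i_I,i_R,t,k_{qkd},k_{pqc})$, sends $m_2=(c_a,c_e,kid,\tau_1,\tau_2)$ and accepts with session key $k_{sess}$. * *SendM2.* On $m_2=(c_a,c_e,kid,\tau_1',\tau_2')$ the initiator computes $k_{pqc}=\mathsf{KDF}(k_b,\mathsf{Decaps}_{stat}(sk_{i_I},c_a),\mathsf{Decaps}_{eph}(sk_e,c_e))$, requests the QKD key with identifier $kid$ (and aborts if there is none), computes $(k_{sess},\tau_1,\tau_2)=\mathsf{Combine}(i_I,i_R,t,k_{qkd},k_{pqc})$ with $t=(m_1,(c_a,c_e,kid))$, aborts unless $\tau_1=\tau_1'$ and $\tau_2=\tau_2'$, and otherwise accepts with session key $k_{sess}$. * $\mathsf{Combine}(i_I,i_R,t,k_{qkd},k_{pqc})$ splits $k_{qkd}=k_{qkd,m}\|k_{qkd,s}$ and $k_{pqc}=k_{pqc,m}\|k_{pqc,s}$ and returns $k_{sess}=k_{qkd,s}\oplus k_{pqc,s}$, $\tau_1=\mathsf{MAC}^{(qkd)}_{k_{qkd,m}}(t,i_I,i_R)$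 and $\tau_2=\mathsf{MAC}^{(pqc)}_{k_{pqc,m}}(t,\tau_1,i_I,i_R)$. **QKD oracle.** A key request in a session of $i$ with peer $j$ returns a fresh identifier $kid$ and a uniformly random key. As long as the key is not corrupt, it is handed out once more, namely to the first session of $j$ with peer $i$ that requests $kid$. The adversary may leak a key (it learns the key) and may override the key of any $kid$ (it sets the key); the key is then corrupt for ever, and a corrupt key is handed out to every session that requests it by its identifier. **Game $\text{IND-StAA-QKD}_b$.** Static key pairs of $N$ parties are generated independently, and the adversary $A$ gets the public keys. $A$ adaptively establishes sessions of a party with a peer (possibly the party itself), starts them as initiators, delivers arbitrary messages to them and sees their replies and whether an initiator accepts, reveals session keys, reveals initiator states, reveals static secret keys, leaks and overrides QKD keys, and tests one session that has a session key: it gets that key if $b=0$ and a uniformly random key if $b=1$. Two sessions match if their holders and peers are swapped, one is an initiator and the other a responder, and each received exactly the message that the other sent. The game outputs the final bit of $A$ if a session was tested, neither its key nor the key of a matching session was revealed, and at the end of the game the QKD key with the identifier in its second message is not corrupt; otherwise it outputs $0$. All static secret keys and all states may have been revealed. The advantage is $$\mathrm{Adv}^{\text{IND-StAA-QKD}}(\Pi,A)=\bigl|\Pr[\text{IND-StAA-QKD}_1(\Pi,A)\Rightarrow1]-\Pr[\text{IND-StAA-QKD}_0(\Pi,A)\Rightarrow1]\bigr|.$$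 **Other notions.** A KEM is $\delta$-correct if $\Pr[\mathsf{Decaps}(sk,c)\ne k]\le\delta$ for $(pk,sk)\leftarrow\mathsf{KeyGen}$, $(c,k)\leftarrow\mathsf{Encaps}(pk)$, and $\delta$-correct for every key pair if this holds (over $\mathsf{Encaps}$ only) for each $(pk,sk)$ in the support of $\mathsf{KeyGen}$. For a MAC, $\mathrm{Adv}^{\text{OT-SUF-CMA}}_{\mathsf{MAC}}(B)$ is the probability that $B$, with one query $m$ to a tagging oracle under a uniformly random key, answered by $\tau$, outputs a pair $(m^*,\tau^*)$ with valid tag and $(m^*,\tau^*)\ne(m,\tau)$. **Theorem (QKD-based security).** Let $\mathsf{KEM}_{stat}$ be $\delta_{stat}$-correct and $\mathsf{KEM}_{eph}$ be $\delta_{eph}$-correct. Let $A$ be a (potentially computationally unbounded) IND-StAA-QKD adversary against $\Pi$ with $N$ parties that establishes at most $n_s$ sessions. Then there is a (potentially computationally unbounded) OT-SUF-CMA adversary $B$ against $\mathsf{MAC}^{(qkd)}$ such that, if $N\le 2n_s$ or if $\mathsf{KEM}_{stat}$ is $\delta_{stat}$-correct for every key pair, $$\mathrm{Adv}^{\text{IND-StAA-QKD}}(\Pi,A)\le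 2n_s\Bigl(n_s\,(2\delta_{stat}+\delta_{eph})+\mathrm{Adv}^{\text{OT-SUF-CMA}}_{\mathsf{MAC}^{(qkd)}}(B)\Bigr),$$ and in all cases $$\mathrm{Adv}^{\text{IND-StAA-QKD}}(\Pi,A)\le 2n_s\Bigl(\max(2n_s,N)\,\delta_{stat}+n_s\,\delta_{eph}+\mathrm{Adv}^{\text{OT-SUF-CMA}}_{\mathsf{MAC}^{(qkd)}}(B)\Bigr).$$ -/

import Mathlib

noncomputable section

namespace QKDAKE

/-! ### Bit strings and probabilities -/

/-- Bit strings of length `n`. -/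
abbrev Bits (n : ℕ) : Type := Fin n → Bool

/-- Bitwise exclusive or. -/
def Bits.xor {n : ℕ} (x y : Bits n) : Bits n := fun i => Bool.xor (x i) (y i)

/-- The first `m` bits of a string of length `m + n`. -/
def Bits.left {m n : ℕ} (x : Bits (m + n)) : Bits m := fun i => x (Fin.castAdd n i)

/-- The last `n` bits of a string of length `m + n`. -/
def Bits.right {m n : ℕ} (x : Bits (m + n)) : Bits n := fun i => x (Fin.natAdd m i)

/-- The probability that a Boolean experiment outputs `true`. -/
def prTrue (p : PMF Bool) : ℝ := (p true).toReal

/-- `n` independent samples of `p`. -/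
def iid {α : Type} (p : PMF α) : (n : ℕ) → PMF (Fin n → α)
  | 0 => PMF.pure Fin.elim0
  | n + 1 => p.bind fun a => (iid p n).bind fun v => PMF.pure (Fin.cons a v)

/-! ### Randomised algorithms with oracle access -/

/-- A (computationally unbounded) randomised algorithm with output in `α` that may ask adaptively
chosen queries `q : Q`, each of which is answered by an element of `R q`. -/
inductive OracleAlg (Q : Type) (R : Q → Type) (α : Type) : Type 1
  | done (a : α) : OracleAlg Q R α
  | sample {β : Type} (p : PMF β) (k : β → OracleAlg Q R α) : OracleAlg Q R α
  | ask (q : Q) (k : R q → OracleAlg Q R α) : OracleAlg Q R α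

/-- Run an algorithm against a stateful randomised oracle; the result is the output together with
the final state of the oracle. -/
def OracleAlg.run {Q : Type} {R : Q → Type} {α σ : Type}
    (oracle : (q : Q) → σ → PMF (R q × σ)) : OracleAlg Q R α → σ → PMF (α × σ)
  | .done a, st => PMF.pure (a, st)
  | .sample p k, st => p.bind fun x => (k x).run oracle st
  | .ask q k, st => (oracle q st).bind fun r => (k r.1).run oracle r.2

/-- The queries asked in any run of the algorithm have total cost at most `n`. -/
def OracleAlg.CostAtMost {Q : Type} {R : Q → Type} {α : Type} (cost : Q → ℕ) :
    OracleAlg Q R α → ℕ → Prop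
  | .done _, _ => True
  | .sample _ k, n => ∀ x, (k x).CostAtMost cost n
  | .ask q k, n => cost q ≤ n ∧ ∀ r, (k r).CostAtMost cost (n - cost q)

/-! ### Key encapsulation mechanisms -/

/-- A key encapsulation mechanism. A rejection symbol, if there is one, is an element of `Key`. -/
structure KEM where
  PK : Type
  SK : Type
  CT : Type
  Key : Type
  keyGen : PMF (PK × SK)
  encaps : PK → PMF (CT × Key)
  decaps : SK → CT → Key

open Classical in
/-- The experiment, for a fixed key pair, that encapsulates and tells whether decapsulation of the
ciphertext fails to give back the encapsulated key. -/
def KEM.decapsFails (K : KEM) (pk : K.PK) (sk : K.SK) : PMF Bool :=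
  (K.encaps pk).bind fun ck => PMF.pure (decide (K.decaps sk ck.1 ≠ ck.2))

/-- `δ`-correctness: for an honest key pair and an honest encapsulation, decapsulation fails with
probability at most `δ`. -/
def KEM.IsCorrect (K : KEM) (δ : ℝ) : Prop :=
  prTrue (K.keyGen.bind fun ks => K.decapsFails ks.1 ks.2) ≤ δ

/-- `δ`-correctness for each individual key pair that key generation can output. -/
def KEM.IsCorrectForEveryKey (K : KEM) (δ : ℝ) : Prop :=
  ∀ ks ∈ K.keyGen.support, prTrue (K.decapsFails ks.1 ks.2) ≤ δ

/-! ### Message authentication codes -/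

/-- A canonical message authentication code with `ℓ`-bit keys: tags are computed
deterministically, and verification recomputes the tag. -/
structure MAC (ℓ : ℕ) (M : Type) where
  Tag : Type
  tag : Bits ℓ → M → Tag

/-- An adversary of the one-time strong unforgeability game: it has access to a tagging oracle and
outputs a forgery (or gives up). -/
abbrev MAC.Forger {ℓ : ℕ} {M : Type} (mac : MAC ℓ M) : Type 1 :=
  OracleAlg M (fun _ => Option mac.Tag) (Option (M × mac.Tag))

/-- The one-time tagging oracle. It answers the first query only; its state records that query
and the answer. -/
def MAC.tagOracle {ℓ : ℕ} {M : Type} (mac : MAC ℓ M) (k : Bits ℓ) (m : M) :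
    Option (M × mac.Tag) → PMF (Option mac.Tag × Option (M × mac.Tag))
  | none => PMF.pure (some (mac.tag k m), some (m, mac.tag k m))
  | some r => PMF.pure (none, some r)

open Classical in
/-- The OT-SUF-CMA game: the forger wins iff it outputs a message with a valid tag, and this pair
is not the one that it got from the tagging oracle. -/
def MAC.otSufCmaGame {ℓ : ℕ} {M : Type} (mac : MAC ℓ M) (B : mac.Forger) : PMF Bool :=
  (PMF.uniformOfFintype (Bits ℓ)).bind fun k =>
    (B.run (mac.tagOracle k) none).bind fun r =>
      PMF.pure (decide (∃ m τ, r.1 = some (m, τ) ∧ mac.tag k m = τ ∧ r.2 ≠ some (m, τ)))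

/-- The advantage of `B` in the OT-SUF-CMA game. -/
def MAC.otSufCmaAdv {ℓ : ℕ} {M : Type} (mac : MAC ℓ M) (B : mac.Forger) : ℝ :=
  prTrue (mac.otSufCmaGame B)

/-! ### The protocol -/

/-- The first message `(c_b, pk_e)`. -/
structure Msg1 (S E : KEM) where
  cb : S.CT
  pke : E.PK

/-- The transcript `(m₁, (c_a, c_e, kid))` that is authenticated. Key identifiers are natural
numbers. -/
structure Transcript (S E : KEM) where
  m1 : Msg1 S E
  ca : S.CT
  ce : E.CT
  kid : ℕ

/-- The building blocks of the protocol. Identities of parties are natural numbers. -/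
structure Suite where
  /-- the static KEM -/
  stat : KEM
  /-- the ephemeral KEM -/
  eph : KEM
  /-- the length of the keys of the inner MAC -/
  lenMacQkd : ℕ
  /-- the length of the keys of the outer MAC -/
  lenMacPqc : ℕ
  /-- the length of the session keys -/
  lenSess : ℕ
  /-- the inner MAC, on messages `(t, i_I, i_R)` -/
  macQkd : MAC lenMacQkd (Transcript stat eph × ℕ × ℕ)
  /-- the outer MAC, on messages `(t, τ₁, i_I, i_R)` -/
  macPqc : MAC lenMacPqc (Transcript stat eph × macQkd.Tag × ℕ × ℕ)
  /-- the key derivation function -/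
  kdf : stat.Key → stat.Key → eph.Key → Bits (lenMacPqc + lenSess)

namespace Suite

variable (P : Suite)

/-- QKD keys `k_m ‖ k_s`. -/
abbrev QkdKey : Type := Bits (P.lenMacQkd + P.lenSess)

/-- Session keys. -/
abbrev SessKey : Type := Bits P.lenSess

/-- The second message `(c_a, c_e, kid, τ₁, τ₂)`. -/
structure Msg2 (P : Suite) where
  ca : P.stat.CT
  ce : P.eph.CT
  kid : ℕ
  tag1 : P.macQkd.Tag
  tag2 : P.macPqc.Tag

/-- The state `(k_b, sk_e, m₁)` that the initiator keeps. -/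
structure IState (P : Suite) where
  kb : P.stat.Key
  ske : P.eph.SK
  m1 : Msg1 P.stat P.eph

/-- The algorithm `Init`. -/
def initiate (pkj : P.stat.PK) : PMF (Msg1 P.stat P.eph × P.IState) :=
  (P.stat.encaps pkj).bind fun b =>
    P.eph.keyGen.bind fun e =>
      PMF.pure (⟨b.1, e.1⟩, ⟨b.2, e.2, ⟨b.1, e.1⟩⟩)

/-- The algorithm `Combine`. -/
def combine (iI iR : ℕ) (t : Transcript P.stat P.eph) (kqkd : P.QkdKey)
    (kpqc : Bits (P.lenMacPqc + P.lenSess)) : P.SessKey × P.macQkd.Tag × P.macPqc.Tag :=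
  let ksess := Bits.xor kqkd.right kpqc.right
  let tag1 := P.macQkd.tag kqkd.left (t, iI, iR)
  let tag2 := P.macPqc.tag kpqc.left (t, tag1, iI, iR)
  (ksess, tag1, tag2)

/-- The algorithm `SendM1` of the responder `i` with peer `j`. It calls `getKey` once, a stateful
oracle that returns a fresh key identifier and a key. -/
def sendM1 {σ : Type} (getKey : σ → PMF ((ℕ × P.QkdKey) × σ)) (i : ℕ) (ski : P.stat.SK)
    (j : ℕ) (pkj : P.stat.PK) (m1 : Msg1 P.stat P.eph) (st : σ) :
    PMF ((P.Msg2 × P.SessKey) × σ) :=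
  let kb := P.stat.decaps ski m1.cb
  (P.stat.encaps pkj).bind fun a =>
    (P.eph.encaps m1.pke).bind fun e =>
      let kpqc := P.kdf kb a.2 e.2
      (getKey st).bind fun g =>
        let kid := g.1.1
        let c := P.combine j i ⟨m1, a.1, e.1, kid⟩ g.1.2 kpqc
        PMF.pure ((⟨a.1, e.1, kid, c.2.1, c.2.2⟩, c.1), g.2)

open Classical in
/-- The algorithm `SendM2` of the initiator `i` with peer `j`. It calls the stateful oracle
`getKeyWithId` once. The output is the session key, or `none` if the session aborts. -/
def sendM2 {σ : Type} (getKeyWithId : ℕ → σ → Option P.QkdKey × σ) (i : ℕ) (ski : P.stat.SK)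
    (j : ℕ) (s : P.IState) (m2 : P.Msg2) (st : σ) : Option P.SessKey × σ :=
  let ka := P.stat.decaps ski m2.ca
  let ke := P.eph.decaps s.ske m2.ce
  let kpqc := P.kdf s.kb ka ke
  match getKeyWithId m2.kid st with
  | (none, st') => (none, st')
  | (some kqkd, st') =>
      let c := P.combine i j ⟨s.m1, m2.ca, m2.ce, m2.kid⟩ kqkd kpqc
      if c.2.1 = m2.tag1 ∧ c.2.2 = m2.tag2 then (some c.1, st') else (none, st')

/-! ### The QKD oracle -/

/-- The status of a QKD key: `waiting i j` if it was requested by a session of party `i` with peer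
`j` and party `j` has not retrieved it yet, `delivered` if it was retrieved, and `corrupt` if it
was leaked to or set by the adversary. -/
inductive KeyFlag : Type
  | waiting (holder peer : ℕ)
  | delivered
  | corrupt

/-- The state of the QKD oracle: the keys with their flags, and a bound on the identifiers in
use. -/
structure QkdState (P : Suite) where
  nextKid : ℕ
  keys : ℕ → Option (P.QkdKey × KeyFlag)

/-- Store a key with its flag. -/
def QkdState.set {P : Suite} (st : P.QkdState) (kid : ℕ) (k : P.QkdKey) (f : KeyFlag) :
    P.QkdState :=
  ⟨max st.nextKid (kid + 1), Function.update st.keys kid (some (k, f))⟩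

/-- `QKD-GET-KEY`, called in a session of `holder` with `peer`: a uniformly random key under a
fresh identifier. -/
def QkdState.getKey {P : Suite} (holder peer : ℕ) (st : P.QkdState) :
    PMF ((ℕ × P.QkdKey) × P.QkdState) :=
  (PMF.uniformOfFintype P.QkdKey).bind fun k =>
    PMF.pure ((st.nextKid, k), st.set st.nextKid k (.waiting holder peer))

/-- `QKD-GET-KEY-WITH-ID`, called in a session of `holder` with `peer`. An honest key is handed out
once, to the party for which it was requested; a corrupt key is always handed out. -/
def QkdState.getKeyWithId {P : Suite} (holder peer : ℕ) (kid : ℕ) (st : P.QkdState) :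
    Option P.QkdKey × P.QkdState :=
  match st.keys kid with
  | some (k, .waiting i j) =>
      if i = peer ∧ j = holder then (some k, st.set kid k .delivered) else (none, st)
  | some (k, .corrupt) => (some k, st)
  | some (_, .delivered) => (none, st)
  | none => (none, st)

/-- `QKD-LEAK`: the adversary learns a key, which becomes corrupt. -/
def QkdState.leak {P : Suite} (kid : ℕ) (st : P.QkdState) : Option P.QkdKey × P.QkdState :=
  match st.keys kid with
  | some (k, _) => (some k, st.set kid k .corrupt)
  | none => (none, st)

/-- `QKD-OVERRIDE`: the adversary sets a key, under an old or a new identifier; it becomes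
corrupt. -/
def QkdState.override {P : Suite} (kid : ℕ) (k : P.QkdKey) (st : P.QkdState) : P.QkdState :=
  st.set kid k .corrupt

/-- The key with this identifier is flagged as corrupt. -/
def QkdState.IsCorrupt {P : Suite} (st : P.QkdState) (kid : ℕ) : Prop :=
  ∃ k, st.keys kid = some (k, .corrupt)

/-! ### The security game -/

/-- The role of a session. -/
inductive Role : Type
  | initiator
  | responder
  deriving DecidableEq

/-- The variables of a session. The message `m1` is the one sent by an initiator or received by a
responder, and `m2` is the one received by an initiator or sent by a responder. -/
structure Session (P : Suite) (N : ℕ) where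
  holder : Fin N
  peer : Fin N
  role : Option Role := none
  m1 : Option (Msg1 P.stat P.eph) := none
  m2 : Option P.Msg2 := none
  state : Option P.IState := none
  key : Option P.SessKey := none
  revealed : Bool := false

/-- Matching sessions: holder and peer are swapped, the roles are opposite, and what one of them
sent is what the other received. -/
def Session.Matches {P : Suite} {N : ℕ} (s s' : P.Session N) : Prop :=
  s'.holder = s.peer ∧ s'.peer = s.holder ∧
    ((s.role = some .initiator ∧ s'.role = some .responder) ∨
      (s.role = some .responder ∧ s'.role = some .initiator)) ∧
    s.m1 ≠ none ∧ s'.m1 = s.m1 ∧ s.m2 ≠ none ∧ s'.m2 = s.m2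

/-- The state of the game with `N` parties. -/
structure GameState (P : Suite) (N : ℕ) where
  numSessions : ℕ
  sessions : ℕ → Option (P.Session N)
  qkd : P.QkdState
  tested : Option ℕ

/-- The state in which the game starts. -/
def GameState.start (P : Suite) (N : ℕ) : P.GameState N :=
  ⟨0, fun _ => none, ⟨0, fun _ => none⟩, none⟩

/-- Overwrite the variables of a session. -/
def GameState.setSession {P : Suite} {N : ℕ} (st : P.GameState N) (sid : ℕ) (s : P.Session N) :
    P.GameState N :=
  { st with sessions := Function.update st.sessions sid (some s) }

/-- The queries of the adversary. -/
inductive Query (P : Suite) (N : ℕ) : Type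
  /-- establish a session of party `i` with peer `j` -/
  | est (i j : Fin N)
  /-- start the session as an initiator -/
  | init (sid : ℕ)
  /-- deliver a first message; the session becomes a responder -/
  | sendM1 (sid : ℕ) (m1 : Msg1 P.stat P.eph)
  /-- deliver a second message to an initiator -/
  | sendM2 (sid : ℕ) (m2 : P.Msg2)
  /-- reveal the session key -/
  | reveal (sid : ℕ)
  /-- reveal the state of an initiator -/
  | revState (sid : ℕ)
  /-- reveal the static secret key of a party -/
  | corrupt (i : Fin N)
  /-- the test query -/
  | test (sid : ℕ)
  /-- learn a QKD key -/
  | qkdLeak (kid : ℕ)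
  /-- set a QKD key -/
  | qkdOverride (kid : ℕ) (k : P.QkdKey)

/-- The type of the answer to a query. For `sendM2` it tells whether the session accepts. -/
def Response (P : Suite) (N : ℕ) : Query P N → Type
  | .est _ _ => ℕ
  | .init _ => Option (Msg1 P.stat P.eph)
  | .sendM1 _ _ => Option P.Msg2
  | .sendM2 _ _ => Bool
  | .reveal _ => Option P.SessKey
  | .revState _ => Option P.IState
  | .corrupt _ => P.stat.SK
  | .test _ => Option P.SessKey
  | .qkdLeak _ => Option P.QkdKey
  | .qkdOverride _ _ => Unit

/-- The oracles of the game with bit `b`, where `keys` are the static key pairs of the parties.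
A query that is not admissible is answered by `none` or `false` and changes nothing. -/
def oracle (N : ℕ) (keys : Fin N → P.stat.PK × P.stat.SK) (b : Bool) :
    (q : Query P N) → P.GameState N → PMF (Response P N q × P.GameState N)
  | .est i j, st =>
      PMF.pure (st.numSessions,
        { st with
          numSessions := st.numSessions + 1
          sessions := Function.update st.sessions st.numSessions
            (some { holder := i, peer := j }) })
  | .init sid, st =>
      match st.sessions sid with
      | none => PMF.pure (none, st)
      | some s =>
          if s.role = none then
            (P.initiate (keys s.peer).1).bind fun r =>
              PMF.pure (some r.1, st.setSession sid
                { s with role := some .initiator, m1 := some r.1, state := some r.2 })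
          else PMF.pure (none, st)
  | .sendM1 sid m1, st =>
      match st.sessions sid with
      | none => PMF.pure (none, st)
      | some s =>
          if s.role = none then
            (P.sendM1 (QkdState.getKey s.holder s.peer) s.holder (keys s.holder).2 s.peer
              (keys s.peer).1 m1 st.qkd).bind fun r =>
                PMF.pure (some r.1.1, ({ st with qkd := r.2 } : P.GameState N).setSession sid
                  { s with
                    role := some .responder, m1 := some m1, m2 := some r.1.1
                    key := some r.1.2 })
          else PMF.pure (none, st)
  | .sendM2 sid m2, st =>
      match st.sessions sid with
      | none => PMF.pure (false, st)
      | some s =>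
          match s.state, s.m2 with
          | some s', none =>
              let r := P.sendM2 (QkdState.getKeyWithId s.holder s.peer) s.holder
                (keys s.holder).2 s.peer s' m2 st.qkd
              PMF.pure (r.1.isSome, ({ st with qkd := r.2 } : P.GameState N).setSession sid
                { s with m2 := some m2, key := r.1 })
          | _, _ => PMF.pure (false, st)
  | .reveal sid, st =>
      match st.sessions sid with
      | none => PMF.pure (none, st)
      | some s =>
          match s.key with
          | none => PMF.pure (none, st)
          | some k => PMF.pure (some k, st.setSession sid { s with revealed := true })
  | .revState sid, st => PMF.pure ((st.sessions sid).bind fun s => s.state, st)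
  | .corrupt i, st => PMF.pure ((keys i).2, st)
  | .test sid, st =>
      match st.tested, (st.sessions sid).bind fun s => s.key with
      | none, some k =>
          if b then
            (PMF.uniformOfFintype P.SessKey).bind fun k' =>
              PMF.pure (some k', { st with tested := some sid })
          else PMF.pure (some k, { st with tested := some sid })
      | _, _ => PMF.pure (none, st)
  | .qkdLeak kid, st => PMF.pure ((st.qkd.leak kid).1, { st with qkd := (st.qkd.leak kid).2 })
  | .qkdOverride kid k, st => PMF.pure ((), { st with qkd := st.qkd.override kid k })

/-- The attack is nontrivial: a session was tested, neither its key nor the key of a matching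
session was revealed, and its QKD key is not corrupt. All static secret keys and all states may
have been revealed. -/
def GameState.Nontrivial {P : Suite} {N : ℕ} (st : P.GameState N) : Prop :=
  ∃ sid s m2, st.tested = some sid ∧ st.sessions sid = some s ∧ s.revealed = false ∧
    s.m2 = some m2 ∧ ¬ st.qkd.IsCorrupt m2.kid ∧
    ∀ sid' s', st.sessions sid' = some s' → s.Matches s' → s'.revealed = false

/-- An adversary of the IND-StAA-QKD game with `N` parties, which are numbered `0, …, N - 1`. It
gets the static public keys. -/
abbrev Adversary (P : Suite) (N : ℕ) : Type 1 :=
  (Fin N → P.stat.PK) → OracleAlg (Query P N) (Response P N) Bool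

/-- `1` for the query that establishes a session, and `0` for all other queries. -/
def Query.estCost {P : Suite} {N : ℕ} : Query P N → ℕ
  | .est _ _ => 1
  | _ => 0

/-- The adversary establishes at most `n` sessions. -/
def Adversary.EstablishesAtMost {P : Suite} {N : ℕ} (A : P.Adversary N) (n : ℕ) : Prop :=
  ∀ pks, (A pks).CostAtMost Query.estCost n

open Classical in
/-- The IND-StAA-QKD game with bit `b`. -/
def indStAAQkdGame {N : ℕ} (A : P.Adversary N) (b : Bool) : PMF Bool :=
  (iid P.stat.keyGen N).bind fun keys =>
    ((A fun i => (keys i).1).run (P.oracle N keys b) (GameState.start P N)).bind fun r =>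
      PMF.pure (r.1 && decide r.2.Nontrivial)

/-- The advantage of `A` in distinguishing the two IND-StAA-QKD games. -/
def indStAAQkdAdv {N : ℕ} (A : P.Adversary N) : ℝ :=
  |prTrue (P.indStAAQkdGame A true) - prTrue (P.indStAAQkdGame A false)|

end Suite

end QKDAKE

end

/-! The session key is the exclusive or of the right half of a QKD key with a string derived from
the KEM keys, so an honest QKD key that occurs in no other revealed session acts as a one-time pad.
For an identifier `κ`, call a test hidden (`HiddenTest`) if the tested session uses `κ`, this QKD
key is not corrupt and no session that uses `κ` was revealed. Adding a string `Δ` to the right half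
of the key and to all session keys that use it is invisible in such a run, except in the answer to
the test query. Averaged over a uniform `Δ`, the real session key is as uniform as the random one,
so the probability of output 1 with a hidden test does not depend on the bit
(`ev_hiddenGain_average`).

What remains are nontrivial attacks without a hidden test (`Exposed`): some other session with the
same honest QKD key was revealed, but it does not match the tested one. Identifiers are fresh, so
two responders never share one. An honest key is handed out once, so two initiators never both
accept with it. Hence one of the two sessions is the responder `r` that requested the key and the
other is an accepting initiator. Either their transcripts differ, and the initiator accepted a tag
of the inner MAC on a message that `r` did not tag (`Forged`), or they agree. In the second case
both inner tags agree, and if no decapsulation fails both sides derive the same `k_pqc`, hence the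
same outer tag, and the sessions match after all (`matches_of_not_forged`, `exposed_imp`). The outer
MAC needs no security.

Failures are bounded by a potential on a log of all encapsulations (`ev_loggedOracle_run_le`). The
adversary chooses the peers with the public keys in hand, so each static encapsulation costs the
failure probability of the worst of the `N` key pairs. This is why `N` occurs in the final bound
unless correctness holds for every key pair.

A forgery against `r` gives a MAC forger that guesses `r`, takes the tag of `r` from its oracle, and
simulates the game with an arbitrary MAC key under this identifier (`forgeProb_le_forgerBefore`).
The MAC key is needed again only when an initiator retrieves it to check a tag. The forger stops
there and outputs that message and tag. One attempt suffices, because the key is then used up.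

The sum of these losses is `n_s` times the MAC advantage, the worst static failure probability and
`n_s` times the ephemeral one, which is within the claimed bounds with a factor 2 to spare. -/

open scoped ENNReal

noncomputable section

namespace QKDAKE

/-! ### Expectations -/

/-- The expectation of a nonnegative function. -/
def ev {α : Type} (p : PMF α) (f : α → ℝ≥0∞) : ℝ≥0∞ := ∑' a, p a * f a

open Classical in
/-- The indicator of a proposition. -/
def ind (p : Prop) : ℝ≥0∞ := if p then 1 else 0

theorem ind_of {p : Prop} (h : p) : ind p = 1 := by simp [ind, h]

theorem ind_of_not {p : Prop} (h : ¬ p) : ind p = 0 := by simp [ind, h]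

theorem ind_le_one (p : Prop) : ind p ≤ 1 := by unfold ind; split_ifs <;> simp

theorem ind_mono {p q : Prop} (h : p → q) : ind p ≤ ind q := by
  by_cases hp : p
  · rw [ind_of hp, ind_of (h hp)]
  · rw [ind_of_not hp]; exact zero_le

theorem ind_congr {p q : Prop} (h : p ↔ q) : ind p = ind q := by rw [propext h]

theorem ind_or_le (p q : Prop) : ind (p ∨ q) ≤ ind p + ind q := by
  unfold ind; split_ifs <;> simp_all

section ev

variable {α β : Type}

@[simp] theorem ev_pure (a : α) (f : α → ℝ≥0∞) : ev (PMF.pure a) f = f a := by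
  classical
  unfold ev
  rw [tsum_eq_single a]
  · simp
  · intro b hb; simp [PMF.pure_apply, hb]

@[simp] theorem ev_bind (p : PMF α) (q : α → PMF β) (f : β → ℝ≥0∞) :
    ev (p.bind q) f = ev p fun a => ev (q a) f := by
  unfold ev
  simp only [PMF.bind_apply, ← ENNReal.tsum_mul_right, ← ENNReal.tsum_mul_left]
  rw [ENNReal.tsum_comm]
  simp only [mul_assoc]

theorem ev_map (p : PMF α) (g : α → β) (f : β → ℝ≥0∞) :
    ev (p.map g) f = ev p fun a => f (g a) := by
  simp [← PMF.bind_pure_comp]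

theorem ev_mono_support {p : PMF α} {f g : α → ℝ≥0∞} (h : ∀ a ∈ p.support, f a ≤ g a) :
    ev p f ≤ ev p g := by
  refine ENNReal.tsum_le_tsum fun a => ?_
  by_cases ha : p a = 0
  · simp [ha]
  · gcongr
    exact h a ((PMF.mem_support_iff p a).2 ha)

theorem ev_mono {p : PMF α} {f g : α → ℝ≥0∞} (h : ∀ a, f a ≤ g a) : ev p f ≤ ev p g :=
  ev_mono_support fun a _ => h a

theorem ev_congr_support {p : PMF α} {f g : α → ℝ≥0∞} (h : ∀ a ∈ p.support, f a = g a) :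
    ev p f = ev p g :=
  le_antisymm (ev_mono_support fun a ha => (h a ha).le) (ev_mono_support fun a ha => (h a ha).ge)

@[simp] theorem ev_const (p : PMF α) (c : ℝ≥0∞) : ev p (fun _ => c) = c := by
  simp [ev, ENNReal.tsum_mul_right, p.tsum_coe]

theorem ev_le_of_support {p : PMF α} {f : α → ℝ≥0∞} {c : ℝ≥0∞} (h : ∀ a ∈ p.support, f a ≤ c) :
    ev p f ≤ c :=
  (ev_mono_support h).trans (ev_const p c).le

theorem ev_eq_zero_of_support {p : PMF α} {f : α → ℝ≥0∞} (h : ∀ a ∈ p.support, f a = 0) :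
    ev p f = 0 :=
  le_antisymm (ev_le_of_support fun a ha => (h a ha).le) zero_le

theorem ev_add (p : PMF α) (f g : α → ℝ≥0∞) : (ev p fun a => f a + g a) = ev p f + ev p g := by
  simp [ev, mul_add, ENNReal.tsum_add]

theorem ev_tsum {ι : Type} (p : PMF α) (f : ι → α → ℝ≥0∞) :
    (ev p fun a => ∑' i, f i a) = ∑' i, ev p (f i) := by
  unfold ev
  simp only [← ENNReal.tsum_mul_left]
  rw [ENNReal.tsum_comm]

theorem ev_sum {ι : Type} (s : Finset ι) (p : PMF α) (f : ι → α → ℝ≥0∞) :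
    (ev p fun a => ∑ i ∈ s, f i a) = ∑ i ∈ s, ev p (f i) := by
  classical
  induction s using Finset.induction_on with
  | empty => simp
  | insert i s hi ih => simp [Finset.sum_insert hi, ev_add, ih]

theorem ev_const_mul (p : PMF α) (c : ℝ≥0∞) (f : α → ℝ≥0∞) :
    (ev p fun a => c * f a) = c * ev p f := by
  simp only [ev, ← ENNReal.tsum_mul_left]
  exact tsum_congr fun a => by ring

theorem ev_comm (p : PMF α) (q : PMF β) (f : α → β → ℝ≥0∞) :
    (ev p fun a => ev q (f a)) = ev q fun b => ev p fun a => f a b := by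
  simp only [ev, ← ENNReal.tsum_mul_left]
  rw [ENNReal.tsum_comm]
  exact tsum_congr fun b => tsum_congr fun a => by ring

theorem ev_uniform [Fintype α] [Nonempty α] (f : α → ℝ≥0∞) :
    ev (PMF.uniformOfFintype α) f = (Fintype.card α : ℝ≥0∞)⁻¹ * ∑ a, f a := by
  simp [ev, Finset.mul_sum]

theorem ev_uniform_equiv [Fintype α] [Nonempty α] (e : α ≃ α) (f : α → ℝ≥0∞) :
    (ev (PMF.uniformOfFintype α) fun a => f (e a)) = ev (PMF.uniformOfFintype α) f := by
  rw [ev_uniform, ev_uniform, Equiv.sum_comp e f]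

/-- This is what splits a uniform QKD key into an independent MAC key and session half. -/
theorem ev_uniform_prod {γ : Type} [Fintype α] [Nonempty α] [Fintype β] [Nonempty β] [Fintype γ]
    [Nonempty γ] (e : γ ≃ α × β) (f : α → β → ℝ≥0∞) :
    (ev (PMF.uniformOfFintype γ) fun c => f (e c).1 (e c).2) =
      ev (PMF.uniformOfFintype α) fun a => ev (PMF.uniformOfFintype β) fun b => f a b := by
  simp only [ev_uniform]
  rw [Equiv.sum_comp e (fun x => f x.1 x.2), Fintype.sum_prod_type, Fintype.card_congr e,
    Fintype.card_prod, Nat.cast_mul, ENNReal.mul_inv (by simp) (by simp), ← Finset.mul_sum, mul_assoc]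

/-- Indicators of points separate distributions. With this, equality of two oracle answers can be
proved by a change of variables inside an expectation. -/
theorem ev_ext {p q : PMF α} (h : ∀ f, ev p f = ev q f) : p = q := by
  ext a
  have := h fun b => ind (b = a)
  unfold ev at this
  rw [tsum_eq_single a (fun b hb => by simp [ind, hb]),
    tsum_eq_single a (fun b hb => by simp [ind, hb])] at this
  simpa [ind] using this

theorem ev_ne_top {p : PMF α} {f : α → ℝ≥0∞} (h : ∀ a, f a ≤ 1) : ev p f ≠ ⊤ :=
  ne_top_of_le_ne_top ENNReal.one_ne_top (ev_le_of_support fun a _ => h a)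

theorem prTrue_eq_ev (p : PMF Bool) : prTrue p = (ev p fun b => ind (b = true)).toReal := by
  unfold prTrue ev
  rw [tsum_eq_single true (fun b hb => by simp [ind, hb])]
  simp [ind]

end ev

theorem ev_iid {α : Type} (p : PMF α) (n : ℕ) (i : Fin n) (f : α → ℝ≥0∞) :
    (ev (iid p n) fun v => f (v i)) = ev p f := by
  induction n with
  | zero => exact i.elim0
  | succ n ih =>
    simp only [iid, ev_bind, ev_pure]
    refine Fin.cases ?_ (fun j => ?_) i
    · simp
    · simpa using ih j

theorem mem_support_of_mem_support_iid {α : Type} (p : PMF α) (n : ℕ) (v : Fin n → α)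
    (hv : v ∈ (iid p n).support) (i : Fin n) : v i ∈ p.support := by
  induction n with
  | zero => exact i.elim0
  | succ n ih =>
    simp only [iid, PMF.mem_support_bind_iff, PMF.support_pure, Set.mem_singleton_iff] at hv
    obtain ⟨a, ha, w, hw, rfl⟩ := hv
    refine Fin.cases ?_ (fun j => ?_) i
    · simpa using ha
    · simpa using ih w hw j

/-! ### Runs of oracle algorithms -/

namespace OracleAlg

variable {Q : Type} {R : Q → Type} {α σ τ : Type}

@[simp] theorem ev_run_done (oracle : (q : Q) → σ → PMF (R q × σ)) (a : α) (st : σ)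
    (f : α × σ → ℝ≥0∞) : ev ((done a : OracleAlg Q R α).run oracle st) f = f (a, st) := by
  simp [run]

@[simp] theorem ev_run_sample (oracle : (q : Q) → σ → PMF (R q × σ)) {β : Type} (p : PMF β)
    (k : β → OracleAlg Q R α) (st : σ) (f : α × σ → ℝ≥0∞) :
    ev ((sample p k).run oracle st) f = ev p fun x => ev ((k x).run oracle st) f := by
  simp [run]

@[simp] theorem ev_run_ask (oracle : (q : Q) → σ → PMF (R q × σ)) (q : Q)
    (k : R q → OracleAlg Q R α) (st : σ) (f : α × σ → ℝ≥0∞) :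
    ev ((ask q k).run oracle st) f =
      ev (oracle q st) fun r => ev ((k r.1).run oracle r.2) f := by
  simp [run]

theorem inv_of_mem_support_run (oracle : (q : Q) → σ → PMF (R q × σ)) {Inv : σ → Prop}
    (hstep : ∀ q st, Inv st → ∀ r ∈ (oracle q st).support, Inv r.2) (alg : OracleAlg Q R α) :
    ∀ st, Inv st → ∀ r ∈ (alg.run oracle st).support, Inv r.2 := by
  induction alg with
  | done a => intro st h r hr; simp only [run, PMF.support_pure, Set.mem_singleton_iff] at hr; rwa [hr]
  | sample p k ih =>
    intro st h r hr
    simp only [run, PMF.mem_support_bind_iff] at hr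
    obtain ⟨x, -, hr⟩ := hr
    exact ih x st h r hr
  | ask q k ih =>
    intro st h r hr
    simp only [run, PMF.mem_support_bind_iff] at hr
    obtain ⟨x, hx, hr⟩ := hr
    exact ih x.1 x.2 (hstep q st h x hx) r hr

/-- An invariant that may depend on the number of queries left. -/
theorem inv_of_mem_support_run_of_costAtMost {oracle : (q : Q) → σ → PMF (R q × σ)} {cost : Q → ℕ}
    {Inv : ℕ → σ → Prop}
    (hstep : ∀ n q st, Inv n st → cost q ≤ n → ∀ r ∈ (oracle q st).support, Inv (n - cost q) r.2)
    (alg : OracleAlg Q R α) :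
    ∀ n st, alg.CostAtMost cost n → Inv n st →
      ∀ r ∈ (alg.run oracle st).support, ∃ m, Inv m r.2 := by
  induction alg with
  | done a =>
    intro n st _ h r hr
    simp only [run, PMF.support_pure, Set.mem_singleton_iff] at hr
    exact ⟨n, by rwa [hr]⟩
  | sample p k ih =>
    intro n st hc h r hr
    simp only [run, PMF.mem_support_bind_iff] at hr
    obtain ⟨x, -, hr⟩ := hr
    exact ih x n st (hc x) h r hr
  | ask q k ih =>
    intro n st hc h r hr
    simp only [run, PMF.mem_support_bind_iff] at hr
    obtain ⟨x, hx, hr⟩ := hr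
    exact ih x.1 (n - cost q) x.2 (hc.2 x.1) (hstep n q st h hc.1 x hx) r hr

/-- A potential that does not increase on average bounds the expectation at the end of a run. -/
theorem ev_run_le_potential {oracle : (q : Q) → σ → PMF (R q × σ)} {Inv : σ → Prop}
    (hstep : ∀ q st, Inv st → ∀ r ∈ (oracle q st).support, Inv r.2) {φ : σ → ℝ≥0∞}
    (hφ : ∀ q st, Inv st → (ev (oracle q st) fun r => φ r.2) ≤ φ st) {f : α × σ → ℝ≥0∞}
    (hf : ∀ a st, Inv st → f (a, st) ≤ φ st) (alg : OracleAlg Q R α) :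
    ∀ st, Inv st → ev (alg.run oracle st) f ≤ φ st := by
  induction alg with
  | done a => intro st h; simpa using hf a st h
  | sample p k ih =>
    intro st h
    rw [ev_run_sample]
    exact ev_le_of_support fun x _ => ih x st h
  | ask q k ih =>
    intro st h
    rw [ev_run_ask]
    exact (ev_mono_support fun r hr => ih r.1 r.2 (hstep q st h r hr)).trans (hφ q st h)

/-- Runs with an oracle that keeps more information in its state. -/
theorem ev_run_of_projection {oracle : (q : Q) → σ → PMF (R q × σ)}
    {oracle' : (q : Q) → τ → PMF (R q × τ)} {π : τ → σ}
    (h : ∀ q st, (oracle' q st).map (fun r => (r.1, π r.2)) = oracle q (π st))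
    (f : α × σ → ℝ≥0∞) (alg : OracleAlg Q R α) :
    ∀ st, (ev (alg.run oracle' st) fun r => f (r.1, π r.2)) = ev (alg.run oracle (π st)) f := by
  induction alg with
  | done a => intro st; simp
  | sample p k ih => intro st; simp [ih]
  | ask q k ih => intro st; simp [ih, ← h, ev_map]

end OracleAlg

namespace Suite

variable {P : Suite} {N : ℕ}

/-! ### Transitions of the game -/

/-- The key that the initiator `s` derives from its state and a second message. -/
def Session.kpqc (keys : Fin N → P.stat.PK × P.stat.SK) (s : P.Session N) (s' : P.IState)
    (m2 : P.Msg2) : Bits (P.lenMacPqc + P.lenSess) :=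
  P.kdf s'.kb (P.stat.decaps (keys s.holder).2 m2.ca) (P.eph.decaps s'.ske m2.ce)

/-- The transcript that belongs to two messages. -/
def transcript (m1 : Msg1 P.stat P.eph) (m2 : P.Msg2) : Transcript P.stat P.eph :=
  ⟨m1, m2.ca, m2.ce, m2.kid⟩

/-- The tags in `m2` are valid for the initiator `s` with QKD key `k`. -/
def Session.TagsValid (keys : Fin N → P.stat.PK × P.stat.SK) (s : P.Session N) (s' : P.IState)
    (m2 : P.Msg2) (k : P.QkdKey) : Prop :=
  P.macQkd.tag k.left (transcript s'.m1 m2, s.holder, s.peer) = m2.tag1 ∧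
    P.macPqc.tag (s.kpqc keys s' m2).left (transcript s'.m1 m2, m2.tag1, s.holder, s.peer) =
      m2.tag2

/-- Responder `s` of a game in state `st`, after answering `m1` with the given random choices. -/
def responderPost (P : Suite) {N : ℕ} (keys : Fin N → P.stat.PK × P.stat.SK) (st : P.GameState N)
    (s : P.Session N) (m1 : Msg1 P.stat P.eph) (a : P.stat.CT × P.stat.Key)
    (e : P.eph.CT × P.eph.Key) (k : P.QkdKey) : P.Msg2 × P.SessKey :=
  let c := P.combine s.peer s.holder ⟨m1, a.1, e.1, st.qkd.nextKid⟩ k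
    (P.kdf (P.stat.decaps (keys s.holder).2 m1.cb) a.2 e.2)
  (⟨a.1, e.1, st.qkd.nextKid, c.2.1, c.2.2⟩, c.1)

/-- The state of the game after a first message was answered. -/
def GameState.answer (st : P.GameState N) (sid : ℕ) (s : P.Session N) (m1 : Msg1 P.stat P.eph)
    (r : P.Msg2 × P.SessKey) (k : P.QkdKey) : P.GameState N :=
  ({ st with qkd := st.qkd.set st.qkd.nextKid k (.waiting s.holder s.peer) } :
    P.GameState N).setSession sid
      { s with role := some .responder, m1 := some m1, m2 := some r.1, key := some r.2 }

/-- The state of the game after a session was initiated. -/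
def GameState.initiated (st : P.GameState N) (sid : ℕ) (s : P.Session N)
    (r : Msg1 P.stat P.eph × P.IState) : P.GameState N :=
  st.setSession sid { s with role := some .initiator, m1 := some r.1, state := some r.2 }

/-- `Step keys st q st'`: the query `q` can change the state of the game from `st` to `st'`. -/
inductive Step (keys : Fin N → P.stat.PK × P.stat.SK) (st : P.GameState N) :
    Query P N → P.GameState N → Prop
  | noop (q) : Step keys st q st
  | est (i j : Fin N) : Step keys st (.est i j)
      { st with
          numSessions := st.numSessions + 1
          sessions := Function.update st.sessions st.numSessions
            (some { holder := i, peer := j }) }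
  | init (sid : ℕ) (s : P.Session N) (r : Msg1 P.stat P.eph × P.IState)
      (hs : st.sessions sid = some s) (hr : s.role = none) (hm : r.2.m1 = r.1) :
      Step keys st (.init sid) (st.initiated sid s r)
  | sendM1 (sid : ℕ) (s : P.Session N) (m1 : Msg1 P.stat P.eph) (a : P.stat.CT × P.stat.Key)
      (e : P.eph.CT × P.eph.Key) (k : P.QkdKey) (hs : st.sessions sid = some s)
      (hr : s.role = none) :
      Step keys st (.sendM1 sid m1) (st.answer sid s m1 (responderPost P keys st s m1 a e k) k)
  | sendM2 (sid : ℕ) (s : P.Session N) (s' : P.IState) (m2 : P.Msg2) (key : Option P.SessKey)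
      (hs : st.sessions sid = some s) (hs' : s.state = some s') (hm : s.m2 = none)
      (hk : key ≠ none → ∃ k,
        (st.qkd.getKeyWithId s.holder s.peer m2.kid).1 = some k ∧ s.TagsValid keys s' m2 k) :
      Step keys st (.sendM2 sid m2)
        (({ st with qkd := (st.qkd.getKeyWithId s.holder s.peer m2.kid).2 } :
          P.GameState N).setSession sid { s with m2 := some m2, key := key })
  | reveal (sid : ℕ) (s : P.Session N) (hs : st.sessions sid = some s) (hk : s.key ≠ none) :
      Step keys st (.reveal sid) (st.setSession sid { s with revealed := true })
  | test (sid : ℕ) (s : P.Session N) (hs : st.sessions sid = some s) (hk : s.key ≠ none)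
      (ht : st.tested = none) : Step keys st (.test sid) { st with tested := some sid }
  | leak (kid : ℕ) (k : P.QkdKey) (f : KeyFlag) (hk : st.qkd.keys kid = some (k, f)) :
      Step keys st (.qkdLeak kid) { st with qkd := st.qkd.set kid k .corrupt }
  | override (kid : ℕ) (k : P.QkdKey) :
      Step keys st (.qkdOverride kid k) { st with qkd := st.qkd.set kid k .corrupt }

/-! ### Closed forms of the oracle answers and the transitions they allow -/

theorem oracle_init (keys : Fin N → P.stat.PK × P.stat.SK) (b : Bool) (st : P.GameState N)
    (sid : ℕ) (s : P.Session N) (hs : st.sessions sid = some s) (hr : s.role = none) :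
    P.oracle N keys b (.init sid) st = (P.initiate (keys s.peer).1).bind fun r =>
      PMF.pure (some r.1, st.initiated sid s r) := by
  simp only [oracle, hs, hr, if_true]
  rfl

theorem oracle_sendM1 (keys : Fin N → P.stat.PK × P.stat.SK) (b : Bool) (st : P.GameState N)
    (sid : ℕ) (m1 : Msg1 P.stat P.eph) (s : P.Session N) (hs : st.sessions sid = some s)
    (hr : s.role = none) :
    P.oracle N keys b (.sendM1 sid m1) st =
      (P.stat.encaps (keys s.peer).1).bind fun a => (P.eph.encaps m1.pke).bind fun e =>
        (PMF.uniformOfFintype P.QkdKey).bind fun k =>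
          PMF.pure (some (responderPost P keys st s m1 a e k).1,
            st.answer sid s m1 (responderPost P keys st s m1 a e k) k) := by
  simp only [oracle, hs, hr, if_true, sendM1, QkdState.getKey, PMF.bind_bind, PMF.pure_bind]
  rfl

-- The outer tag is checked on the recomputed inner tag in the protocol, but on the received one in
-- `TagsValid`. Given that the first check succeeds, the two are equal.
open Classical in
theorem sendM2_fst (keys : Fin N → P.stat.PK × P.stat.SK) (s : P.Session N) (s' : P.IState)
    (m2 : P.Msg2) (qs : P.QkdState) :
    (P.sendM2 (QkdState.getKeyWithId s.holder s.peer) s.holder (keys s.holder).2 s.peer s' m2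
      qs).1 = (qs.getKeyWithId s.holder s.peer m2.kid).1.bind fun k =>
        if s.TagsValid keys s' m2 k then some (Bits.xor k.right (s.kpqc keys s' m2).right)
        else none := by
  cases hg : qs.getKeyWithId s.holder s.peer m2.kid with
  | mk o st' =>
    cases o with
    | none => simp [sendM2, hg]
    | some k =>
      have hc : ∀ c : P.SessKey × P.macQkd.Tag × P.macPqc.Tag,
          c = P.combine s.holder s.peer ⟨s'.m1, m2.ca, m2.ce, m2.kid⟩ k (s.kpqc keys s' m2) →
          (c.2.1 = m2.tag1 ∧ c.2.2 = m2.tag2 ↔ s.TagsValid keys s' m2 k) := by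
        rintro c rfl
        refine and_congr_right fun h => ?_
        change P.macPqc.tag _ (_, P.macQkd.tag k.left (transcript s'.m1 m2, s.holder, s.peer), _) = _
          ↔ _
        rw [show P.macQkd.tag k.left (transcript s'.m1 m2, s.holder, s.peer) = m2.tag1 from h]
        rfl
      simp only [sendM2, hg, Option.bind_some]
      by_cases h : s.TagsValid keys s' m2 k
      · rw [if_pos h]
        split_ifs with h'
        · rfl
        · exact absurd ((hc _ rfl).2 h) h'
      · rw [if_neg h]
        split_ifs with h'
        · exact absurd ((hc _ rfl).1 h') h
        · rfl

theorem oracle_sendM2 (keys : Fin N → P.stat.PK × P.stat.SK) (b : Bool) (st : P.GameState N)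
    (sid : ℕ) (m2 : P.Msg2) (s : P.Session N) (s' : P.IState) (hs : st.sessions sid = some s)
    (hs' : s.state = some s') (hm : s.m2 = none) :
    P.oracle N keys b (.sendM2 sid m2) st =
      PMF.pure ((P.sendM2 (QkdState.getKeyWithId s.holder s.peer) s.holder
          (keys s.holder).2 s.peer s' m2 st.qkd).1.isSome,
        ({ st with qkd := (st.qkd.getKeyWithId s.holder s.peer m2.kid).2 } :
          P.GameState N).setSession sid
            { s with
              m2 := some m2
              key := (P.sendM2 (QkdState.getKeyWithId s.holder s.peer) s.holder
                (keys s.holder).2 s.peer s' m2 st.qkd).1 }) := by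
  -- Retrieval changes the QKD state in the same way whether or not the tags are accepted: an honest
  -- key is used up even by a failed check.
  have : (P.sendM2 (QkdState.getKeyWithId s.holder s.peer) s.holder
      (keys s.holder).2 s.peer s' m2 st.qkd).2 =
        (st.qkd.getKeyWithId s.holder s.peer m2.kid).2 := by
    cases hg : st.qkd.getKeyWithId s.holder s.peer m2.kid with
    | mk o st' =>
      cases o with
      | none => simp [sendM2, hg]
      | some k => simp only [sendM2, hg]; split_ifs <;> rfl
  rw [← this]
  obtain ⟨_, _, _, _, _, _, _, _⟩ := s
  subst hs' hm
  simp only [oracle, hs]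
  rfl

theorem oracle_sendM2_noop (keys : Fin N → P.stat.PK × P.stat.SK) (b : Bool) (st : P.GameState N)
    (sid : ℕ) (m2 : P.Msg2)
    (h : ∀ s s', st.sessions sid = some s → s.state = some s' → s.m2 ≠ none) :
    P.oracle N keys b (.sendM2 sid m2) st = PMF.pure (false, st) := by
  cases hs : st.sessions sid with
  | none => simp only [oracle, hs]; rfl
  | some s =>
    cases hs' : s.state with
    | none => simp only [oracle, hs, hs']; rfl
    | some s' =>
      cases hm : s.m2 with
      | some _ => simp only [oracle, hs, hs', hm]; rfl
      | none => exact absurd hm (h s s' hs hs')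

theorem oracle_reveal (keys : Fin N → P.stat.PK × P.stat.SK) (b : Bool) (st : P.GameState N)
    (sid : ℕ) (s : P.Session N) (k : P.SessKey) (hs : st.sessions sid = some s)
    (hk : s.key = some k) :
    P.oracle N keys b (.reveal sid) st =
      PMF.pure (some k, st.setSession sid { s with revealed := true }) := by
  obtain ⟨_, _, _, _, _, _, _, _⟩ := s
  subst hk
  simp only [oracle, hs]
  rfl

/-- Invariants need only the possible transitions. `Step` forgets probabilities, answers and the bit
of the game, so each invariant is checked once for both games. -/
theorem step_of_mem_support_oracle {keys : Fin N → P.stat.PK × P.stat.SK} {b : Bool}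
    {q : Query P N} {st : P.GameState N} {r : Response P N q × P.GameState N}
    (h : r ∈ (P.oracle N keys b q st).support) : Step keys st q r.2 := by
  cases q with
  | est i j =>
    simp only [oracle, PMF.support_pure, Set.mem_singleton_iff] at h
    subst h; exact .est i j
  | init sid =>
    cases hs : st.sessions sid with
    | none =>
      simp only [oracle, hs, PMF.support_pure, Set.mem_singleton_iff] at h
      subst h; exact .noop _
    | some s =>
      by_cases hr : s.role = none
      · rw [oracle_init keys b st sid s hs hr] at h
        obtain ⟨x, hx, h⟩ := (PMF.mem_support_bind_iff _ _ _).1 h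
        rw [(PMF.mem_support_pure_iff _ _).1 h]
        simp only [initiate, PMF.mem_support_bind_iff, PMF.support_pure,
          Set.mem_singleton_iff] at hx
        obtain ⟨_, -, _, -, rfl⟩ := hx
        exact .init sid s _ hs hr rfl
      · simp only [oracle, hs, hr, PMF.support_pure, Set.mem_singleton_iff, if_false] at h
        subst h; exact .noop _
  | sendM1 sid m1 =>
    cases hs : st.sessions sid with
    | none =>
      simp only [oracle, hs, PMF.support_pure, Set.mem_singleton_iff] at h
      subst h; exact .noop _
    | some s =>
      by_cases hr : s.role = none
      · rw [oracle_sendM1 keys b st sid m1 s hs hr] at h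
        obtain ⟨a, -, h⟩ := (PMF.mem_support_bind_iff _ _ _).1 h
        obtain ⟨e, -, h⟩ := (PMF.mem_support_bind_iff _ _ _).1 h
        obtain ⟨k, -, h⟩ := (PMF.mem_support_bind_iff _ _ _).1 h
        rw [(PMF.mem_support_pure_iff _ _).1 h]
        exact .sendM1 sid s m1 a e k hs hr
      · simp only [oracle, hs, hr, PMF.support_pure, Set.mem_singleton_iff, if_false] at h
        subst h; exact .noop _
  | sendM2 sid m2 =>
    by_cases hn : ∀ s s', st.sessions sid = some s → s.state = some s' → s.m2 ≠ none
    · rw [oracle_sendM2_noop keys b st sid m2 hn] at h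
      rw [(PMF.mem_support_pure_iff _ _).1 h]
      exact .noop _
    · push Not at hn
      obtain ⟨s, s', hs, hs', hm⟩ := hn
      rw [oracle_sendM2 keys b st sid m2 s s' hs hs' hm] at h
      rw [(PMF.mem_support_pure_iff _ _).1 h]
      refine .sendM2 sid s s' m2 _ hs hs' hm fun hk => ?_
      rw [sendM2_fst] at hk
      obtain ⟨k, hk⟩ := Option.ne_none_iff_exists'.1 hk
      obtain ⟨k', hk', hv⟩ := Option.bind_eq_some_iff.1 hk
      refine ⟨k', hk', ?_⟩
      by_contra hc
      rw [if_neg hc] at hv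
      exact absurd hv (by simp)
  | reveal sid =>
    cases hs : st.sessions sid with
    | none =>
      simp only [oracle, hs, PMF.support_pure, Set.mem_singleton_iff] at h
      subst h; exact .noop _
    | some s =>
      cases hk : s.key with
      | none =>
        simp only [oracle, hs, hk, PMF.support_pure, Set.mem_singleton_iff] at h
        subst h; exact .noop _
      | some k =>
        rw [oracle_reveal keys b st sid s k hs hk] at h
        rw [(PMF.mem_support_pure_iff _ _).1 h]
        exact .reveal sid s hs (by simp [hk])
  | revState sid =>
    simp only [oracle, PMF.support_pure, Set.mem_singleton_iff] at h
    subst h; exact .noop _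
  | corrupt i =>
    simp only [oracle, PMF.support_pure, Set.mem_singleton_iff] at h
    subst h; exact .noop _
  | test sid =>
    cases ht : st.tested with
    | some _ =>
      simp only [oracle, ht, PMF.support_pure, Set.mem_singleton_iff] at h
      subst h; exact .noop _
    | none =>
      cases hk : (st.sessions sid).bind fun s => s.key with
      | none =>
        simp only [oracle, ht, hk, PMF.support_pure, Set.mem_singleton_iff] at h
        subst h; exact .noop _
      | some k =>
        obtain ⟨s, hs, hk'⟩ := Option.bind_eq_some_iff.1 hk
        have key := Step.test (keys := keys) sid s hs (by simp [hk']) ht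
        cases b with
        | false =>
          simp only [oracle, ht, hk, Bool.false_eq_true, if_false] at h
          rw [(PMF.mem_support_pure_iff _ _).1 h]
          exact key
        | true =>
          simp only [oracle, ht, hk, if_true] at h
          obtain ⟨_, -, h⟩ := (PMF.mem_support_bind_iff _ _ _).1 h
          rw [(PMF.mem_support_pure_iff _ _).1 h]
          exact key
  | qkdLeak kid =>
    simp only [oracle, PMF.support_pure, Set.mem_singleton_iff] at h
    subst h
    cases hk : st.qkd.keys kid with
    | none => simp only [QkdState.leak, hk]; exact .noop _
    | some kf =>
      simp only [QkdState.leak, hk]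
      exact .leak kid kf.1 kf.2 hk
  | qkdOverride kid k =>
    simp only [oracle, PMF.support_pure, Set.mem_singleton_iff] at h
    subst h
    exact .override kid k

/-- There are three outcomes: refusal, a corrupt key with the state unchanged, or an honest waiting
key that becomes delivered. Only the last one affects honest keys. -/
theorem getKeyWithId_cases (qs : P.QkdState) (i j kid : ℕ) :
    (qs.getKeyWithId i j kid).1 = none ∧ (qs.getKeyWithId i j kid).2 = qs ∨
    (∃ k, qs.keys kid = some (k, .corrupt) ∧ (qs.getKeyWithId i j kid).1 = some k ∧
      (qs.getKeyWithId i j kid).2 = qs) ∨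
    ∃ k, qs.keys kid = some (k, .waiting j i) ∧ (qs.getKeyWithId i j kid).1 = some k ∧
      (qs.getKeyWithId i j kid).2 = qs.set kid k .delivered := by
  unfold QkdState.getKeyWithId
  split
  · rename_i k i' j' h
    split_ifs with hc
    · obtain ⟨rfl, rfl⟩ := hc
      exact .inr (.inr ⟨k, h, rfl, rfl⟩)
    · exact .inl ⟨rfl, rfl⟩
  · rename_i k h
    exact .inr (.inl ⟨k, h, rfl, rfl⟩)
  · exact .inl ⟨rfl, rfl⟩
  · exact .inl ⟨rfl, rfl⟩

/-! ### Invariants of the game -/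

/-- The key of a session was accepted by an initiator after the second message `m2`. -/
structure Session.InitiatorAccepted (s : P.Session N) (s' : P.IState) (m2 : P.Msg2) : Prop where
  role : s.role = some .initiator
  state : s.state = some s'
  m2 : s.m2 = some m2
  key : s.key ≠ none

/-- The session answered `m1` with `m2`. -/
structure Session.Responded (s : P.Session N) (m1 : Msg1 P.stat P.eph) (m2 : P.Msg2) : Prop where
  role : s.role = some .responder
  m1 : s.m1 = some m1
  m2 : s.m2 = some m2

/-- A key and its flag that is not corrupt. -/
def GameState.HonestKey (st : P.GameState N) (kid : ℕ) (k : P.QkdKey) (f : KeyFlag) : Prop :=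
  st.qkd.keys kid = some (k, f) ∧ f ≠ .corrupt

/-- Invariants of the book-keeping. -/
structure Basic (st : P.GameState N) : Prop where
  lt : ∀ sid s, st.sessions sid = some s → sid < st.numSessions
  fresh : ∀ sid s, st.sessions sid = some s → s.role = none →
    s.m2 = none ∧ s.state = none ∧ s.key = none
  ini : ∀ sid s, st.sessions sid = some s → s.role = some .initiator →
    ∃ s', s.state = some s' ∧ s.m1 = some s'.m1
  res : ∀ sid s, st.sessions sid = some s → s.role = some .responder → s.state = none ∧
    ∃ m1 m2, s.m1 = some m1 ∧ s.m2 = some m2 ∧ st.qkd.keys m2.kid ≠ none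
  key_m2 : ∀ sid s, st.sessions sid = some s → s.key ≠ none →
    ∃ m2, s.m2 = some m2 ∧ st.qkd.keys m2.kid ≠ none
  revealed_key : ∀ sid s, st.sessions sid = some s → s.revealed = true → s.key ≠ none
  tested : ∀ sid, st.tested = some sid → ∃ s, st.sessions sid = some s ∧ s.key ≠ none
  kid_lt : ∀ kid, st.qkd.keys kid ≠ none → kid < st.qkd.nextKid

/-- The invariants of the game. -/
structure WF (keys : Fin N → P.stat.PK × P.stat.SK) (st : P.GameState N) : Prop
    extends Basic st where
  res_unique : ∀ a b sa sb m1a m2a m1b m2b, st.sessions a = some sa → st.sessions b = some sb →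
    sa.Responded m1a m2a → sb.Responded m1b m2b → m2a.kid = m2b.kid → a = b
  res_tag : ∀ b sb m1 m2 k f, st.sessions b = some sb → sb.Responded m1 m2 →
    st.HonestKey m2.kid k f →
      P.macQkd.tag k.left (transcript m1 m2, sb.peer, sb.holder) = m2.tag1
  res_flag : ∀ b sb m1 m2 k i j, st.sessions b = some sb → sb.Responded m1 m2 →
    st.HonestKey m2.kid k (.waiting i j) → i = sb.holder ∧ j = sb.peer
  acc_tag : ∀ a sa s' m2 k f, st.sessions a = some sa → sa.InitiatorAccepted s' m2 →
    st.HonestKey m2.kid k f → f = .delivered ∧ sa.TagsValid keys s' m2 k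
  acc_unique : ∀ a b sa sb s'a m2a s'b m2b k f, st.sessions a = some sa →
    st.sessions b = some sb → sa.InitiatorAccepted s'a m2a → sb.InitiatorAccepted s'b m2b →
      m2a.kid = m2b.kid → st.HonestKey m2b.kid k f → a = b
  acc_res : ∀ a b sa sb s' m2a m1 m2b k f, st.sessions a = some sa → st.sessions b = some sb →
    sa.InitiatorAccepted s' m2a → sb.Responded m1 m2b → m2a.kid = m2b.kid →
      st.HonestKey m2b.kid k f → sa.holder = sb.peer ∧ sa.peer = sb.holder

theorem wf_start (keys : Fin N → P.stat.PK × P.stat.SK) : WF keys (GameState.start P N) := by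
  constructor
  · constructor <;> simp [GameState.start]
  all_goals simp [GameState.start]

theorem getKeyWithId_keys (qs : P.QkdState) (i j kid : ℕ) :
    (∀ kid', (qs.getKeyWithId i j kid).2.keys kid' ≠ none ↔ qs.keys kid' ≠ none) ∧
      qs.nextKid ≤ (qs.getKeyWithId i j kid).2.nextKid ∧
      ((qs.getKeyWithId i j kid).1 ≠ none → qs.keys kid ≠ none) := by
  rcases getKeyWithId_cases qs i j kid with ⟨h1, h2⟩ | ⟨k, h, h1, h2⟩ | ⟨k, h, h1, h2⟩
  · simp [h1, h2]
  · simp [h1, h2, h]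
  · simp only [h1, h2, h, QkdState.set, Function.update_apply]
    grind

theorem basic_sendM2 {keys : Fin N → P.stat.PK × P.stat.SK} {st : P.GameState N} (h : Basic st)
    (sid : ℕ) (s : P.Session N) (s' : P.IState) (m2 : P.Msg2) (key : Option P.SessKey)
    (hs : st.sessions sid = some s) (hs' : s.state = some s') (hm : s.m2 = none)
    (hk : key ≠ none → ∃ k,
      (st.qkd.getKeyWithId s.holder s.peer m2.kid).1 = some k ∧ s.TagsValid keys s' m2 k) :
    Basic (({ st with qkd := (st.qkd.getKeyWithId s.holder s.peer m2.kid).2 } :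
          P.GameState N).setSession sid { s with m2 := some m2, key := key }) := by
  obtain ⟨h1, h2, h3, h4, h5, h6, h7, h8⟩ := h
  have hkey : s.key = none := by
    by_contra hk
    obtain ⟨_, hm', -⟩ := h5 _ _ hs hk
    simp [hm] at hm'
  have hrev : ¬ s.revealed = true := fun hr => h6 _ _ hs hr hkey
  have hr1 : s.role ≠ none := fun hr => by simpa [hs'] using (h2 _ _ hs hr).2.1
  have hr2 : s.role ≠ some .responder := fun hr => by simpa [hs'] using (h4 _ _ hs hr).1
  obtain ⟨hq1, hq2, hq3⟩ := getKeyWithId_keys st.qkd s.holder s.peer m2.kid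
  have hk' : key ≠ none → st.qkd.keys m2.kid ≠ none := fun h => hq3 <| by
    obtain ⟨k, hk, -⟩ := hk h
    simp [hk]
  clear hk hq3
  generalize (st.qkd.getKeyWithId s.holder s.peer m2.kid).2 = g at hq1 hq2
  constructor
  all_goals simp only [GameState.setSession, Function.update_apply]
  · clear h2 h3 h4 h5 h6 h7 h8; grind
  · clear h3 h4 h5 h6 h7 h8; grind
  · clear h2 h4 h5 h6 h7 h8; grind
  · clear h2 h3 h5 h6 h7 h8; grind
  · clear h2 h3 h4 h6 h7 h8; grind
  · clear h2 h3 h4 h5 h7 h8; grind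
  · clear h2 h3 h4 h5 h6 h8; grind
  · clear h2 h3 h4 h5 h6 h7; grind

set_option maxHeartbeats 2000000 in
theorem basic_step {keys : Fin N → P.stat.PK × P.stat.SK} {st st' : P.GameState N} {q : Query P N}
    (h : Basic st) (hs : Step keys st q st') : Basic st' := by
  obtain ⟨h1, h2, h3, h4, h5, h6, h7, h8⟩ := h
  cases hs with
  | noop => exact ⟨h1, h2, h3, h4, h5, h6, h7, h8⟩
  | est i j =>
    constructor
    all_goals simp only [Function.update_apply]
    all_goals grind
  | init sid s r hs hr hm =>
    constructor
    all_goals simp only [GameState.initiated, GameState.setSession, Function.update_apply]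
    all_goals grind
  | sendM1 sid s m1 a e k hs hr =>
    constructor
    all_goals simp only [GameState.answer, GameState.setSession, QkdState.set,
      Function.update_apply, responderPost]
    all_goals grind
  | sendM2 sid s s' m2 key hs hs' hm hk =>
    exact basic_sendM2 ⟨h1, h2, h3, h4, h5, h6, h7, h8⟩ sid s s' m2 key hs hs' hm hk
  | reveal sid s hs hk =>
    constructor
    all_goals simp only [GameState.setSession, Function.update_apply]
    all_goals grind
  | test sid s hs hk ht =>
    constructor
    all_goals grind
  | leak kid k f hk =>
    constructor
    all_goals simp only [QkdState.set, Function.update_apply]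
    all_goals grind
  | override kid k =>
    constructor
    all_goals simp only [QkdState.set, Function.update_apply]
    all_goals grind

/-- Everything that is relevant for the honest keys in `st'` is already present in `st`. -/
structure Frame (st st' : P.GameState N) : Prop where
  res : ∀ b sb m1 m2, st'.sessions b = some sb → sb.Responded m1 m2 → ∃ sb0,
    st.sessions b = some sb0 ∧ sb0.Responded m1 m2 ∧ sb0.holder = sb.holder ∧ sb0.peer = sb.peer
  acc : ∀ a sa s' m2, st'.sessions a = some sa → sa.InitiatorAccepted s' m2 → ∃ sa0,
    st.sessions a = some sa0 ∧ sa0.InitiatorAccepted s' m2 ∧ sa0.holder = sa.holder ∧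
      sa0.peer = sa.peer
  key : ∀ kid k f, st'.HonestKey kid k f → st.HonestKey kid k f

/-- Beyond the book-keeping, every clause of `WF` is universal over responders, accepting initiators
and honest keys. A transition that creates none of these therefore preserves all clauses. -/
theorem wf_of_frame {keys : Fin N → P.stat.PK × P.stat.SK} {st st' : P.GameState N}
    (h : WF keys st) (hf : Frame st st') (hb : Basic st') : WF keys st' where
  toBasic := hb
  res_unique := by
    intro a b sa sb m1a m2a m1b m2b ha hb ra rb hk
    obtain ⟨sa0, ha, ra, -⟩ := hf.res _ _ _ _ ha ra
    obtain ⟨sb0, hb, rb, -⟩ := hf.res _ _ _ _ hb rb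
    exact h.res_unique _ _ _ _ _ _ _ _ ha hb ra rb hk
  res_tag := by
    intro b sb m1 m2 k f hb rb hk
    obtain ⟨sb0, hb, rb, h1, h2⟩ := hf.res _ _ _ _ hb rb
    rw [← h1, ← h2]
    exact h.res_tag _ _ _ _ _ _ hb rb (hf.key _ _ _ hk)
  res_flag := by
    intro b sb m1 m2 k i j hb rb hk
    obtain ⟨sb0, hb, rb, h1, h2⟩ := hf.res _ _ _ _ hb rb
    rw [← h1, ← h2]
    exact h.res_flag _ _ _ _ _ _ _ hb rb (hf.key _ _ _ hk)
  acc_tag := by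
    intro a sa s' m2 k f ha ra hk
    obtain ⟨sa0, ha, ra, h1, h2⟩ := hf.acc _ _ _ _ ha ra
    have := h.acc_tag _ _ _ _ _ _ ha ra (hf.key _ _ _ hk)
    rwa [Session.TagsValid, Session.kpqc, h1, h2] at this
  acc_unique := by
    intro a b sa sb s'a m2a s'b m2b k f ha hb ra rb hkid hk
    obtain ⟨sa0, ha, ra, -⟩ := hf.acc _ _ _ _ ha ra
    obtain ⟨sb0, hb, rb, -⟩ := hf.acc _ _ _ _ hb rb
    exact h.acc_unique _ _ _ _ _ _ _ _ _ _ ha hb ra rb hkid (hf.key _ _ _ hk)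
  acc_res := by
    intro a b sa sb s' m2a m1 m2b k f ha hb ra rb hkid hk
    obtain ⟨sa0, ha, ra, h1, h2⟩ := hf.acc _ _ _ _ ha ra
    obtain ⟨sb0, hb, rb, h3, h4⟩ := hf.res _ _ _ _ hb rb
    rw [← h1, ← h2, ← h3, ← h4]
    exact h.acc_res _ _ _ _ _ _ _ _ _ _ ha hb ra rb hkid (hf.key _ _ _ hk)

/-- The new key gets the identifier `nextKid`, which exceeds every identifier in use. So no older
responder or accepting initiator can conflict with the new responder, and the flag, key and tag of
the new session fit by construction. -/
theorem wf_sendM1 {keys : Fin N → P.stat.PK × P.stat.SK} {st : P.GameState N} (h : WF keys st)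
    (sid : ℕ) (s : P.Session N) (m1 : Msg1 P.stat P.eph) (a : P.stat.CT × P.stat.Key)
    (e : P.eph.CT × P.eph.Key) (k : P.QkdKey) (hs : st.sessions sid = some s)
    (hr : s.role = none) :
    WF keys (st.answer sid s m1 (responderPost P keys st s m1 a e k) k) := by
  have hb := basic_step h.toBasic (Step.sendM1 (keys := keys) sid s m1 a e k hs hr)
  set st' := st.answer sid s m1 (responderPost P keys st s m1 a e k) k with hst'
  have hres : ∀ b sb m1' m2, st'.sessions b = some sb → sb.Responded m1' m2 →
      (st.sessions b = some sb ∧ b ≠ sid ∧ m2.kid < st.qkd.nextKid) ∨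
      (b = sid ∧ sb.holder = s.holder ∧ sb.peer = s.peer ∧ m1' = m1 ∧
        m2 = (responderPost P keys st s m1 a e k).1) := by
    intro b sb m1' m2 hb hr
    simp only [hst', GameState.answer, GameState.setSession, Function.update_apply] at hb
    split_ifs at hb with hbs
    · right
      injection hb with hb
      subst hb
      exact ⟨hbs, rfl, rfl, (Option.some_injective _ hr.m1).symm, (Option.some_injective _ hr.m2).symm⟩
    · left
      refine ⟨hb, hbs, ?_⟩
      obtain ⟨-, _, m2', -, hm2, hk⟩ := h.res _ _ hb hr.role
      rw [hr.m2] at hm2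
      injection hm2 with hm2
      exact h.kid_lt _ (hm2 ▸ hk)
  have hacc : ∀ a sa s' m2, st'.sessions a = some sa → sa.InitiatorAccepted s' m2 →
      st.sessions a = some sa ∧ m2.kid < st.qkd.nextKid := by
    intro a sa s' m2 ha hr
    simp only [hst', GameState.answer, GameState.setSession, Function.update_apply] at ha
    split_ifs at ha with hbs
    · injection ha with ha
      subst ha
      cases hr.role
    · refine ⟨ha, ?_⟩
      obtain ⟨m2', hm2, hk⟩ := h.key_m2 _ _ ha hr.key
      rw [hr.m2] at hm2
      injection hm2 with hm2
      exact h.kid_lt _ (hm2 ▸ hk)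
  have hkey : ∀ kid k' f, st'.HonestKey kid k' f → (kid < st.qkd.nextKid ∧ st.HonestKey kid k' f) ∨
      (kid = st.qkd.nextKid ∧ k' = k ∧ f = .waiting s.holder s.peer) := by
    rintro kid k' f ⟨hk, hf⟩
    simp only [hst', GameState.answer, GameState.setSession, QkdState.set,
      Function.update_apply] at hk
    split_ifs at hk with hkid
    · grind
    · exact .inl ⟨h.kid_lt _ (by simp [hk]), hk, hf⟩
  have hkid : (responderPost P keys st s m1 a e k).1.kid = st.qkd.nextKid := rfl
  have htag : (responderPost P keys st s m1 a e k).1.tag1 = P.macQkd.tag k.left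
    (transcript m1 (responderPost P keys st s m1 a e k).1, s.peer, s.holder) := rfl
  obtain ⟨-, g1, g2, g3, g4, g5, g6⟩ := h
  refine ⟨hb, ?_, ?_, ?_, ?_, ?_, ?_⟩
  · clear g2 g3 g4 g5 g6 hacc hkey htag hb; grind
  · clear g1 g3 g4 g5 g6 hacc hb; grind
  · clear g2 g1 g4 g5 g6 hacc hb; grind
  · clear g2 g1 g3 g5 g6 hres hb; grind
  · clear g2 g1 g3 g4 g6 hres hb; grind
  · clear g2 g1 g3 g4 g5 hb; grind

/-- An honest key is handed out only while it is `waiting` for this holder and peer, and becomes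
`delivered` at once. An earlier acceptance would have required the flag `delivered`, which gives
uniqueness, and the flag names the parties of the responder, which gives the agreement of holders
and peers. -/
theorem wf_sendM2 {keys : Fin N → P.stat.PK × P.stat.SK} {st : P.GameState N} (h : WF keys st)
    (sid : ℕ) (s : P.Session N) (s' : P.IState) (m2 : P.Msg2) (key : Option P.SessKey)
    (hs : st.sessions sid = some s) (hs' : s.state = some s') (hm : s.m2 = none)
    (hk : key ≠ none → ∃ k,
      (st.qkd.getKeyWithId s.holder s.peer m2.kid).1 = some k ∧ s.TagsValid keys s' m2 k) :
    WF keys (({ st with qkd := (st.qkd.getKeyWithId s.holder s.peer m2.kid).2 } :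
          P.GameState N).setSession sid { s with m2 := some m2, key := key }) := by
  have hb := basic_step h.toBasic (Step.sendM2 (keys := keys) sid s s' m2 key hs hs' hm hk)
  have hrole : s.role ≠ some .responder := fun hr => by
    have := (h.res _ _ hs hr).1
    simp [hs'] at this
  set st' := ({ st with qkd := (st.qkd.getKeyWithId s.holder s.peer m2.kid).2 } :
          P.GameState N).setSession sid { s with m2 := some m2, key := key } with hst'
  have hres : ∀ b sb m1' m2, st'.sessions b = some sb → sb.Responded m1' m2 →
      st.sessions b = some sb := by
    intro b sb m1' m2 hb hr
    simp only [hst', GameState.setSession, Function.update_apply] at hb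
    split_ifs at hb with hbs
    · injection hb with hb
      subst hb
      exact absurd hr.role hrole
    · exact hb
  have hacc : ∀ a sa s'a m2a, st'.sessions a = some sa → sa.InitiatorAccepted s'a m2a →
      (a ≠ sid ∧ st.sessions a = some sa) ∨
      (a = sid ∧ sa.holder = s.holder ∧ sa.peer = s.peer ∧ s'a = s' ∧ m2a = m2 ∧ ∃ k,
        (st.qkd.getKeyWithId s.holder s.peer m2.kid).1 = some k ∧ s.TagsValid keys s' m2 k ∧
          sa.TagsValid keys s' m2 k) := by
    intro a sa s'a m2a ha hr
    simp only [hst', GameState.setSession, Function.update_apply] at ha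
    split_ifs at ha with hbs
    · right
      injection ha with ha
      subst ha
      obtain ⟨k, hk1, hk2⟩ := hk hr.key
      exact ⟨hbs, rfl, rfl, Option.some_injective _ (hr.state.symm.trans hs'),
        (Option.some_injective _ hr.m2).symm, k, hk1, hk2, hk2⟩
    · exact .inl ⟨hbs, ha⟩
  -- A key that is honest afterwards is either unaffected, and then nothing was handed out if it is
  -- the requested one, or it is the waiting key just delivered.
  have hkey : ∀ kid k' f, st'.HonestKey kid k' f →
      (st.HonestKey kid k' f ∧
        (kid = m2.kid → (st.qkd.getKeyWithId s.holder s.peer m2.kid).1 = none)) ∨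
      (f = .delivered ∧ kid = m2.kid ∧ st.HonestKey kid k' (.waiting s.peer s.holder) ∧
        (st.qkd.getKeyWithId s.holder s.peer m2.kid).1 = some k') := by
    rintro kid k' f ⟨hk, hf⟩
    rcases getKeyWithId_cases st.qkd s.holder s.peer m2.kid with
        ⟨hg1, hg2⟩ | ⟨k, hk', hg1, hg2⟩ | ⟨k, hk', hg1, hg2⟩
    · simp only [hst', GameState.setSession, hg2] at hk
      exact .inl ⟨⟨hk, hf⟩, fun _ => hg1⟩
    · simp only [hst', GameState.setSession, hg2] at hk
      refine .inl ⟨⟨hk, hf⟩, ?_⟩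
      rintro rfl
      grind
    · simp only [hst', GameState.setSession, hg2, QkdState.set, Function.update_apply] at hk
      split_ifs at hk with hkid
      · right
        injection hk with hk
        injection hk with h1 h2
        subst h1 hkid
        exact ⟨h2.symm, rfl, ⟨hk', by simp⟩, hg1⟩
      · exact .inl ⟨⟨hk, hf⟩, fun h => absurd h hkid⟩
  clear_value st'
  obtain ⟨-, g1, g2, g3, g4, g5, g6⟩ := h
  refine ⟨hb, ?_, ?_, ?_, ?_, ?_, ?_⟩
  · clear g2 g3 g4 g5 g6 hacc hkey hb; grind
  · clear g1 g3 g4 g5 g6 hacc hb; grind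
  · clear g2 g1 g4 g5 g6 hacc hb; grind
  · clear g2 g1 g3 g5 g6 hres hb; grind
  · clear g2 g1 g3 g6 hres hb; grind
  · clear g2 g1 g5 hb; grind

theorem wf_step {keys : Fin N → P.stat.PK × P.stat.SK} {st st' : P.GameState N} {q : Query P N}
    (h : WF keys st) (hs : Step keys st q st') : WF keys st' := by
  have hb := basic_step h.toBasic hs
  cases hs with
  | noop => exact h
  | est i j =>
    refine wf_of_frame h ⟨?_, ?_, fun _ _ _ h => h⟩ hb
    all_goals simp only [Function.update_apply]
    all_goals grind [Session.Responded, Session.InitiatorAccepted]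
  | init sid s r hs hr hm =>
    have := h.fresh _ _ hs hr
    refine wf_of_frame h ⟨?_, ?_, fun _ _ _ h => h⟩ hb
    all_goals simp only [GameState.initiated, GameState.setSession, Function.update_apply]
    all_goals grind [Session.Responded, Session.InitiatorAccepted]
  | sendM1 sid s m1 a e k hs hr => exact wf_sendM1 h sid s m1 a e k hs hr
  | sendM2 sid s s' m2 key hs hs' hm hk => exact wf_sendM2 h sid s s' m2 key hs hs' hm hk
  | reveal sid s hs hk =>
    refine wf_of_frame h ⟨?_, ?_, fun _ _ _ h => h⟩ hb
    all_goals simp only [GameState.setSession, Function.update_apply]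
    all_goals grind [Session.Responded, Session.InitiatorAccepted]
  | test sid s hs hk ht =>
    refine wf_of_frame h ⟨?_, ?_, fun _ _ _ h => h⟩ hb
    all_goals grind
  | leak kid k f hk =>
    refine wf_of_frame h ⟨?_, ?_, ?_⟩ hb
    · grind
    · grind
    · simp only [GameState.HonestKey, QkdState.set, Function.update_apply]
      grind
  | override kid k =>
    refine wf_of_frame h ⟨?_, ?_, ?_⟩ hb
    · grind
    · grind
    · simp only [GameState.HonestKey, QkdState.set, Function.update_apply]
      grind

end Suite

/-! ### Changing one QKD key -/

/-- The string of zeros. -/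
def Bits.zero (n : ℕ) : Bits n := fun _ => false

@[simp] theorem Bits.xor_zero {n : ℕ} (x : Bits n) : x.xor (Bits.zero n) = x := by
  funext i; simp [Bits.xor, Bits.zero]

@[simp] theorem Bits.xor_self {n : ℕ} (x : Bits n) : x.xor x = Bits.zero n := by
  funext i; simp [Bits.xor, Bits.zero]

theorem Bits.xor_assoc {n : ℕ} (x y z : Bits n) : (x.xor y).xor z = x.xor (y.xor z) := by
  funext i; simp [Bits.xor]

theorem Bits.xor_comm {n : ℕ} (x y : Bits n) : x.xor y = y.xor x := by
  funext i; simp [Bits.xor, Bool.xor_comm]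

/-- Adding a fixed string. -/
def Bits.xorEquiv {n : ℕ} (Δ : Bits n) : Bits n ≃ Bits n where
  toFun x := x.xor Δ
  invFun x := x.xor Δ
  left_inv x := by simp [Bits.xor_assoc]
  right_inv x := by simp [Bits.xor_assoc]

/-- Concatenation. -/
def Bits.append {m n : ℕ} (x : Bits m) (y : Bits n) : Bits (m + n) := Fin.append x y

@[simp] theorem Bits.left_append {m n : ℕ} (x : Bits m) (y : Bits n) : (x.append y).left = x := by
  funext i; simp [Bits.append, Bits.left]

@[simp] theorem Bits.right_append {m n : ℕ} (x : Bits m) (y : Bits n) :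
    (x.append y).right = y := by
  funext i; simp [Bits.append, Bits.right]

@[simp] theorem Bits.append_left_right {m n : ℕ} (x : Bits (m + n)) :
    x.left.append x.right = x := by
  funext i
  refine Fin.addCases (fun j => ?_) (fun j => ?_) i <;> simp [Bits.append, Bits.left, Bits.right]

/-- Strings and their halves. -/
def Bits.splitEquiv (m n : ℕ) : Bits (m + n) ≃ Bits m × Bits n where
  toFun x := (x.left, x.right)
  invFun x := x.1.append x.2
  left_inv x := by simp
  right_inv x := by simp

/-- Adding a string to the right half. -/
def Bits.xorRight {m n : ℕ} (Δ : Bits n) (x : Bits (m + n)) : Bits (m + n) :=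
  x.left.append (x.right.xor Δ)

/-- Adding a string to the right half, as a bijection. -/
def Bits.xorRightEquiv {m n : ℕ} (Δ : Bits n) : Bits (m + n) ≃ Bits (m + n) where
  toFun := Bits.xorRight Δ
  invFun := Bits.xorRight Δ
  left_inv x := by simp [Bits.xorRight, Bits.xor_assoc]
  right_inv x := by simp [Bits.xorRight, Bits.xor_assoc]

namespace Suite

variable {P : Suite} {N : ℕ}

/-- Apply `h` to the key with identifier `κ`. -/
def QkdState.shift (κ : ℕ) (h : P.QkdKey → P.QkdKey) (qs : P.QkdState) : P.QkdState :=
  ⟨qs.nextKid, fun kid =>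
    (qs.keys kid).map fun kf => (if kid = κ then h kf.1 else kf.1, kf.2)⟩

/-- The second message of a session contains the key identifier `κ`. -/
def Session.Uses (s : P.Session N) (κ : ℕ) : Prop := ∃ m2, s.m2 = some m2 ∧ m2.kid = κ

open Classical in
/-- Add `Δ` to the session key if it belongs to the key identifier `κ`. -/
def Session.shift (κ : ℕ) (Δ : P.SessKey) (s : P.Session N) : P.Session N :=
  { s with key := if s.Uses κ then s.key.map fun k => k.xor Δ else s.key }

/-- Apply `h` to the QKD key with identifier `κ` and add `Δ` to the session keys that belong
to it. -/
def GameState.shift (κ : ℕ) (h : P.QkdKey → P.QkdKey) (Δ : P.SessKey) (st : P.GameState N) :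
    P.GameState N where
  numSessions := st.numSessions
  sessions sid := (st.sessions sid).map (Session.shift κ Δ)
  qkd := st.qkd.shift κ h
  tested := st.tested

variable {κ : ℕ} {h : P.QkdKey → P.QkdKey} {Δ : P.SessKey}

theorem Session.shift_of_not_uses {s : P.Session N} (hs : ¬ s.Uses κ) : s.shift κ Δ = s := by
  simp [Session.shift, hs]

@[simp] theorem Session.shift_zero (s : P.Session N) : s.shift κ (Bits.zero _) = s := by
  simp [Session.shift]

theorem QkdState.shift_set (qs : P.QkdState) (kid : ℕ) (k : P.QkdKey) (f : KeyFlag) :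
    (qs.set kid k f).shift κ h = (qs.shift κ h).set kid (if kid = κ then h k else k) f := by
  simp only [QkdState.shift, QkdState.set, QkdState.mk.injEq, true_and]
  funext kid'
  by_cases hk : kid' = kid
  · subst hk; simp
  · simp [hk]

theorem GameState.shift_setSession (st : P.GameState N) (sid : ℕ) (s : P.Session N) :
    (st.setSession sid s).shift κ h Δ = (st.shift κ h Δ).setSession sid (s.shift κ Δ) := by
  simp only [GameState.shift, GameState.setSession, GameState.mk.injEq, true_and, and_true]
  funext sid'
  by_cases hk : sid' = sid
  · subst hk; simp
  · simp [hk]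

/-- Whether a key is handed out depends on the flags only, and these are not changed. -/
theorem QkdState.getKeyWithId_shift (qs : P.QkdState) (i j kid : ℕ) :
    (qs.shift κ h).getKeyWithId i j kid =
      ((qs.getKeyWithId i j kid).1.map fun k => if kid = κ then h k else k,
        (qs.getKeyWithId i j kid).2.shift κ h) := by
  cases hk : qs.keys kid with
  | none =>
    have : (qs.shift κ h).keys kid = none := by simp [QkdState.shift, hk]
    simp [QkdState.getKeyWithId, this, hk]
  | some kf =>
    obtain ⟨k, f⟩ := kf
    have : (qs.shift κ h).keys kid = some (if kid = κ then h k else k, f) := by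
      simp [QkdState.shift, hk]
    cases f with
    | corrupt => simp [QkdState.getKeyWithId, this, hk]
    | delivered => simp [QkdState.getKeyWithId, this, hk]
    | waiting i' j' =>
      simp only [QkdState.getKeyWithId, this, hk]
      split_ifs <;> simp [QkdState.shift_set, *]

/-! ### Commutation of the oracles with the change of one QKD key -/

theorem oracle_est_shift (keys : Fin N → P.stat.PK × P.stat.SK) (b : Bool) (st : P.GameState N)
    (i j : Fin N) :
    P.oracle N keys b (.est i j) (st.shift κ h Δ) =
      (P.oracle N keys b (.est i j) st).map fun r => (r.1, r.2.shift κ h Δ) := by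
  simp only [oracle]
  erw [PMF.pure_map]
  congr 2
  simp only [GameState.shift, GameState.mk.injEq, true_and, and_true]
  funext sid
  by_cases hs : sid = st.numSessions
  · subst hs
    simp [Session.shift, Session.Uses]
  · simp [hs]

theorem sessions_shift (st : P.GameState N) (sid : ℕ) :
    (st.shift κ h Δ).sessions sid = (st.sessions sid).map (Session.shift κ Δ) := rfl

theorem oracle_init_shift (keys : Fin N → P.stat.PK × P.stat.SK) (b : Bool) (st : P.GameState N)
    (sid : ℕ) :
    P.oracle N keys b (.init sid) (st.shift κ h Δ) =
      (P.oracle N keys b (.init sid) st).map fun r => (r.1, r.2.shift κ h Δ) := by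
  cases hs : st.sessions sid with
  | none =>
    simp only [oracle, sessions_shift, hs, Option.map_none]
    erw [PMF.pure_map]
  | some s =>
    have hs' : (st.shift κ h Δ).sessions sid = some (s.shift κ Δ) := by simp [sessions_shift, hs]
    by_cases hr : s.role = none
    · rw [oracle_init keys b st sid s hs hr, oracle_init keys b _ sid _ hs' hr]
      erw [PMF.map_bind]
      refine congrArg _ (funext fun r => ?_)
      erw [PMF.pure_map]
      simp only [GameState.initiated, GameState.shift_setSession]
      rfl
    · have hr' : (s.shift κ Δ).role ≠ none := hr
      simp only [oracle, hs, hs', hr, hr', if_false]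
      erw [PMF.pure_map]

theorem oracle_sendM1_shift_of_ne (keys : Fin N → P.stat.PK × P.stat.SK) (b : Bool)
    (st : P.GameState N) (sid : ℕ) (m1 : Msg1 P.stat P.eph) (hκ : st.qkd.nextKid ≠ κ) :
    P.oracle N keys b (.sendM1 sid m1) (st.shift κ h Δ) =
      (P.oracle N keys b (.sendM1 sid m1) st).map fun r => (r.1, r.2.shift κ h Δ) := by
  cases hs : st.sessions sid with
  | none =>
    simp only [oracle, sessions_shift, hs, Option.map_none]
    erw [PMF.pure_map]
  | some s =>
    have hs' : (st.shift κ h Δ).sessions sid = some (s.shift κ Δ) := by simp [sessions_shift, hs]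
    by_cases hr : s.role = none
    · rw [oracle_sendM1 keys b st sid m1 s hs hr, oracle_sendM1 keys b _ sid m1 _ hs' hr]
      erw [PMF.map_bind]
      refine congrArg _ (funext fun a => ?_)
      erw [PMF.map_bind]
      refine congrArg _ (funext fun e => ?_)
      erw [PMF.map_bind]
      refine congrArg _ (funext fun k => ?_)
      erw [PMF.pure_map]
      simp only [GameState.answer, GameState.shift_setSession]
      refine congrArg PMF.pure (Prod.ext rfl ?_)
      refine congrArg₂ (fun x y => GameState.setSession x sid y) ?_ ?_
      · simp only [GameState.shift, QkdState.shift_set, hκ, if_false]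
        rfl
      · rw [Session.shift_of_not_uses (s := { s with
          role := some .responder, m1 := some m1
          m2 := some (responderPost P keys st s m1 a e k).1
          key := some (responderPost P keys st s m1 a e k).2 })]
        · rfl
        · rintro ⟨m2, hm, hk⟩
          injection hm with hm
          subst hm
          exact hκ hk
    · have hr' : (s.shift κ Δ).role ≠ none := hr
      simp only [oracle, hs, hs', hr, hr', if_false]
      erw [PMF.pure_map]

/-- Here the fresh key itself is stored under `κ`. Replacing it by `Bits.xorRight Δ` of itself keeps
the MAC half, hence the whole reply, and adds `Δ` to the session key. As this map permutes the
uniformly distributed keys, the equality holds in distribution, though not for each sampled key. -/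
theorem oracle_sendM1_shift_xorRight (keys : Fin N → P.stat.PK × P.stat.SK) (b : Bool)
    (st : P.GameState N) (sid : ℕ) (m1 : Msg1 P.stat P.eph) (hκ : st.qkd.nextKid = κ) :
    P.oracle N keys b (.sendM1 sid m1) (st.shift κ (Bits.xorRight Δ) Δ) =
      (P.oracle N keys b (.sendM1 sid m1) st).map
        fun r => (r.1, r.2.shift κ (Bits.xorRight Δ) Δ) := by
  cases hs : st.sessions sid with
  | none =>
    simp only [oracle, sessions_shift, hs, Option.map_none]
    erw [PMF.pure_map]
  | some s =>
    have hs' : (st.shift κ (Bits.xorRight Δ) Δ).sessions sid = some (s.shift κ Δ) := by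
      simp [sessions_shift, hs]
    by_cases hr : s.role = none
    · rw [oracle_sendM1 keys b st sid m1 s hs hr, oracle_sendM1 keys b _ sid m1 _ hs' hr]
      erw [PMF.map_bind]
      refine congrArg _ (funext fun a => ?_)
      erw [PMF.map_bind]
      refine congrArg _ (funext fun e => ?_)
      erw [PMF.map_bind]
      refine ev_ext fun f => ?_
      rw [ev_bind]
      erw [ev_bind]
      -- The change of variables for the fresh key, on the side of the shifted state.
      rw [← ev_uniform_equiv (Bits.xorRightEquiv Δ)]
      refine congrArg _ (funext fun k => ?_)
      erw [PMF.pure_map, ev_pure, ev_pure]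
      refine congrArg f ?_
      have hpost : responderPost P keys (st.shift κ (Bits.xorRight Δ) Δ) (s.shift κ Δ) m1 a e
          (Bits.xorRight Δ k) = ((responderPost P keys st s m1 a e k).1,
            (responderPost P keys st s m1 a e k).2.xor Δ) := by
        have h1 : (Bits.xorRight Δ k : P.QkdKey).left = k.left := by simp [Bits.xorRight]
        have h2 : (Bits.xorRight Δ k : P.QkdKey).right = k.right.xor Δ := by simp [Bits.xorRight]
        simp only [responderPost, combine, h1, h2, Bits.xor_assoc]
        rw [Bits.xor_comm Δ]
        rfl
      change (some (responderPost P keys _ _ m1 a e (Bits.xorRight Δ k)).1,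
        GameState.answer _ sid _ m1 (responderPost P keys _ _ m1 a e (Bits.xorRight Δ k))
          (Bits.xorRight Δ k)) = _
      rw [hpost]
      refine Prod.ext rfl ?_
      simp only [GameState.answer, GameState.shift_setSession]
      refine congrArg₂ (fun x y => GameState.setSession x sid y) ?_ ?_
      · simp only [GameState.shift, QkdState.shift_set, hκ, if_true]
        rw [show (QkdState.shift κ (Bits.xorRight Δ) st.qkd).nextKid = κ from hκ]
        rfl
      · simp only [Session.shift]
        rw [if_pos ⟨_, rfl, hκ⟩]
        rfl
    · have hr' : (s.shift κ Δ).role ≠ none := hr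
      simp only [oracle, hs, hs', hr, hr', if_false]
      erw [PMF.pure_map]

-- There are two reasons why a check with the key `κ` may be unaffected. A change of the right half
-- only leaves both tags alone and adds `Δ` to the session key. An arbitrary change, with session
-- keys fixed, is harmless if the key is not handed out.
open Classical in
theorem oracle_sendM2_shift (keys : Fin N → P.stat.PK × P.stat.SK) (b : Bool)
    (st : P.GameState N) (sid : ℕ) (m2 : P.Msg2)
    (hh : m2.kid = κ → h = Bits.xorRight Δ ∨ Δ = Bits.zero _ ∧
      ∀ s s', st.sessions sid = some s → s.state = some s' → s.m2 = none →
        (st.qkd.getKeyWithId s.holder s.peer κ).1 = none) :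
    P.oracle N keys b (.sendM2 sid m2) (st.shift κ h Δ) =
      (P.oracle N keys b (.sendM2 sid m2) st).map fun r => (r.1, r.2.shift κ h Δ) := by
  by_cases hn : ∀ s s', st.sessions sid = some s → s.state = some s' → s.m2 ≠ none
  · rw [oracle_sendM2_noop keys b st sid m2 hn, oracle_sendM2_noop keys b _ sid m2]
    · erw [PMF.pure_map]
      rfl
    · intro s s' hs hs'
      rw [sessions_shift] at hs
      obtain ⟨s0, hs0, rfl⟩ := Option.map_eq_some_iff.1 hs
      exact hn s0 s' hs0 hs'
  · push Not at hn
    obtain ⟨s, s', hs, hs', hm⟩ := hn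
    have hss : (st.shift κ h Δ).sessions sid = some (s.shift κ Δ) := by simp [sessions_shift, hs]
    rw [oracle_sendM2 keys b st sid m2 s s' hs hs' hm,
      oracle_sendM2 keys b _ sid m2 _ s' hss hs' hm]
    erw [PMF.pure_map]
    have hkey : (P.sendM2 (QkdState.getKeyWithId (s.shift κ Δ).holder (s.shift κ Δ).peer)
          (s.shift κ Δ).holder (keys (s.shift κ Δ).holder).2 (s.shift κ Δ).peer s' m2
            (st.shift κ h Δ).qkd).1 =
        (P.sendM2 (QkdState.getKeyWithId s.holder s.peer) s.holder (keys s.holder).2 s.peer s' m2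
          st.qkd).1.map fun k => if m2.kid = κ then k.xor Δ else k := by
      rw [sendM2_fst, sendM2_fst]
      change ((st.qkd.shift κ h).getKeyWithId s.holder s.peer m2.kid).1.bind _ = _
      rw [QkdState.getKeyWithId_shift]
      cases hg : (st.qkd.getKeyWithId s.holder s.peer m2.kid).1 with
      | none => simp
      | some k =>
        simp only [Option.map_some, Option.bind_some]
        change (if s.TagsValid keys s' m2 (if m2.kid = κ then h k else k) then
          some (Bits.xor (if m2.kid = κ then h k else k).right (s.kpqc keys s' m2).right)
            else none) = _
        by_cases hk : m2.kid = κ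
        · rcases hh hk with rfl | ⟨-, hno⟩
          · have h1 : (Bits.xorRight Δ k : P.QkdKey).left = k.left := by simp [Bits.xorRight]
            have h2 : (Bits.xorRight Δ k : P.QkdKey).right = k.right.xor Δ := by
              simp [Bits.xorRight]
            have h3 : s.TagsValid keys s' m2 (Bits.xorRight Δ k) ↔ s.TagsValid keys s' m2 k := by
              simp [Session.TagsValid, h1]
            simp only [hk, if_true, h3, h2]
            split_ifs
            · rw [Option.map_some, Bits.xor_assoc, Bits.xor_assoc, Bits.xor_comm Δ]
            · rfl
          · have := hno s s' hs hs' hm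
            rw [← hk, hg] at this
            simp at this
        · simp [hk]
    rw [hkey]
    refine congrArg PMF.pure (Prod.ext ?_ ?_)
    · simp
    · rw [GameState.shift_setSession]
      refine congrArg₂ (fun x y => GameState.setSession x sid y) ?_ ?_
      · change ({ st.shift κ h Δ with
          qkd := ((st.qkd.shift κ h).getKeyWithId s.holder s.peer m2.kid).2 } : P.GameState N) = _
        rw [QkdState.getKeyWithId_shift]
        rfl
      · simp only [Session.shift, Session.Uses, Option.some.injEq, exists_eq_left']
        by_cases hk : m2.kid = κ <;> simp [hk]

theorem oracle_reveal_shift (keys : Fin N → P.stat.PK × P.stat.SK) (b : Bool)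
    (st : P.GameState N) (sid : ℕ)
    (hh : Δ = Bits.zero _ ∨ ∀ s, st.sessions sid = some s → s.key ≠ none → ¬ s.Uses κ) :
    P.oracle N keys b (.reveal sid) (st.shift κ h Δ) =
      (P.oracle N keys b (.reveal sid) st).map fun r => (r.1, r.2.shift κ h Δ) := by
  cases hs : st.sessions sid with
  | none =>
    simp only [oracle, sessions_shift, hs, Option.map_none]
    erw [PMF.pure_map]
  | some s =>
    have hss : (st.shift κ h Δ).sessions sid = some (s.shift κ Δ) := by simp [sessions_shift, hs]
    cases hk : s.key with
    | none =>
      have hk' : (s.shift κ Δ).key = none := by simp [Session.shift, hk]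
      simp only [oracle, hss, hs, hk, hk']
      erw [PMF.pure_map]
    | some k =>
      have hshift : s.shift κ Δ = s := by
        rcases hh with rfl | hh
        · exact Session.shift_zero s
        · exact Session.shift_of_not_uses (hh s hs (by simp [hk]))
      rw [hshift] at hss
      rw [oracle_reveal keys b st sid s k hs hk, oracle_reveal keys b _ sid s k hss hk]
      erw [PMF.pure_map]
      rw [GameState.shift_setSession]
      have : Session.shift κ Δ { s with revealed := true } = { s with revealed := true } := by
        conv_rhs => rw [← hshift]
        rfl
      rw [this]
      rfl

theorem oracle_test_of_tested (keys : Fin N → P.stat.PK × P.stat.SK) (b : Bool)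
    (st : P.GameState N) (sid : ℕ) (ht : st.tested ≠ none) :
    P.oracle N keys b (.test sid) st = PMF.pure (none, st) := by
  obtain ⟨sid', ht⟩ := Option.ne_none_iff_exists'.1 ht
  simp only [oracle, ht]
  rfl

theorem oracle_test_of_key_eq_none (keys : Fin N → P.stat.PK × P.stat.SK) (b : Bool)
    (st : P.GameState N) (sid : ℕ) (hk : ∀ s, st.sessions sid = some s → s.key = none) :
    P.oracle N keys b (.test sid) st = PMF.pure (none, st) := by
  cases ht : st.tested with
  | some _ => exact oracle_test_of_tested keys b st sid (by simp [ht])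
  | none =>
    have : (st.sessions sid).bind (fun s => s.key) = none := by
      cases hs : st.sessions sid with
      | none => rfl
      | some s => exact hk s hs
    simp only [oracle, ht, this]
    rfl

theorem oracle_test (keys : Fin N → P.stat.PK × P.stat.SK) (b : Bool)
    (st : P.GameState N) (sid : ℕ) (s : P.Session N) (k : P.SessKey)
    (hs : st.sessions sid = some s) (hk : s.key = some k) (ht : st.tested = none) :
    P.oracle N keys b (.test sid) st =
      (if b then PMF.uniformOfFintype P.SessKey else PMF.pure k).bind fun k' =>
        PMF.pure (some k', { st with tested := some sid }) := by
  have : (st.sessions sid).bind (fun s => s.key) = some k := by simp [hs, hk]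
  simp only [oracle, ht, this]
  cases b
  · simp only [Bool.false_eq_true, if_false, PMF.pure_bind]
    rfl
  · rfl

theorem oracle_test_shift (keys : Fin N → P.stat.PK × P.stat.SK) (b : Bool)
    (st : P.GameState N) (sid : ℕ) (hh : Δ = Bits.zero _ ∨ st.tested ≠ none) :
    P.oracle N keys b (.test sid) (st.shift κ h Δ) =
      (P.oracle N keys b (.test sid) st).map fun r => (r.1, r.2.shift κ h Δ) := by
  by_cases ht : st.tested = none
  · obtain rfl := hh.resolve_right (not_not.2 ht)
    have hss : (st.shift κ h (Bits.zero _)).sessions sid = st.sessions sid := by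
      rw [sessions_shift]
      cases st.sessions sid <;> simp
    by_cases hk : ∀ s, st.sessions sid = some s → s.key = none
    · rw [oracle_test_of_key_eq_none keys b st sid hk, oracle_test_of_key_eq_none keys b _ sid]
      · erw [PMF.pure_map]
        rfl
      · rwa [hss]
    · push Not at hk
      obtain ⟨s, hs, hk⟩ := hk
      obtain ⟨k, hk⟩ := Option.ne_none_iff_exists'.1 hk
      rw [oracle_test keys b st sid s k hs hk ht,
        oracle_test keys b _ sid s k (hss.trans hs) hk ht]
      erw [PMF.map_bind]
      refine congrArg _ (funext fun k' => ?_)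
      erw [PMF.pure_map]
      rfl
  · rw [oracle_test_of_tested keys b st sid ht, oracle_test_of_tested keys b (st.shift κ h Δ) sid ht]
    erw [PMF.pure_map]
    rfl

theorem oracle_revState_shift (keys : Fin N → P.stat.PK × P.stat.SK) (b : Bool)
    (st : P.GameState N) (sid : ℕ) :
    P.oracle N keys b (.revState sid) (st.shift κ h Δ) =
      (P.oracle N keys b (.revState sid) st).map fun r => (r.1, r.2.shift κ h Δ) := by
  simp only [oracle]
  erw [PMF.pure_map]
  refine congrArg PMF.pure (Prod.ext ?_ rfl)
  change (Option.map _ (st.sessions sid)).bind _ = (st.sessions sid).bind _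
  cases st.sessions sid <;> rfl

theorem oracle_corrupt_shift (keys : Fin N → P.stat.PK × P.stat.SK) (b : Bool)
    (st : P.GameState N) (i : Fin N) :
    P.oracle N keys b (.corrupt i) (st.shift κ h Δ) =
      (P.oracle N keys b (.corrupt i) st).map fun r => (r.1, r.2.shift κ h Δ) := by
  simp only [oracle]
  erw [PMF.pure_map]

theorem oracle_qkdLeak_shift (keys : Fin N → P.stat.PK × P.stat.SK) (b : Bool)
    (st : P.GameState N) (kid : ℕ) (hk : kid = κ → st.qkd.keys kid = none) :
    P.oracle N keys b (.qkdLeak kid) (st.shift κ h Δ) =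
      (P.oracle N keys b (.qkdLeak kid) st).map fun r => (r.1, r.2.shift κ h Δ) := by
  simp only [oracle]
  erw [PMF.pure_map]
  have : (st.qkd.shift κ h).leak kid = ((st.qkd.leak kid).1, (st.qkd.leak kid).2.shift κ h) := by
    unfold QkdState.leak
    cases hkf : st.qkd.keys kid with
    | none =>
      have hkey : (st.qkd.shift κ h).keys kid = none := by simp [QkdState.shift, hkf]
      simp [hkey]
    | some kf =>
      have hk' : kid ≠ κ := fun h => by simpa [hkf] using hk h
      have hkey : (st.qkd.shift κ h).keys kid = some kf := by simp [QkdState.shift, hk', hkf]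
      simp [hkey, QkdState.shift_set, hk']
  change PMF.pure (((st.qkd.shift κ h).leak kid).1, { st.shift κ h Δ with
    qkd := ((st.qkd.shift κ h).leak kid).2 }) = _
  rw [this]
  rfl

theorem oracle_qkdOverride_shift (keys : Fin N → P.stat.PK × P.stat.SK) (b : Bool)
    (st : P.GameState N) (kid : ℕ) (k : P.QkdKey) (hk : kid ≠ κ) :
    P.oracle N keys b (.qkdOverride kid k) (st.shift κ h Δ) =
      (P.oracle N keys b (.qkdOverride kid k) st).map fun r => (r.1, r.2.shift κ h Δ) := by
  simp only [oracle]
  erw [PMF.pure_map]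
  refine congrArg PMF.pure (Prod.ext rfl ?_)
  simp only [GameState.shift, QkdState.override, QkdState.shift_set, hk, if_false]

end Suite

namespace Suite

variable {P : Suite} {N : ℕ} {κ : ℕ} {h : P.QkdKey → P.QkdKey} {Δ : P.SessKey}

/-! ### Session keys are hidden by the QKD key -/

/-- The tested session belongs to the QKD key with identifier `κ`, which is not corrupt and no
session key that belongs to it was revealed. -/
def GameState.HiddenTest (κ : ℕ) (st : P.GameState N) : Prop :=
  (∃ sid s, st.tested = some sid ∧ st.sessions sid = some s ∧ s.Uses κ) ∧ ¬ st.qkd.IsCorrupt κ ∧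
    ∀ sid s, st.sessions sid = some s → s.Uses κ → s.revealed = false

/-- The state cannot evolve into one with `HiddenTest κ` any more. -/
def GameState.Spoiled (κ : ℕ) (st : P.GameState N) : Prop :=
  st.qkd.IsCorrupt κ ∨ (∃ sid s, st.sessions sid = some s ∧ s.Uses κ ∧ s.revealed = true) ∨
    ∃ sid s, st.tested = some sid ∧ st.sessions sid = some s ∧ ¬ s.Uses κ ∧ s.m2 ≠ none

theorem not_hiddenTest_of_spoiled {st : P.GameState N} (hst : st.Spoiled κ) :
    ¬ st.HiddenTest κ := by
  rintro ⟨⟨sid, s, ht, hs, hu⟩, hc, hr⟩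
  rcases hst with h | ⟨sid', s', hs', hu', hr'⟩ | ⟨sid', s', ht', hs', hu', -⟩
  · exact hc h
  · simp [hr _ _ hs' hu'] at hr'
  · rw [ht] at ht'
    cases ht'
    rw [hs] at hs'
    cases hs'
    exact hu' hu

/-- A fresh key never overwrites a present one, retrieval changes waiting keys only, and the
adversary's own actions set the flag `corrupt`. -/
theorem isCorrupt_step {keys : Fin N → P.stat.PK × P.stat.SK} {st st' : P.GameState N}
    {q : Query P N} (hb : Basic st) (hs : Step keys st q st') (hc : st.qkd.IsCorrupt κ) :
    st'.qkd.IsCorrupt κ := by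
  obtain ⟨k0, hc⟩ := hc
  have hlt := hb.kid_lt κ (by simp [hc])
  cases hs with
  | sendM1 sid s m1 a e k hs hr =>
    refine ⟨k0, ?_⟩
    simp only [GameState.answer, GameState.setSession, QkdState.set]
    rwa [Function.update_of_ne hlt.ne]
  | sendM2 sid s s' m2 key hs hs' hm hk =>
    rcases getKeyWithId_cases st.qkd s.holder s.peer m2.kid with
        ⟨-, hg⟩ | ⟨k, -, -, hg⟩ | ⟨k, hk', -, hg⟩
    · exact ⟨k0, by simpa only [GameState.setSession, hg] using hc⟩
    · exact ⟨k0, by simpa only [GameState.setSession, hg] using hc⟩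
    · refine ⟨k0, ?_⟩
      simp only [GameState.setSession, hg, QkdState.set]
      rwa [Function.update_of_ne]
      rintro rfl
      simp [hc] at hk'
  | leak kid k f hk =>
    by_cases hkid : κ = kid
    · subst hkid; exact ⟨k, by simp [QkdState.set]⟩
    · exact ⟨k0, by simpa [QkdState.set, hkid] using hc⟩
  | override kid k =>
    by_cases hkid : κ = kid
    · subst hkid; exact ⟨k, by simp [QkdState.set]⟩
    · exact ⟨k0, by simpa [QkdState.set, hkid] using hc⟩
  | _ => exact ⟨k0, hc⟩

/-- A session that has its second message keeps it. -/
theorem session_step {keys : Fin N → P.stat.PK × P.stat.SK} {st st' : P.GameState N}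
    {q : Query P N} (hb : Basic st) (hs : Step keys st q st') {sid : ℕ} {s : P.Session N}
    (hsid : st.sessions sid = some s) (hm : s.m2 ≠ none) :
    ∃ s', st'.sessions sid = some s' ∧ s'.m2 = s.m2 ∧ (s.revealed = true → s'.revealed = true) := by
  have h1 := hb.lt
  have h2 := hb.fresh
  cases hs with
  | est i j =>
    simp only [Function.update_apply]
    grind
  | init sid' s0 r hs hr hm =>
    simp only [GameState.initiated, GameState.setSession, Function.update_apply]
    grind
  | sendM1 sid' s0 m1 a e k hs hr =>
    simp only [GameState.answer, GameState.setSession, Function.update_apply]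
    grind
  | sendM2 sid' s0 s' m2 key hs hs' hm hk =>
    simp only [GameState.setSession, Function.update_apply]
    grind
  | reveal sid' s0 hs hk =>
    simp only [GameState.setSession, Function.update_apply]
    grind
  | _ => exact ⟨s, hsid, rfl, id⟩

theorem tested_step {keys : Fin N → P.stat.PK × P.stat.SK} {st st' : P.GameState N}
    {q : Query P N} (hs : Step keys st q st') {sid : ℕ} (ht : st.tested = some sid) :
    st'.tested = some sid := by
  cases hs with
  | test sid' s hs hk ht' => rw [ht] at ht'; cases ht'
  | _ => exact ht

/-- Corruption, the `revealed` flag, the tested session and a second message, once present, are all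
permanent. The condition `s.m2 ≠ none` is needed because a session without a second message could
still come to use `κ`. -/
theorem spoiled_step {keys : Fin N → P.stat.PK × P.stat.SK} {st st' : P.GameState N}
    {q : Query P N} (hb : Basic st) (hs : Step keys st q st') (hst : st.Spoiled κ) :
    st'.Spoiled κ := by
  rcases hst with h | ⟨sid, s, hsid, ⟨m2, hm, hk⟩, hr⟩ | ⟨sid, s, ht, hsid, hu, hm⟩
  · exact .inl (isCorrupt_step hb hs h)
  · obtain ⟨s', h1, h2, h3⟩ := session_step hb hs hsid (by simp [hm])
    exact .inr (.inl ⟨sid, s', h1, ⟨m2, h2.trans hm, hk⟩, h3 hr⟩)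
  · obtain ⟨s', h1, h2, h3⟩ := session_step hb hs hsid hm
    refine .inr (.inr ⟨sid, s', tested_step hs ht, h1, ?_, by rwa [h2]⟩)
    rwa [Session.Uses, h2]

/-- The adversary outputs `1` in a hidden test. -/
def hiddenGain (κ : ℕ) (r : Bool × P.GameState N) : ℝ≥0∞ := ind (r.1 = true ∧ r.2.HiddenTest κ)

theorem ev_hiddenGain_of_spoiled (keys : Fin N → P.stat.PK × P.stat.SK) (b : Bool)
    (alg : OracleAlg (Query P N) (Response P N) Bool) (st : P.GameState N) (hb : Basic st)
    (hst : st.Spoiled κ) : ev (alg.run (P.oracle N keys b) st) (hiddenGain κ) = 0 := by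
  refine ev_eq_zero_of_support fun r hr => ind_of_not fun hw => ?_
  have := OracleAlg.inv_of_mem_support_run (P.oracle N keys b)
    (Inv := fun st => Basic st ∧ st.Spoiled κ)
    (fun q st hst r hr =>
      have := step_of_mem_support_oracle hr
      ⟨basic_step hst.1 this, spoiled_step hst.1 this hst.2⟩) alg st ⟨hb, hst⟩ r hr
  exact not_hiddenTest_of_spoiled this.2 hw.2

/-! ### Hidden tests under a change of the QKD key -/

theorem isCorrupt_shift (st : P.GameState N) (kid : ℕ) :
    (st.shift κ h Δ).qkd.IsCorrupt kid ↔ st.qkd.IsCorrupt kid := by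
  unfold QkdState.IsCorrupt
  cases hk : st.qkd.keys kid with
  | none => simp [GameState.shift, QkdState.shift, hk]
  | some kf => simp [GameState.shift, QkdState.shift, hk]; grind

theorem exists_session_shift (st : P.GameState N) (sid : ℕ) (p : P.Session N → Prop)
    (hp : ∀ s, p (s.shift κ Δ) ↔ p s) :
    (∃ s, (st.shift κ h Δ).sessions sid = some s ∧ p s) ↔ ∃ s, st.sessions sid = some s ∧ p s := by
  simp only [sessions_shift, Option.map_eq_some_iff]
  constructor
  · rintro ⟨s, ⟨s0, h0, rfl⟩, h1⟩
    exact ⟨s0, h0, (hp _).1 h1⟩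
  · rintro ⟨s, h0, h1⟩
    exact ⟨_, ⟨s, h0, rfl⟩, (hp _).2 h1⟩

theorem forall_session_shift (st : P.GameState N) (sid : ℕ) (p : P.Session N → Prop)
    (hp : ∀ s, p (s.shift κ Δ) ↔ p s) :
    (∀ s, (st.shift κ h Δ).sessions sid = some s → p s) ↔ ∀ s, st.sessions sid = some s → p s := by
  simp only [sessions_shift, Option.map_eq_some_iff]
  constructor
  · intro H s hs
    exact (hp _).1 (H _ ⟨s, hs, rfl⟩)
  · rintro H _ ⟨s, hs, rfl⟩
    exact (hp _).2 (H s hs)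

theorem hiddenTest_shift (st : P.GameState N) :
    (st.shift κ h Δ).HiddenTest κ ↔ st.HiddenTest κ := by
  unfold GameState.HiddenTest
  rw [isCorrupt_shift]
  refine and_congr (exists_congr fun sid => ?_) (and_congr_right fun _ => forall_congr' fun sid =>
    forall_session_shift st sid (fun s => s.Uses κ → s.revealed = false) fun s => Iff.rfl)
  have := exists_session_shift (κ := κ) (h := h) (Δ := Δ) st sid (fun s => s.Uses κ)
    fun s => Iff.rfl
  simp only [exists_and_left]
  exact and_congr Iff.rfl this

@[simp] theorem shift_key_eq_none (s : P.Session N) : (s.shift κ Δ).key = none ↔ s.key = none := by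
  simp only [Session.shift]
  split_ifs <;> simp

theorem keys_shift_eq_none (st : P.GameState N) (kid : ℕ) :
    (st.shift κ h Δ).qkd.keys kid = none ↔ st.qkd.keys kid = none := by
  simp [GameState.shift, QkdState.shift]

theorem basic_shift {st : P.GameState N} (hb : Basic st) : Basic (st.shift κ h Δ) where
  lt sid := (forall_session_shift st sid (fun _ => sid < st.numSessions) fun s => Iff.rfl).2
    (hb.lt sid)
  fresh sid := (forall_session_shift st sid (fun s => s.role = none →
    s.m2 = none ∧ s.state = none ∧ s.key = none) fun s => by
      rw [shift_key_eq_none]; rfl).2 (hb.fresh sid)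
  ini sid := (forall_session_shift st sid (fun s => s.role = some .initiator →
    ∃ s', s.state = some s' ∧ s.m1 = some s'.m1) fun s => Iff.rfl).2 (hb.ini sid)
  res sid := (forall_session_shift st sid _ fun s => Iff.rfl).2 fun s hs => by
    simpa only [ne_eq, keys_shift_eq_none] using hb.res sid s hs
  key_m2 sid := (forall_session_shift st sid (fun s => s.key ≠ none →
    ∃ m2, s.m2 = some m2 ∧ (st.shift κ h Δ).qkd.keys m2.kid ≠ none) fun s => by
      rw [ne_eq, shift_key_eq_none]; rfl).2 fun s hs => by
    simpa only [ne_eq, keys_shift_eq_none] using hb.key_m2 sid s hs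
  revealed_key sid := (forall_session_shift st sid (fun s => s.revealed = true → s.key ≠ none)
    fun s => by rw [ne_eq, shift_key_eq_none]; rfl).2 (hb.revealed_key sid)
  tested sid ht := (exists_session_shift st sid (fun s => s.key ≠ none)
    fun s => by rw [ne_eq, shift_key_eq_none]).2 (hb.tested sid ht)
  kid_lt kid := by
    rw [ne_eq, keys_shift_eq_none]
    exact hb.kid_lt kid

/-- The query spoils hidden tests for `κ`. -/
def Spoils (κ : ℕ) (st : P.GameState N) : Query P N → Prop
  | .reveal sid => ∃ s, st.sessions sid = some s ∧ s.key ≠ none ∧ s.Uses κ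
  | .qkdLeak kid => kid = κ ∧ st.qkd.keys κ ≠ none
  | .qkdOverride kid _ => kid = κ
  | _ => False

theorem spoils_shift (st : P.GameState N) (q : Query P N) :
    Spoils κ (st.shift κ h Δ) q ↔ Spoils κ st q := by
  cases q with
  | reveal sid =>
    exact exists_session_shift st sid (fun s => s.key ≠ none ∧ s.Uses κ) fun s => by
      rw [ne_eq, shift_key_eq_none]; rfl
  | qkdLeak kid => simp [Spoils, keys_shift_eq_none]
  | _ => rfl

theorem spoiled_of_spoils {keys : Fin N → P.stat.PK × P.stat.SK} {b : Bool} {st : P.GameState N}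
    {q : Query P N} (hq : Spoils κ st q) {r : Response P N q × P.GameState N}
    (hr : r ∈ (P.oracle N keys b q st).support) : r.2.Spoiled κ := by
  cases q with
  | reveal sid =>
    obtain ⟨s, hs, hk, hu⟩ := hq
    obtain ⟨k, hk⟩ := Option.ne_none_iff_exists'.1 hk
    rw [oracle_reveal keys b st sid s k hs hk] at hr
    rw [(PMF.mem_support_pure_iff _ _).1 hr]
    exact .inr (.inl ⟨sid, { s with revealed := true }, by simp [GameState.setSession], hu, rfl⟩)
  | qkdLeak kid =>
    obtain ⟨rfl, hk⟩ := hq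
    obtain ⟨kf, hk⟩ := Option.ne_none_iff_exists'.1 hk
    simp only [oracle] at hr
    rw [(PMF.mem_support_pure_iff _ _).1 hr]
    exact .inl ⟨kf.1, by simp [QkdState.leak, hk, QkdState.set]⟩
  | qkdOverride kid k =>
    obtain rfl := hq
    simp only [oracle] at hr
    rw [(PMF.mem_support_pure_iff _ _).1 hr]
    exact .inl ⟨k, by simp [QkdState.override, QkdState.set]⟩
  | _ => exact hq.elim

theorem ev_hiddenGain_ask_of_spoils (keys : Fin N → P.stat.PK × P.stat.SK) (b : Bool)
    (q : Query P N) (k : Response P N q → OracleAlg (Query P N) (Response P N) Bool)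
    (st : P.GameState N) (hb : Basic st) (hq : Spoils κ st q) :
    ev ((OracleAlg.ask q k).run (P.oracle N keys b) st) (hiddenGain κ) = 0 := by
  rw [OracleAlg.ev_run_ask]
  exact ev_eq_zero_of_support fun r hr => ev_hiddenGain_of_spoiled keys b _ _
    (basic_step hb (step_of_mem_support_oracle hr)) (spoiled_of_spoils hq hr)

/-- The right half of a QKD key enters session keys only, never tags. It can thus be noticed only by
revealing or testing such a session key, or by leaking the QKD key. Overriding that key would
destroy the shift. -/
theorem oracle_shift_xorRight (keys : Fin N → P.stat.PK × P.stat.SK) (b : Bool)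
    (st : P.GameState N) (q : Query P N) (hq : ¬ Spoils κ st q)
    (ht : ∀ sid, q = .test sid → st.tested ≠ none) :
    P.oracle N keys b q (st.shift κ (Bits.xorRight Δ) Δ) =
      (P.oracle N keys b q st).map fun r => (r.1, r.2.shift κ (Bits.xorRight Δ) Δ) := by
  cases q with
  | est i j => exact oracle_est_shift keys b st i j
  | init sid => exact oracle_init_shift keys b st sid
  | sendM1 sid m1 =>
    by_cases hκ : st.qkd.nextKid = κ
    · exact oracle_sendM1_shift_xorRight keys b st sid m1 hκ
    · exact oracle_sendM1_shift_of_ne keys b st sid m1 hκ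
  | sendM2 sid m2 => exact oracle_sendM2_shift keys b st sid m2 fun _ => .inl rfl
  | reveal sid =>
    exact oracle_reveal_shift keys b st sid (.inr fun s hs hk hu => hq ⟨s, hs, hk, hu⟩)
  | revState sid => exact oracle_revState_shift keys b st sid
  | corrupt i => exact oracle_corrupt_shift keys b st i
  | test sid => exact oracle_test_shift keys b st sid (.inr (ht sid rfl))
  | qkdLeak kid =>
    refine oracle_qkdLeak_shift keys b st kid ?_
    rintro rfl
    by_contra hk
    exact hq ⟨rfl, hk⟩
  | qkdOverride kid k => exact oracle_qkdOverride_shift keys b st kid k hq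

theorem oracle_congr_bit (keys : Fin N → P.stat.PK × P.stat.SK) (b b' : Bool)
    (st : P.GameState N) (q : Query P N) (ht : ∀ sid, q = .test sid → st.tested ≠ none) :
    P.oracle N keys b q st = P.oracle N keys b' q st := by
  cases q with
  | test sid =>
    rw [oracle_test_of_tested keys b st sid (ht sid rfl),
      oracle_test_of_tested keys b' st sid (ht sid rfl)]
  | _ => rfl

/-- Once a session is tested, the bit is never consulted again. The shift stays invisible until a
query spoils the hidden test, and from then on both sides are zero. -/
theorem ev_hiddenGain_shift_of_tested (keys : Fin N → P.stat.PK × P.stat.SK) (b b' : Bool)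
    (alg : OracleAlg (Query P N) (Response P N) Bool) :
    ∀ st : P.GameState N, Basic st → st.tested ≠ none →
      ev (alg.run (P.oracle N keys b) (st.shift κ (Bits.xorRight Δ) Δ)) (hiddenGain κ) =
        ev (alg.run (P.oracle N keys b') st) (hiddenGain κ) := by
  induction alg with
  | done a =>
    intro st _ _
    simp only [OracleAlg.ev_run_done, hiddenGain, hiddenTest_shift]
  | sample p k ih =>
    intro st hb ht
    simp only [OracleAlg.ev_run_sample]
    exact congrArg _ (funext fun x => ih x st hb ht)
  | ask q k ih =>
    intro st hb ht
    by_cases hq : Spoils κ st q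
    · rw [ev_hiddenGain_ask_of_spoils keys b' q k st hb hq,
        ev_hiddenGain_ask_of_spoils keys b q k _ (basic_shift hb) ((spoils_shift st q).2 hq)]
    · rw [OracleAlg.ev_run_ask, OracleAlg.ev_run_ask,
        oracle_shift_xorRight keys b st q hq fun _ _ => ht, ev_map,
        oracle_congr_bit keys b b' st q fun _ _ => ht]
      refine ev_congr_support fun r hr => ?_
      have hstep := step_of_mem_support_oracle hr
      obtain ⟨sid, ht⟩ := Option.ne_none_iff_exists'.1 ht
      exact ih _ _ (basic_step hb hstep) (by rw [tested_step hstep ht]; simp)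

theorem ev_oracle_test_of_key_eq_none (keys : Fin N → P.stat.PK × P.stat.SK) (b : Bool)
    (st : P.GameState N) (sid : ℕ) (hk : ∀ s, st.sessions sid = some s → s.key = none)
    (f : Response P N (.test sid) × P.GameState N → ℝ≥0∞) :
    ev (P.oracle N keys b (.test sid) st) f = f ((none : Option P.SessKey), st) := by
  rw [oracle_test_of_key_eq_none keys b st sid hk]
  exact ev_pure _ _

theorem ev_oracle_test (keys : Fin N → P.stat.PK × P.stat.SK) (b : Bool)
    (st : P.GameState N) (sid : ℕ) (s : P.Session N) (k : P.SessKey)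
    (hs : st.sessions sid = some s) (hk : s.key = some k) (ht : st.tested = none)
    (f : Response P N (.test sid) × P.GameState N → ℝ≥0∞) :
    ev (P.oracle N keys b (.test sid) st) f =
      ev (if b then PMF.uniformOfFintype P.SessKey else PMF.pure k) fun k' =>
        f ((some k' : Option P.SessKey), { st with tested := some sid }) := by
  rw [oracle_test keys b st sid s k hs hk ht]
  refine (ev_bind _ _ _).trans (congrArg _ (funext fun k' => ?_))
  exact ev_pure _ _

/-- The probability that the adversary outputs `1` in a hidden test does not depend on the bit of
the game. -/
theorem ev_hiddenGain_average (keys : Fin N → P.stat.PK × P.stat.SK)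
    (alg : OracleAlg (Query P N) (Response P N) Bool) :
    ∀ st : P.GameState N, Basic st →
      (ev (PMF.uniformOfFintype P.SessKey) fun Δ =>
        ev (alg.run (P.oracle N keys true) (st.shift κ (Bits.xorRight Δ) Δ)) (hiddenGain κ)) =
      ev (PMF.uniformOfFintype P.SessKey) fun Δ =>
        ev (alg.run (P.oracle N keys false) (st.shift κ (Bits.xorRight Δ) Δ)) (hiddenGain κ) := by
  induction alg with
  | done a => intro st _; simp
  | sample p k ih =>
    intro st hb
    simp only [OracleAlg.ev_run_sample]
    exact (ev_comm _ _ _).trans ((congrArg _ (funext fun x => ih x st hb)).trans (ev_comm _ _ _))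
  | ask q k ih =>
    intro st hb
    -- After the test, both sides are equal already for each single `Δ`.
    by_cases ht : st.tested = none
    swap
    · simp only [ev_hiddenGain_shift_of_tested keys _ true _ st hb ht]
    by_cases hq : Spoils κ st q
    · simp only [ev_hiddenGain_ask_of_spoils keys _ q k _ (basic_shift hb)
        ((spoils_shift st q).2 hq)]
    by_cases hqt : ∃ sid, q = .test sid
    · obtain ⟨sid, rfl⟩ := hqt
      by_cases hk : ∀ s, st.sessions sid = some s → s.key = none
      · have hk' : ∀ Δ s, (st.shift κ (Bits.xorRight Δ) Δ).sessions sid = some s → s.key = none :=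
          fun Δ => (forall_session_shift st sid (fun s => s.key = none)
            fun s => shift_key_eq_none s).2 hk
        simp only [OracleAlg.ev_run_ask, fun b Δ f => ev_oracle_test_of_key_eq_none keys b _ sid (hk' Δ) f]
        exact ih none st hb
      · push Not at hk
        obtain ⟨s, hs, hk⟩ := hk
        obtain ⟨k0, hk⟩ := Option.ne_none_iff_exists'.1 hk
        -- This is the one-time pad. The continuation does not depend on the shift or the bit, so
        -- only the answer matters: it is `k0.xor Δ` with uniform `Δ` for bit 0, and uniform for bit
        -- 1.
        by_cases hu : s.Uses κ
        · have hu' : ∀ b Δ, ev ((OracleAlg.ask (.test sid) k).run (P.oracle N keys b)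
              (st.shift κ (Bits.xorRight Δ) Δ)) (hiddenGain κ) =
              ev (if b then PMF.uniformOfFintype P.SessKey else PMF.pure (k0.xor Δ)) fun k' =>
                ev ((k (some k')).run (P.oracle N keys true) { st with tested := some sid })
                  (hiddenGain κ) := by
            intro b Δ
            have hs' : (st.shift κ (Bits.xorRight Δ) Δ).sessions sid = some (s.shift κ Δ) := by
              simp [sessions_shift, hs]
            have hk' : (s.shift κ Δ).key = some (k0.xor Δ) := by simp [Session.shift, hu, hk]
            rw [OracleAlg.ev_run_ask, ev_oracle_test keys b _ sid _ _ hs' hk' ht]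
            refine congrArg _ (funext fun k' => ?_)
            exact ev_hiddenGain_shift_of_tested keys b true (k (some k'))
              { st with tested := some sid }
              (basic_step hb (Step.test (keys := keys) sid s hs (by simp [hk]) ht)) (by simp)
          simp only [hu', if_true, ev_const, Bool.false_eq_true, if_false, ev_pure, Bits.xor_comm k0]
          exact (ev_uniform_equiv (Bits.xorEquiv k0) _).symm
        -- A test of a session with another identifier rules out a hidden test for `κ`.
        · have h0 : ∀ b Δ, ev ((OracleAlg.ask (.test sid) k).run (P.oracle N keys b)
              (st.shift κ (Bits.xorRight Δ) Δ)) (hiddenGain κ) = 0 := by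
            intro b Δ
            have hs' : (st.shift κ (Bits.xorRight Δ) Δ).sessions sid = some (s.shift κ Δ) := by
              simp [sessions_shift, hs]
            have hk' : (s.shift κ Δ).key ≠ none := by simp [hk]
            obtain ⟨k1, hk1⟩ := Option.ne_none_iff_exists'.1 hk'
            rw [OracleAlg.ev_run_ask, ev_oracle_test keys b _ sid _ _ hs' hk1 ht]
            refine ev_eq_zero_of_support fun k' _ => ?_
            obtain ⟨m2, hm, -⟩ := hb.key_m2 _ _ hs (by simp [hk])
            exact ev_hiddenGain_of_spoiled keys b _ _
              (basic_step (basic_shift hb) (Step.test (keys := keys) sid _ hs' hk' ht))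
              (.inr (.inr ⟨sid, _, rfl, hs', hu, by simp [Session.shift, hm]⟩))
          simp only [h0]
    · push Not at hqt
      simp only [OracleAlg.ev_run_ask, fun b Δ => oracle_shift_xorRight (Δ := Δ) keys b st q hq
        fun sid hsid => absurd hsid (hqt sid), ev_map]
      rw [oracle_congr_bit keys true false st q fun sid hsid => absurd hsid (hqt sid)]
      -- For any other query the answer is distributed independently of `Δ`, so the average over `Δ`
      -- can be moved inside, where the induction hypothesis applies.
      exact (ev_comm _ _ _).trans ((ev_congr_support fun r hr => ih _ _
        (basic_step hb (step_of_mem_support_oracle hr))).trans (ev_comm _ _ _))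

end Suite

namespace Suite

variable {P : Suite} {N : ℕ} {κ : ℕ}

/-! ### The two games differ by exposure only -/

theorem shift_start (h : P.QkdKey → P.QkdKey) (Δ : P.SessKey) :
    (GameState.start P N).shift κ h Δ = GameState.start P N := rfl

/-- At the start there are no keys, so the shift does nothing and the averages over `Δ` are averages
of constants. -/
theorem ev_hiddenGain_start (keys : Fin N → P.stat.PK × P.stat.SK)
    (alg : OracleAlg (Query P N) (Response P N) Bool) :
    ev (alg.run (P.oracle N keys true) (GameState.start P N)) (hiddenGain κ) =
      ev (alg.run (P.oracle N keys false) (GameState.start P N)) (hiddenGain κ) := by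
  simpa only [shift_start, ev_const] using
    ev_hiddenGain_average (κ := κ) keys alg (GameState.start P N) (wf_start keys).toBasic

/-- Matching sessions have the same second message, hence the same key identifier. -/
theorem nontrivial_of_hiddenTest {st : P.GameState N} (h : st.HiddenTest κ) : st.Nontrivial := by
  obtain ⟨⟨sid, s, ht, hs, m2, hm, rfl⟩, hc, hr⟩ := h
  refine ⟨sid, s, m2, ht, hs, hr _ _ hs ⟨m2, hm, rfl⟩, hm, hc, fun sid' s' hs' hmatch => ?_⟩
  obtain ⟨-, -, -, -, -, -, hm2⟩ := hmatch
  exact hr _ _ hs' ⟨m2, hm2.trans hm, rfl⟩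

theorem hiddenTest_unique {st : P.GameState N} {κ' : ℕ} (h : st.HiddenTest κ)
    (h' : st.HiddenTest κ') : κ = κ' := by
  obtain ⟨⟨sid, s, ht, hs, m2, hm, rfl⟩, -⟩ := h
  obtain ⟨⟨sid', s', ht', hs', m2', hm', rfl⟩, -⟩ := h'
  rw [ht] at ht'
  cases ht'
  rw [hs] at hs'
  cases hs'
  rw [hm] at hm'
  cases hm'
  rfl

/-- A nontrivial attack in which a session key was revealed that belongs to the same QKD key as
the tested session key. -/
def GameState.Exposed (st : P.GameState N) : Prop := st.Nontrivial ∧ ∀ κ, ¬ st.HiddenTest κ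

/-- The tested session determines its identifier, so at most one term of the sum is nonzero. Summing
over all `κ` avoids guessing the identifier, and no factor is lost. -/
theorem ind_nontrivial_eq (r : Bool × P.GameState N) :
    ind (r.1 = true ∧ r.2.Nontrivial) =
      (∑' κ, hiddenGain κ r) + ind (r.1 = true ∧ r.2.Exposed) := by
  by_cases h : ∃ κ, r.2.HiddenTest κ
  · obtain ⟨κ, hκ⟩ := h
    rw [tsum_eq_single (f := fun κ => hiddenGain κ r) κ
        fun κ' hne => ind_of_not fun h => hne (hiddenTest_unique h.2 hκ),
      ind_of_not (p := r.1 = true ∧ r.2.Exposed) fun h => h.2.2 κ hκ, add_zero]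
    exact ind_congr (and_congr_right fun _ =>
      ⟨fun _ => hκ, fun h => nontrivial_of_hiddenTest h⟩)
  · push Not at h
    rw [ENNReal.tsum_eq_zero.2 fun κ =>
      show hiddenGain κ r = 0 from ind_of_not fun h' => h κ h'.2, zero_add]
    exact ind_congr (and_congr_right fun _ => ⟨fun hn => ⟨hn, h⟩, fun hn => hn.1⟩)

/-- The games with the two bits differ by the probability of exposure only. -/
theorem ev_nontrivial_le (keys : Fin N → P.stat.PK × P.stat.SK) (b b' : Bool)
    (alg : OracleAlg (Query P N) (Response P N) Bool) :
    (ev (alg.run (P.oracle N keys b) (GameState.start P N)) fun r =>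
        ind (r.1 = true ∧ r.2.Nontrivial)) ≤
      (ev (alg.run (P.oracle N keys b') (GameState.start P N)) fun r =>
        ind (r.1 = true ∧ r.2.Nontrivial)) +
      ev (alg.run (P.oracle N keys b) (GameState.start P N)) fun r => ind r.2.Exposed := by
  simp only [ind_nontrivial_eq, ev_add, ev_tsum]
  have : ∀ κ, ev (alg.run (P.oracle N keys b) (GameState.start P N)) (hiddenGain κ) =
      ev (alg.run (P.oracle N keys b') (GameState.start P N)) (hiddenGain κ) := by
    intro κ
    cases b <;> cases b' <;> simp [ev_hiddenGain_start]
  simp only [this]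
  gcongr
  · exact le_self_add
  · exact ev_mono fun r => ind_mono And.right

/-! ### The log of encapsulations -/

/-- The encapsulations of a session and the ephemeral key pair of an initiator. -/
inductive Entry (P : Suite) (N : ℕ) : Type
  | ini (peer : Fin N) (cb : P.stat.CT) (kb : P.stat.Key) (pke : P.eph.PK) (ske : P.eph.SK)
  | res (peer : Fin N) (ca : P.stat.CT) (ka : P.stat.Key) (pke : P.eph.PK) (ce : P.eph.CT)
      (ke : P.eph.Key)

/-- The entries of all sessions. -/
abbrev Log (P : Suite) (N : ℕ) : Type := ℕ → Option (Entry P N)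

/-- The oracles of the game, which also keep a log. -/
def loggedOracle (N : ℕ) (keys : Fin N → P.stat.PK × P.stat.SK) (b : Bool) :
    (q : Query P N) → P.GameState N × Log P N →
      PMF (Response P N q × (P.GameState N × Log P N))
  | .init sid, st =>
      match st.1.sessions sid with
      | none => PMF.pure (none, st)
      | some s =>
          if s.role = none then
            (P.stat.encaps (keys s.peer).1).bind fun b => P.eph.keyGen.bind fun e =>
              PMF.pure (some ⟨b.1, e.1⟩,
                (st.1.initiated sid s (⟨b.1, e.1⟩, ⟨b.2, e.2, ⟨b.1, e.1⟩⟩),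
                  Function.update st.2 sid (some (.ini s.peer b.1 b.2 e.1 e.2))))
          else PMF.pure (none, st)
  | .sendM1 sid m1, st =>
      match st.1.sessions sid with
      | none => PMF.pure (none, st)
      | some s =>
          if s.role = none then
            (P.stat.encaps (keys s.peer).1).bind fun a => (P.eph.encaps m1.pke).bind fun e =>
              (PMF.uniformOfFintype P.QkdKey).bind fun k =>
                PMF.pure (some (responderPost P keys st.1 s m1 a e k).1,
                  (st.1.answer sid s m1 (responderPost P keys st.1 s m1 a e k) k,
                    Function.update st.2 sid (some (.res s.peer a.1 a.2 m1.pke e.1 e.2))))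
          else PMF.pure (none, st)
  | q, st => (P.oracle N keys b q st.1).map fun r => (r.1, (r.2, st.2))

/-- The query does not start a session. -/
def Query.Unlogged : Query P N → Prop
  | .init _ => False
  | .sendM1 _ _ => False
  | _ => True

theorem loggedOracle_of_unlogged (keys : Fin N → P.stat.PK × P.stat.SK) (b : Bool)
    (q : Query P N) (st : P.GameState N × Log P N) (hq : q.Unlogged) :
    P.loggedOracle N keys b q st = (P.oracle N keys b q st.1).map fun r => (r.1, (r.2, st.2)) := by
  cases q with
  | init sid => exact hq.elim
  | sendM1 sid m1 => exact hq.elim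
  | _ => rfl

theorem loggedOracle_init (keys : Fin N → P.stat.PK × P.stat.SK) (b : Bool)
    (st : P.GameState N × Log P N) (sid : ℕ) (s : P.Session N) (hs : st.1.sessions sid = some s)
    (hr : s.role = none) :
    P.loggedOracle N keys b (.init sid) st =
      (P.stat.encaps (keys s.peer).1).bind fun b => P.eph.keyGen.bind fun e =>
        PMF.pure (some ⟨b.1, e.1⟩,
          (st.1.initiated sid s (⟨b.1, e.1⟩, ⟨b.2, e.2, ⟨b.1, e.1⟩⟩),
            Function.update st.2 sid (some (.ini s.peer b.1 b.2 e.1 e.2)))) := by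
  simp only [loggedOracle, hs, hr, if_true]
  rfl

theorem loggedOracle_init_noop (keys : Fin N → P.stat.PK × P.stat.SK) (b : Bool)
    (st : P.GameState N × Log P N) (sid : ℕ) (h : ∀ s, st.1.sessions sid = some s → s.role ≠ none) :
    P.loggedOracle N keys b (.init sid) st = PMF.pure (none, st) := by
  cases hs : st.1.sessions sid with
  | none => simp only [loggedOracle, hs]; rfl
  | some s => simp only [loggedOracle, hs, h s hs, if_false]; rfl

theorem loggedOracle_sendM1 (keys : Fin N → P.stat.PK × P.stat.SK) (b : Bool)
    (st : P.GameState N × Log P N) (sid : ℕ) (m1 : Msg1 P.stat P.eph) (s : P.Session N)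
    (hs : st.1.sessions sid = some s) (hr : s.role = none) :
    P.loggedOracle N keys b (.sendM1 sid m1) st =
      (P.stat.encaps (keys s.peer).1).bind fun a => (P.eph.encaps m1.pke).bind fun e =>
        (PMF.uniformOfFintype P.QkdKey).bind fun k =>
          PMF.pure (some (responderPost P keys st.1 s m1 a e k).1,
            (st.1.answer sid s m1 (responderPost P keys st.1 s m1 a e k) k,
              Function.update st.2 sid (some (.res s.peer a.1 a.2 m1.pke e.1 e.2)))) := by
  simp only [loggedOracle, hs, hr, if_true]
  rfl

theorem loggedOracle_sendM1_noop (keys : Fin N → P.stat.PK × P.stat.SK) (b : Bool)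
    (st : P.GameState N × Log P N) (sid : ℕ) (m1 : Msg1 P.stat P.eph)
    (h : ∀ s, st.1.sessions sid = some s → s.role ≠ none) :
    P.loggedOracle N keys b (.sendM1 sid m1) st = PMF.pure (none, st) := by
  cases hs : st.1.sessions sid with
  | none => simp only [loggedOracle, hs]; rfl
  | some s => simp only [loggedOracle, hs, h s hs, if_false]; rfl

theorem oracle_init_noop (keys : Fin N → P.stat.PK × P.stat.SK) (b : Bool)
    (st : P.GameState N) (sid : ℕ) (h : ∀ s, st.sessions sid = some s → s.role ≠ none) :
    P.oracle N keys b (.init sid) st = PMF.pure (none, st) := by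
  cases hs : st.sessions sid with
  | none => simp only [oracle, hs]; rfl
  | some s => simp only [oracle, hs, h s hs, if_false]; rfl

theorem oracle_sendM1_noop (keys : Fin N → P.stat.PK × P.stat.SK) (b : Bool)
    (st : P.GameState N) (sid : ℕ) (m1 : Msg1 P.stat P.eph)
    (h : ∀ s, st.sessions sid = some s → s.role ≠ none) :
    P.oracle N keys b (.sendM1 sid m1) st = PMF.pure (none, st) := by
  cases hs : st.sessions sid with
  | none => simp only [oracle, hs]; rfl
  | some s => simp only [oracle, hs, h s hs, if_false]; rfl

/-- The log is passive, so events about encapsulations can be studied in the logged game without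
changing any probability of the original one. -/
theorem loggedOracle_map (keys : Fin N → P.stat.PK × P.stat.SK) (b : Bool)
    (q : Query P N) (st : P.GameState N × Log P N) :
    (P.loggedOracle N keys b q st).map (fun r => (r.1, r.2.1)) = P.oracle N keys b q st.1 := by
  by_cases hq : q.Unlogged
  · rw [loggedOracle_of_unlogged keys b q st hq, PMF.map_comp]
    exact PMF.map_id _
  · cases q with
    | init sid =>
      by_cases h : ∀ s, st.1.sessions sid = some s → s.role ≠ none
      · rw [loggedOracle_init_noop keys b st sid h, oracle_init_noop keys b st.1 sid h]
        erw [PMF.pure_map]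
        rfl
      · push Not at h
        obtain ⟨s, hs, hr⟩ := h
        rw [loggedOracle_init keys b st sid s hs hr, oracle_init keys b st.1 sid s hs hr]
        simp only [initiate, PMF.bind_bind, PMF.pure_bind]
        erw [PMF.map_bind]
        refine congrArg _ (funext fun a => ?_)
        erw [PMF.map_bind]
        refine congrArg _ (funext fun e => ?_)
        erw [PMF.pure_map]
        rfl
    | sendM1 sid m1 =>
      by_cases h : ∀ s, st.1.sessions sid = some s → s.role ≠ none
      · rw [loggedOracle_sendM1_noop keys b st sid m1 h, oracle_sendM1_noop keys b st.1 sid m1 h]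
        erw [PMF.pure_map]
        rfl
      · push Not at h
        obtain ⟨s, hs, hr⟩ := h
        rw [loggedOracle_sendM1 keys b st sid m1 s hs hr, oracle_sendM1 keys b st.1 sid m1 s hs hr]
        erw [PMF.map_bind]
        refine congrArg _ (funext fun a => ?_)
        erw [PMF.map_bind]
        refine congrArg _ (funext fun e => ?_)
        erw [PMF.map_bind]
        refine congrArg _ (funext fun k => ?_)
        erw [PMF.pure_map]
        rfl
    | _ => exact absurd trivial hq

/-- The invariants of the log. -/
structure LogInv (keys : Fin N → P.stat.PK × P.stat.SK) (st : P.GameState N × Log P N) :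
    Prop where
  basic : Basic st.1
  started : ∀ sid, st.2 sid ≠ none → ∃ s, st.1.sessions sid = some s ∧ s.role ≠ none
  ini : ∀ sid s s', st.1.sessions sid = some s → s.role = some .initiator → s.state = some s' →
    st.2 sid = some (.ini s.peer s'.m1.cb s'.kb s'.m1.pke s'.ske)
  res : ∀ sid s m1 m2, st.1.sessions sid = some s → s.Responded m1 m2 →
    ∃ ka ke, st.2 sid = some (.res s.peer m2.ca ka m1.pke m2.ce ke) ∧
      P.macPqc.tag (P.kdf (P.stat.decaps (keys s.holder).2 m1.cb) ka ke).left
        (transcript m1 m2, m2.tag1, s.peer, s.holder) = m2.tag2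

theorem logInv_start (keys : Fin N → P.stat.PK × P.stat.SK) :
    LogInv keys (GameState.start P N, fun _ => none) := by
  refine ⟨(wf_start keys).toBasic, ?_, ?_, ?_⟩ <;> simp [GameState.start]

theorem logInv_of_unlogged {keys : Fin N → P.stat.PK × P.stat.SK} {st : P.GameState N × Log P N}
    {st' : P.GameState N} {q : Query P N} (h : LogInv keys st) (hq : q.Unlogged)
    (hs : Step keys st.1 q st') : LogInv keys (st', st.2) := by
  have hb := basic_step h.basic hs
  obtain ⟨⟨b1, b2, b3, b4, b5, b6, b7, b8⟩, h1, h2, h3⟩ := h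
  cases hs with
  | noop => exact ⟨hb, h1, h2, h3⟩
  | est i j =>
    refine ⟨hb, ?_, ?_, ?_⟩
    all_goals simp only [Function.update_apply]
    all_goals clear hb b2 b3 b4 b5 b6 b7 b8
    all_goals grind [Session.Responded]
  | init => exact hq.elim
  | sendM1 => exact hq.elim
  | sendM2 sid s s' m2 key hs hs' hm hk =>
    have hr2 : s.role ≠ some .responder := fun hr => by simpa [hs'] using (b4 _ _ hs hr).1
    refine ⟨hb, ?_, ?_, ?_⟩
    all_goals simp only [GameState.setSession, Function.update_apply]
    all_goals clear hb b1 b2 b3 b4 b5 b6 b7 b8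
    all_goals grind [Session.Responded]
  | reveal sid s hs hk =>
    refine ⟨hb, ?_, ?_, ?_⟩
    all_goals simp only [GameState.setSession, Function.update_apply]
    all_goals clear hb b1 b2 b3 b4 b5 b6 b7 b8
    · clear h2 h3; grind
    · clear h1 h3; grind
    · intro sid' s0 m1 m2 hs0 hr0
      split_ifs at hs0 with hsid
      · injection hs0 with hs0
        subst hs0 hsid
        exact h3 _ s _ _ hs ⟨hr0.role, hr0.m1, hr0.m2⟩
      · exact h3 _ _ _ _ hs0 hr0
  | test sid s hs hk ht => exact ⟨hb, h1, h2, h3⟩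
  | leak kid k f hk => exact ⟨hb, h1, h2, h3⟩
  | override kid k => exact ⟨hb, h1, h2, h3⟩

theorem logInv_step {keys : Fin N → P.stat.PK × P.stat.SK} {b : Bool}
    {st : P.GameState N × Log P N} {q : Query P N} (h : LogInv keys st)
    {r : Response P N q × (P.GameState N × Log P N)}
    (hr : r ∈ (P.loggedOracle N keys b q st).support) : LogInv keys r.2 := by
  by_cases hq : q.Unlogged
  · rw [loggedOracle_of_unlogged keys b q st hq] at hr
    obtain ⟨x, hx, rfl⟩ := (PMF.mem_support_map_iff _ _ _).1 hr
    exact logInv_of_unlogged h hq (step_of_mem_support_oracle hx)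
  · cases q with
    | init sid =>
      by_cases hn : ∀ s, st.1.sessions sid = some s → s.role ≠ none
      · rw [loggedOracle_init_noop keys b st sid hn] at hr
        rwa [(PMF.mem_support_pure_iff _ _).1 hr]
      · push Not at hn
        obtain ⟨s, hs, hrole⟩ := hn
        rw [loggedOracle_init keys b st sid s hs hrole] at hr
        obtain ⟨a, -, hr⟩ := (PMF.mem_support_bind_iff _ _ _).1 hr
        obtain ⟨e, -, hr⟩ := (PMF.mem_support_bind_iff _ _ _).1 hr
        rw [(PMF.mem_support_pure_iff _ _).1 hr]
        have hb := basic_step h.basic (Step.init (keys := keys) sid s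
          (⟨a.1, e.1⟩, ⟨a.2, e.2, ⟨a.1, e.1⟩⟩) hs hrole rfl)
        obtain ⟨-, h1, h2, h3⟩ := h
        refine ⟨hb, ?_, ?_, ?_⟩
        all_goals simp only [GameState.initiated, GameState.setSession, Function.update_apply]
        all_goals clear hb
        all_goals grind [Session.Responded]
    | sendM1 sid m1 =>
      by_cases hn : ∀ s, st.1.sessions sid = some s → s.role ≠ none
      · rw [loggedOracle_sendM1_noop keys b st sid m1 hn] at hr
        rwa [(PMF.mem_support_pure_iff _ _).1 hr]
      · push Not at hn
        obtain ⟨s, hs, hrole⟩ := hn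
        rw [loggedOracle_sendM1 keys b st sid m1 s hs hrole] at hr
        obtain ⟨a, -, hr⟩ := (PMF.mem_support_bind_iff _ _ _).1 hr
        obtain ⟨e, -, hr⟩ := (PMF.mem_support_bind_iff _ _ _).1 hr
        obtain ⟨k, -, hr⟩ := (PMF.mem_support_bind_iff _ _ _).1 hr
        rw [(PMF.mem_support_pure_iff _ _).1 hr]
        have hb := basic_step h.basic (Step.sendM1 (keys := keys) sid s m1 a e k hs hrole)
        have hres : ∃ ka ke,
            some (Entry.res s.peer a.1 a.2 m1.pke e.1 e.2) =
              some (Entry.res s.peer (responderPost P keys st.1 s m1 a e k).1.ca ka m1.pke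
                (responderPost P keys st.1 s m1 a e k).1.ce ke) ∧
            P.macPqc.tag (P.kdf (P.stat.decaps (keys s.holder).2 m1.cb) ka ke).left
              (transcript m1 (responderPost P keys st.1 s m1 a e k).1,
                (responderPost P keys st.1 s m1 a e k).1.tag1, s.peer, s.holder) =
                (responderPost P keys st.1 s m1 a e k).1.tag2 :=
          ⟨a.2, e.2, rfl, rfl⟩
        obtain ⟨-, h1, h2, h3⟩ := h
        refine ⟨hb, ?_, ?_, ?_⟩
        all_goals simp only [GameState.answer, GameState.setSession, Function.update_apply]
        all_goals clear hb
        · clear hres h2 h3; grind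
        · clear hres h1 h3; grind
        · intro sid' s0 m1' m2' hs0 hr0
          split_ifs at hs0 with hsid
          · injection hs0 with hs0
            subst hs0
            have e1 := Option.some_injective _ hr0.m1
            have e2 := Option.some_injective _ hr0.m2
            subst e1 e2
            rw [if_pos hsid]
            exact hres
          · rw [if_neg hsid]
            exact h3 _ _ _ _ hs0 hr0
    | _ => exact absurd trivial hq

end Suite

/-- The probability that decapsulation fails for a fixed key pair. -/
def KEM.failure (K : KEM) (ks : K.PK × K.SK) : ℝ≥0∞ :=
  ev (K.encaps ks.1) fun ck => ind (K.decaps ks.2 ck.1 ≠ ck.2)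

namespace Suite

variable {P : Suite} {N : ℕ}

/-! ### Failures of the key encapsulation mechanisms -/

/-- The static encapsulation of a session fails. -/
def Entry.StatFails (keys : Fin N → P.stat.PK × P.stat.SK) : Entry P N → Prop
  | .ini peer cb kb _ _ => P.stat.decaps (keys peer).2 cb ≠ kb
  | .res peer ca ka _ _ _ => P.stat.decaps (keys peer).2 ca ≠ ka

/-- The ephemeral encapsulation of a responder fails for an initiator. -/
def Entry.EphFails : Entry P N → Entry P N → Prop
  | .ini _ _ _ pke ske, .res _ _ _ pke' ce ke => pke' = pke ∧ P.eph.decaps ske ce ≠ ke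
  | _, _ => False

/-- Only starting a session changes the log, and it fills an empty entry. A function of the log that
does not grow on average in these two cases is a potential for the whole run. -/
theorem ev_loggedOracle_run_le (keys : Fin N → P.stat.PK × P.stat.SK) (b : Bool)
    (ψ : Log P N → ℝ≥0∞)
    (hini : ∀ log sid peer, log sid = none →
      (ev (P.stat.encaps (keys peer).1) fun c => ev P.eph.keyGen fun e =>
        ψ (Function.update log sid (some (.ini peer c.1 c.2 e.1 e.2)))) ≤ ψ log)
    (hres : ∀ log sid peer pke, log sid = none →
      (ev (P.stat.encaps (keys peer).1) fun c => ev (P.eph.encaps pke) fun e =>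
        ψ (Function.update log sid (some (.res peer c.1 c.2 pke e.1 e.2)))) ≤ ψ log)
    (alg : OracleAlg (Query P N) (Response P N) Bool) :
    (ev (alg.run (P.loggedOracle N keys b) (GameState.start P N, fun _ => none)) fun r =>
      ψ r.2.2) ≤ ψ fun _ => none := by
  refine OracleAlg.ev_run_le_potential (Inv := LogInv keys) (φ := fun st => ψ st.2)
    (fun q st h r hr => logInv_step h hr) (fun q st h => ?_) (fun _ _ _ => le_rfl) alg _
    (logInv_start keys)
  have hnone : ∀ sid s, st.1.sessions sid = some s → s.role = none → st.2 sid = none := by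
    intro sid s hs hr
    by_contra hl
    obtain ⟨s', hs', hr'⟩ := h.started sid hl
    rw [hs] at hs'
    cases hs'
    exact hr' hr
  by_cases hq : q.Unlogged
  · rw [loggedOracle_of_unlogged keys b q st hq, ev_map]
    exact (ev_const _ _).le
  · cases q with
    | init sid =>
      by_cases hn : ∀ s, st.1.sessions sid = some s → s.role ≠ none
      · rw [loggedOracle_init_noop keys b st sid hn]
        exact (ev_pure _ _).le
      · push Not at hn
        obtain ⟨s, hs, hr⟩ := hn
        rw [loggedOracle_init keys b st sid s hs hr]
        refine le_of_eq_of_le ?_ (hini st.2 sid s.peer (hnone _ _ hs hr))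
        refine (ev_bind _ _ _).trans (congrArg _ (funext fun c => ?_))
        refine (ev_bind _ _ _).trans (congrArg _ (funext fun e => ?_))
        exact ev_pure _ _
    | sendM1 sid m1 =>
      by_cases hn : ∀ s, st.1.sessions sid = some s → s.role ≠ none
      · rw [loggedOracle_sendM1_noop keys b st sid m1 hn]
        exact (ev_pure _ _).le
      · push Not at hn
        obtain ⟨s, hs, hr⟩ := hn
        rw [loggedOracle_sendM1 keys b st sid m1 s hs hr]
        refine le_of_eq_of_le ?_ (hres st.2 sid s.peer m1.pke (hnone _ _ hs hr))
        refine (ev_bind _ _ _).trans (congrArg _ (funext fun c => ?_))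
        refine (ev_bind _ _ _).trans (congrArg _ (funext fun e => ?_))
        refine (ev_bind _ _ _).trans ?_
        -- The QKD key does not enter the log, so its average is that of a constant.
        exact (congrArg _ (funext fun k => ev_pure _ _)).trans
          (ev_const _ (ψ (Function.update st.2 sid (some (.res s.peer c.1 c.2 m1.pke e.1 e.2)))))
    | _ => exact absurd trivial hq

/-- The probability that the static encapsulation of a session fails. -/
def statPotential (keys : Fin N → P.stat.PK × P.stat.SK) (sid : ℕ) (log : Log P N) : ℝ≥0∞ :=
  match log sid with
  | none => ⨆ j, P.stat.failure (keys j)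
  | some e => ind (e.StatFails keys)

/-- The adversary chooses the peer adaptively, possibly knowing secret keys. Before the
encapsulation only the worst key pair gives a bound; the randomness of the encapsulation itself is
still fresh. -/
theorem ev_statFails_le (keys : Fin N → P.stat.PK × P.stat.SK) (b : Bool) (sid : ℕ)
    (alg : OracleAlg (Query P N) (Response P N) Bool) :
    (ev (alg.run (P.loggedOracle N keys b) (GameState.start P N, fun _ => none)) fun r =>
      ind (∃ e, r.2.2 sid = some e ∧ e.StatFails keys)) ≤ ⨆ j, P.stat.failure (keys j) := by
  refine (ev_mono fun r => ?_).trans (ev_loggedOracle_run_le keys b (statPotential keys sid)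
    ?_ ?_ alg)
  · unfold statPotential
    cases h : r.2.2 sid with
    | none => rw [ind_of_not (by simp)]; exact zero_le
    | some e => exact ind_mono (by simp)
  · intro log sid' peer hl
    by_cases hs : sid = sid'
    · subst hs
      simp only [statPotential, Function.update_self, hl, Entry.StatFails, ev_const]
      exact le_iSup (fun j => P.stat.failure (keys j)) peer
    · simp only [statPotential, Function.update_of_ne hs, ev_const, le_refl]
  · intro log sid' peer pke hl
    by_cases hs : sid = sid'
    · subst hs
      simp only [statPotential, Function.update_self, hl, Entry.StatFails, ev_const]
      exact le_iSup (fun j => P.stat.failure (keys j)) peer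
    · simp only [statPotential, Function.update_of_ne hs, ev_const, le_refl]

/-- The probability that the ephemeral encapsulation of `y` fails for `x`. -/
def Entry.ephPotential : Option (Entry P N) → Option (Entry P N) → ℝ≥0∞
  | none, none => ev P.eph.keyGen P.eph.failure
  | some (.ini _ _ _ pke ske), none => P.eph.failure (pke, ske)
  | none, some (.res _ _ _ pke ce ke) =>
      ev P.eph.keyGen fun e => ind (pke = e.1 ∧ P.eph.decaps e.2 ce ≠ ke)
  | some x, some y => ind (x.EphFails y)
  | _, _ => 0

theorem ev_encaps_le_failure (K : KEM) (pk : K.PK) (ks : K.PK × K.SK) :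
    (ev (K.encaps pk) fun ck => ind (pk = ks.1 ∧ K.decaps ks.2 ck.1 ≠ ck.2)) ≤ K.failure ks := by
  by_cases h : pk = ks.1
  · subst h
    exact ev_mono fun ck => ind_mono And.right
  · simp [h, ind]

/-- The two entries may arise in either order. If the initiator is first, the encapsulation is fresh
for its key pair. If the responder is first, it encapsulated under a public key chosen by the
adversary, and a failure counts only if the later, independent key generation produces this very
key; exchanging the two averages gives the same bound. -/
theorem ev_ephFails_le (keys : Fin N → P.stat.PK × P.stat.SK) (b : Bool) (i j : ℕ)
    (alg : OracleAlg (Query P N) (Response P N) Bool) :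
    (ev (alg.run (P.loggedOracle N keys b) (GameState.start P N, fun _ => none)) fun r =>
      ind (∃ x y, r.2.2 i = some x ∧ r.2.2 j = some y ∧ x.EphFails y)) ≤
        ev P.eph.keyGen P.eph.failure := by
  -- One entry cannot belong to an initiator and to a responder.
  by_cases hij : i = j
  · subst hij
    refine (ev_mono fun r => ?_).trans ((ev_const _ 0).le.trans zero_le)
    refine (ind_of_not ?_).le
    rintro ⟨x, y, hx, hy, hf⟩
    rw [hx] at hy
    cases hy
    cases x <;> exact hf
  refine (ev_mono fun r => ?_).trans (ev_loggedOracle_run_le keys b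
    (fun log => Entry.ephPotential (log i) (log j)) ?_ ?_ alg)
  · cases hi : r.2.2 i with
    | none => rw [ind_of_not (by simp)]; exact zero_le
    | some x =>
      cases hj : r.2.2 j with
      | none => rw [ind_of_not (by simp)]; exact zero_le
      | some y =>
        cases x <;> cases y <;> simp [Entry.ephPotential]
  · intro log sid peer hl
    by_cases hi : sid = i
    · subst hi
      simp only [Function.update_self, Function.update_of_ne (Ne.symm hij), hl]
      rcases log j with _ | _ | _
      · simp [Entry.ephPotential]
      · simp [Entry.ephPotential, Entry.EphFails, ind]
      · simp only [Entry.ephPotential, Entry.EphFails, ev_const, le_refl]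
    · by_cases hj : sid = j
      · subst hj
        simp only [Function.update_self, Function.update_of_ne hij, hl]
        rcases log i with _ | _ | _ <;> simp [Entry.ephPotential, Entry.EphFails, ind]
      · simp only [Function.update_of_ne (Ne.symm hi), Function.update_of_ne (Ne.symm hj), ev_const,
          le_refl]
  · intro log sid peer pke hl
    by_cases hi : sid = i
    · subst hi
      simp only [Function.update_self, Function.update_of_ne (Ne.symm hij), hl]
      rcases log j with _ | _ | _ <;> simp [Entry.ephPotential, Entry.EphFails, ind]
    · by_cases hj : sid = j
      · subst hj
        simp only [Function.update_self, Function.update_of_ne hij, hl]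
        rcases log i with _ | ⟨_, _, _, pk, sk⟩ | _
        · simp only [Entry.ephPotential, ev_const]
          -- The encapsulation came before the key generation, but the two are independent.
          rw [ev_comm]
          exact ev_mono fun e => ev_encaps_le_failure P.eph pke e
        · simp only [Entry.ephPotential, Entry.EphFails, ev_const]
          exact ev_encaps_le_failure P.eph pke (pk, sk)
        · simp [Entry.ephPotential, Entry.EphFails, ind]
      · simp only [Function.update_of_ne (Ne.symm hi), Function.update_of_ne (Ne.symm hj), ev_const,
          le_refl]

/-! ### Exposure implies a forgery or a failure -/

/-- An initiator accepted with the QKD key of the responder `r`, but for another transcript. -/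
def GameState.Forged (r : ℕ) (st : P.GameState N) : Prop :=
  ∃ a sa sb s' m2a m1 m2b, st.sessions r = some sb ∧ sb.Responded m1 m2b ∧
    st.sessions a = some sa ∧ sa.InitiatorAccepted s' m2a ∧ m2a.kid = m2b.kid ∧
      ¬ st.qkd.IsCorrupt m2b.kid ∧ transcript s'.m1 m2a ≠ transcript m1 m2b

/-- Without a forgery the transcripts agree, so the inner tags agree, being computed from one QKD
key. Without failures both sides derive the same `k_pqc`, and since the outer tag is deterministic,
the accepted tag is the one that was sent. Thus the whole second messages coincide. -/
theorem matches_of_not_forged {keys : Fin N → P.stat.PK × P.stat.SK}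
    {st : P.GameState N × Log P N} (hw : WF keys st.1) (hl : LogInv keys st) {a r : ℕ}
    {sa sb : P.Session N} {s' : P.IState} {m2a m2b : P.Msg2} {m1 : Msg1 P.stat P.eph}
    (hr : st.1.sessions r = some sb) (rb : sb.Responded m1 m2b) (ha : st.1.sessions a = some sa)
    (ra : sa.InitiatorAccepted s' m2a) (hkid : m2a.kid = m2b.kid)
    (hc : ¬ st.1.qkd.IsCorrupt m2b.kid) (hf : ¬ st.1.Forged r)
    (hstat : ∀ sid e, st.2 sid = some e → ¬ e.StatFails keys)
    (heph : ∀ x y, st.2 a = some x → st.2 r = some y → ¬ x.EphFails y) :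
    sa.Matches sb ∧ sb.Matches sa := by
  obtain ⟨-, m1', m2', h1, h2, hk⟩ := hw.res _ _ hr rb.role
  rw [rb.m2] at h2
  cases h2
  obtain ⟨⟨k, f⟩, hk⟩ := Option.ne_none_iff_exists'.1 hk
  have hhon : st.1.HonestKey m2b.kid k f := ⟨hk, fun hf => hc ⟨k, hf ▸ hk⟩⟩
  have ht : transcript s'.m1 m2a = transcript m1 m2b := by
    by_contra ht
    exact hf ⟨a, sa, sb, s', m2a, m1, m2b, hr, rb, ha, ra, hkid, hc, ht⟩
  obtain ⟨hh, hp⟩ := hw.acc_res _ _ _ _ _ _ _ _ _ _ ha hr ra rb hkid hhon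
  have htag := hw.res_tag _ _ _ _ _ _ hr rb hhon
  obtain ⟨-, hv1, hv2⟩ := hw.acc_tag _ _ _ _ _ _ ha ra (hkid ▸ hhon)
  have htag1 : m2a.tag1 = m2b.tag1 := by rw [← htag, ← hv1, ht, hh, hp]
  obtain ⟨ka, ke, hlog, htag2⟩ := hl.res _ _ _ _ hr rb
  have hlog' := hl.ini _ _ _ ha ra.role ra.state
  have e1 := hstat _ _ hlog
  have e2 := hstat _ _ hlog'
  have e3 := heph _ _ hlog' hlog
  simp only [Entry.StatFails, not_not] at e1 e2
  obtain ⟨m1a, caa, cea, kida⟩ : transcript s'.m1 m2a = transcript m1 m2b ∧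
    m2a.ca = m2b.ca ∧ m2a.ce = m2b.ce ∧ m2a.kid = m2b.kid := by
    refine ⟨ht, ?_, ?_, ?_⟩
    · exact congrArg Transcript.ca ht
    · exact congrArg Transcript.ce ht
    · exact congrArg Transcript.kid ht
  have hm1 : s'.m1 = m1 := congrArg Transcript.m1 ht
  have e3' : P.eph.decaps s'.ske m2b.ce = ke := by
    by_contra hne
    exact e3 ⟨by rw [hm1], hne⟩
  -- The log entry of the responder settles `k_a` and that of the initiator settles `k_b`; each peer
  -- is the other's holder.
  have hkpqc : sa.kpqc keys s' m2a =
      P.kdf (P.stat.decaps (keys sb.holder).2 m1.cb) ka ke := by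
    rw [Session.kpqc, caa, cea, e3', hh, e1, ← hp, ← hm1, e2]
  have htag2' : m2a.tag2 = m2b.tag2 := by
    rw [← htag2, ← hv2, hkpqc, ht, htag1, hh, hp]
  have hm2 : m2a = m2b := by
    cases m2a
    cases m2b
    simp_all
  subst hm2
  have hma : sa.m1 = some m1 := by
    obtain ⟨s'', hs'', hm⟩ := hw.ini _ _ ha ra.role
    rw [ra.state] at hs''
    cases hs''
    rw [hm, hm1]
  refine ⟨⟨hp.symm, hh.symm, .inl ⟨ra.role, rb.role⟩, ?_, ?_, ?_, ?_⟩,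
    ⟨hh, hp, .inr ⟨rb.role, ra.role⟩, ?_, ?_, ?_, ?_⟩⟩
  all_goals simp [hma, rb.m1, ra.m2, rb.m2]

theorem responded_or_accepted {keys : Fin N → P.stat.PK × P.stat.SK} {st : P.GameState N}
    (hw : WF keys st) {sid : ℕ} {s : P.Session N} {m2 : P.Msg2} (hs : st.sessions sid = some s)
    (hm : s.m2 = some m2) (hk : s.key ≠ none) :
    (∃ m1, s.Responded m1 m2) ∨ ∃ s', s.InitiatorAccepted s' m2 := by
  cases hr : s.role with
  | none => exact absurd (hw.fresh _ _ hs hr).2.2 hk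
  | some role =>
    cases role with
    | initiator =>
      obtain ⟨s', hs', -⟩ := hw.ini _ _ hs hr
      exact .inr ⟨s', hr, hs', hm, hk⟩
    | responder =>
      obtain ⟨-, m1, _, hm1, -⟩ := hw.res _ _ hs hr
      exact .inl ⟨m1, hr, hm1, hm⟩

/-- An exposed test shares its honest QKD key with another session that was revealed. If no forgery
or failure occurred, the two would match, and a matching session is not revealed in a nontrivial
attack. -/
theorem exposed_imp {keys : Fin N → P.stat.PK × P.stat.SK} {st : P.GameState N × Log P N}
    (hw : WF keys st.1) (hl : LogInv keys st) (he : st.1.Exposed) :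
    (∃ r < st.1.numSessions, st.1.Forged r) ∨
    (∃ sid < st.1.numSessions, ∃ e, st.2 sid = some e ∧ e.StatFails keys) ∨
    ∃ i < st.1.numSessions, ∃ j < st.1.numSessions,
      ∃ x y, st.2 i = some x ∧ st.2 j = some y ∧ x.EphFails y := by
  obtain ⟨⟨sid, s, m2, ht, hs, hrev, hm, hc, hmatch⟩, hne⟩ := he
  have hlt : ∀ sid e, st.2 sid = some e → sid < st.1.numSessions := by
    intro sid e h
    obtain ⟨s, hs, -⟩ := hl.started sid (by simp [h])
    exact hw.lt _ _ hs
  by_contra hcon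
  push Not at hcon
  obtain ⟨c1, c2, c3⟩ := hcon
  have hstat : ∀ sid e, st.2 sid = some e → ¬ e.StatFails keys :=
    fun sid e h => c2 sid (hlt _ _ h) e h
  have heph : ∀ a r x y, st.2 a = some x → st.2 r = some y → ¬ x.EphFails y :=
    fun a r x y hx hy => c3 a (hlt _ _ hx) r (hlt _ _ hy) x y hx hy
  have hkey : s.key ≠ none := by
    obtain ⟨s0, hs0, hk⟩ := hw.tested _ ht
    rw [hs] at hs0
    cases hs0
    exact hk
  refine hne m2.kid ⟨⟨sid, s, ht, hs, m2, hm, rfl⟩, hc, fun sid' s' hs' hu => ?_⟩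
  obtain ⟨m2', hm', hkid⟩ := hu
  by_contra hrev'
  rw [Bool.not_eq_false] at hrev'
  have hne' : sid ≠ sid' := by
    rintro rfl
    rw [hs] at hs'
    cases hs'
    simp [hrev] at hrev'
  have hno : ¬ s.Matches s' := fun h => by simp [hmatch _ _ hs' h] at hrev'
  have hkey' := hw.revealed_key _ _ hs' hrev'
  obtain ⟨⟨k, f⟩, hk⟩ : ∃ kf, st.1.qkd.keys m2.kid = some kf := by
    obtain ⟨m, h1, h2⟩ := hw.key_m2 _ _ hs hkey
    rw [hm] at h1
    cases h1
    exact Option.ne_none_iff_exists'.1 h2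
  have hhon : st.1.HonestKey m2.kid k f := ⟨hk, fun hf => hc ⟨k, hf ▸ hk⟩⟩
  -- Two responders contradict the freshness of identifiers, two initiators contradict the single
  -- delivery of an honest key, and in the mixed cases the sessions match.
  rcases responded_or_accepted hw hs hm hkey with ⟨m1, hr⟩ | ⟨i, hi⟩ <;>
    rcases responded_or_accepted hw hs' hm' hkey' with ⟨m1', hr'⟩ | ⟨i', hi'⟩
  · exact hne' (hw.res_unique _ _ _ _ _ _ _ _ hs hs' hr hr' hkid.symm)
  · exact hno (matches_of_not_forged hw hl hs hr hs' hi' hkid hc (c1 _ (hw.lt _ _ hs)) hstat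
      (heph _ _)).2
  · exact hno (matches_of_not_forged hw hl hs' hr' hs hi hkid.symm (hkid ▸ hc)
      (c1 _ (hw.lt _ _ hs')) hstat (heph _ _)).1
  · exact hne' (hw.acc_unique _ _ _ _ _ _ _ _ _ _ hs' hs hi' hi hkid hhon).symm

theorem numSessions_step {keys : Fin N → P.stat.PK × P.stat.SK} {st st' : P.GameState N}
    {q : Query P N} (hs : Step keys st q st') : st'.numSessions ≤ st.numSessions + q.estCost := by
  cases hs with
  | est i j => exact le_rfl
  | _ => exact Nat.le_add_right _ _

theorem ind_exists_lt_le (n : ℕ) (p : ℕ → Prop) :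
    ind (∃ i < n, p i) ≤ ∑ i ∈ Finset.range n, ind (p i) := by
  by_cases h : ∃ i < n, p i
  · obtain ⟨i, hi, hp⟩ := h
    rw [ind_of ⟨i, hi, hp⟩, ← ind_of hp]
    exact Finset.single_le_sum (f := fun i => ind (p i)) (fun _ _ => zero_le)
      (Finset.mem_range.2 hi)
  · rw [ind_of_not h]
    exact zero_le

/-- A union bound over the at most `n` sessions: each may be the forged responder or have a static
failure, and each ordered pair may have an ephemeral failure. -/
theorem ev_exposed_le (keys : Fin N → P.stat.PK × P.stat.SK) (b : Bool) (n : ℕ)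
    (alg : OracleAlg (Query P N) (Response P N) Bool) (hcost : alg.CostAtMost Query.estCost n) :
    (ev (alg.run (P.oracle N keys b) (GameState.start P N)) fun r => ind r.2.Exposed) ≤
      (∑ r ∈ Finset.range n, ev (alg.run (P.oracle N keys b) (GameState.start P N))
        fun x => ind (x.2.Forged r)) +
      (n * (⨆ j, P.stat.failure (keys j)) + n * (n * ev P.eph.keyGen P.eph.failure)) := by
  have hproj := fun f => OracleAlg.ev_run_of_projection (π := Prod.fst)
    (loggedOracle_map keys b) f alg (GameState.start P N, fun _ => none)
  rw [← ev_sum, ← hproj, ← hproj]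
  -- Here `m` is the number of sessions that may still be established.
  have hinv : ∀ r ∈ (alg.run (P.loggedOracle N keys b)
      (GameState.start P N, fun _ => none)).support,
      ∃ m, WF keys r.2.1 ∧ LogInv keys r.2 ∧ r.2.1.numSessions + m ≤ n := by
    refine OracleAlg.inv_of_mem_support_run_of_costAtMost (Inv := fun m st =>
      WF keys st.1 ∧ LogInv keys st ∧ st.1.numSessions + m ≤ n) (fun m q st h hc r hr => ?_)
      alg n _ hcost ⟨wf_start keys, logInv_start keys, by simp [GameState.start]⟩
    have hstep : Step keys st.1 q r.2.1 := by
      have : (r.1, r.2.1) ∈ (P.oracle N keys b q st.1).support := by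
        rw [← loggedOracle_map]
        exact (PMF.mem_support_map_iff _ _ _).2 ⟨r, hr, rfl⟩
      exact step_of_mem_support_oracle this
    have := numSessions_step hstep
    exact ⟨wf_step h.1 hstep, logInv_step h.2.1 hr, by omega⟩
  have hbound : ∀ r ∈ (alg.run (P.loggedOracle N keys b)
      (GameState.start P N, fun _ => none)).support,
      ind r.2.1.Exposed ≤ (∑ i ∈ Finset.range n, ind (r.2.1.Forged i)) +
        ((∑ i ∈ Finset.range n, ind (∃ e, r.2.2 i = some e ∧ e.StatFails keys)) +
          ∑ i ∈ Finset.range n, ∑ j ∈ Finset.range n,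
            ind (∃ x y, r.2.2 i = some x ∧ r.2.2 j = some y ∧ x.EphFails y)) := by
    intro r hr
    obtain ⟨m, hw, hl, hm⟩ := hinv r hr
    have hle : r.2.1.numSessions ≤ n := by omega
    refine (ind_mono (exposed_imp hw hl)).trans ?_
    refine (ind_or_le _ _).trans (add_le_add ?_ ((ind_or_le _ _).trans (add_le_add ?_ ?_)))
    · exact (ind_mono fun ⟨i, hi, h⟩ => ⟨i, hi.trans_le hle, h⟩).trans (ind_exists_lt_le n _)
    · exact (ind_mono fun ⟨i, hi, h⟩ => ⟨i, hi.trans_le hle, h⟩).trans (ind_exists_lt_le n _)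
    · refine (ind_mono fun ⟨i, hi, h⟩ => ⟨i, hi.trans_le hle, h⟩).trans
        ((ind_exists_lt_le n _).trans (Finset.sum_le_sum fun i _ => ?_))
      exact (ind_mono fun ⟨i, hi, h⟩ => ⟨i, hi.trans_le hle, h⟩).trans (ind_exists_lt_le n _)
  refine (ev_mono_support hbound).trans ?_
  rw [ev_add, ev_add, ev_sum, ev_sum, ev_sum]
  refine add_le_add le_rfl (add_le_add ?_ ?_)
  · refine (Finset.sum_le_sum fun i _ => ev_statFails_le keys b i alg).trans ?_
    simp
  · refine (Finset.sum_le_sum fun i _ => (ev_sum _ _ _).le.trans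
      (Finset.sum_le_sum fun j _ => ev_ephFails_le keys b i j alg)).trans ?_
    simp

end Suite

/-- Replace the left half of a string. -/
def Bits.setLeft {m n : ℕ} (x : Bits m) (y : Bits (m + n)) : Bits (m + n) := x.append y.right

namespace Suite

variable {P : Suite} {N : ℕ} {κ : ℕ}

/-! ### The forger -/

open Classical in
/-- The simulation with the unknown key under identifier `κ` stops: the key becomes corrupt, or
an initiator uses it to check a tag. -/
def forgerStop (κ : ℕ) (st : P.GameState N) :
    Query P N → Option (Option ((Transcript P.stat P.eph × ℕ × ℕ) × P.macQkd.Tag))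
  | .qkdLeak kid => if kid = κ then some none else none
  | .qkdOverride kid _ => if kid = κ then some none else none
  | .sendM2 sid m2 =>
      match st.sessions sid with
      | none => none
      | some s =>
          match s.state with
          | none => none
          | some s' =>
              if m2.kid = κ ∧ s.m2 = none ∧
                  (st.qkd.getKeyWithId s.holder s.peer κ).1 ≠ none then
                some (some ((transcript s'.m1 m2, s.holder, s.peer), m2.tag1))
              else none
  | _ => none

/-- Simulate the game until an initiator checks a tag with the QKD key under identifier `κ`. -/
def forgerAfter (keys : Fin N → P.stat.PK × P.stat.SK) (b : Bool) (κ : ℕ) :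
    OracleAlg (Query P N) (Response P N) Bool → P.GameState N → P.macQkd.Forger
  | .done _, _ => .done none
  | .sample p k, st => .sample p fun x => forgerAfter keys b κ (k x) st
  | .ask q k, st =>
      match forgerStop κ st q with
      | some out => .done out
      | none => .sample (P.oracle N keys b q st) fun r => forgerAfter keys b κ (k r.1) r.2

/-- The answer of a responder with the tag `τ` and the right half `ks` of the QKD key. -/
def taggedPost (P : Suite) {N : ℕ} (keys : Fin N → P.stat.PK × P.stat.SK) (st : P.GameState N)
    (s : P.Session N) (m1 : Msg1 P.stat P.eph) (a : P.stat.CT × P.stat.Key)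
    (e : P.eph.CT × P.eph.Key) (ks : P.SessKey) (τ : P.macQkd.Tag) : P.Msg2 × P.SessKey :=
  let kpqc := P.kdf (P.stat.decaps (keys s.holder).2 m1.cb) a.2 e.2
  (⟨a.1, e.1, st.qkd.nextKid, τ,
    P.macPqc.tag kpqc.left (⟨m1, a.1, e.1, st.qkd.nextKid⟩, τ, s.peer, s.holder)⟩,
    Bits.xor ks kpqc.right)

open Classical in
/-- Simulate the game, where the tag of the responder `r` comes from the tagging oracle. -/
def forgerBefore (keys : Fin N → P.stat.PK × P.stat.SK) (b : Bool) (r : ℕ) :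
    OracleAlg (Query P N) (Response P N) Bool → P.GameState N → P.macQkd.Forger
  | .done _, _ => .done none
  | .sample p k, st => .sample p fun x => forgerBefore keys b r (k x) st
  | .ask (.sendM1 sid m1) k, st =>
      if h : sid = r ∧ ∃ s, st.sessions sid = some s ∧ s.role = none then
        let s := h.2.choose
        .sample (P.stat.encaps (keys s.peer).1) fun a => .sample (P.eph.encaps m1.pke) fun e =>
          .sample (PMF.uniformOfFintype P.SessKey) fun ks =>
            .ask (⟨m1, a.1, e.1, st.qkd.nextKid⟩, s.peer, s.holder) fun o =>
              match o with
              | none => .done none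
              | some τ =>
                  let post := taggedPost P keys st s m1 a e ks τ
                  forgerAfter keys b st.qkd.nextKid (k (some post.1))
                    -- Zeros stand for the unknown MAC half of the key; the session half `ks` is
                    -- genuine, so session keys are simulated correctly.
                    (st.answer sid s m1 post (Bits.append (Bits.zero _) ks))
      else .sample (P.oracle N keys b (.sendM1 sid m1) st) fun x => forgerBefore keys b r (k x.1) x.2
  | .ask q k, st => .sample (P.oracle N keys b q st) fun x => forgerBefore keys b r (k x.1) x.2

/-- The forger against the inner MAC that attacks the session `r`. -/
def forger (A : P.Adversary N) (b : Bool) (r : ℕ) : P.macQkd.Forger :=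
  .sample (iid P.stat.keyGen N) fun keys =>
    forgerBefore keys b r (A fun i => (keys i).1) (GameState.start P N)

end Suite

/-- The forger wins with key `k`. -/
def MAC.forgeGain {ℓ : ℕ} {M : Type} (mac : MAC ℓ M) (k : Bits ℓ)
    (x : Option (M × mac.Tag) × Option (M × mac.Tag)) : ℝ≥0∞ :=
  ind (∃ m τ, x.1 = some (m, τ) ∧ mac.tag k m = τ ∧ x.2 ≠ some (m, τ))

namespace Suite

variable {P : Suite} {N : ℕ} {κ : ℕ}

/-! ### Forgeries that can no longer happen -/

theorem responded_step {keys : Fin N → P.stat.PK × P.stat.SK} {st st' : P.GameState N}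
    {q : Query P N} (hb : Basic st) (hs : Step keys st q st') {r : ℕ} {s : P.Session N}
    {m1 : Msg1 P.stat P.eph} {m2 : P.Msg2} (hr : st.sessions r = some s)
    (hres : s.Responded m1 m2) :
    ∃ s', st'.sessions r = some s' ∧ s'.Responded m1 m2 ∧ s'.holder = s.holder ∧
      s'.peer = s.peer := by
  have hne : ∀ {sid s0}, st.sessions sid = some s0 → s0.role = none → r ≠ sid := by
    rintro sid s0 h1 h2 rfl
    rw [hr] at h1
    cases h1
    rw [hres.role] at h2
    cases h2
  cases hs with
  | est i j =>
    exact ⟨s, by simp only; rwa [Function.update_of_ne (hb.lt _ _ hr).ne], hres, rfl, rfl⟩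
  | init sid s0 x hs hr0 hm =>
    refine ⟨s, ?_, hres, rfl, rfl⟩
    simp only [GameState.initiated, GameState.setSession]
    rwa [Function.update_of_ne (hne hs hr0)]
  | sendM1 sid s0 m1 a e k hs hr0 =>
    refine ⟨s, ?_, hres, rfl, rfl⟩
    simp only [GameState.answer, GameState.setSession]
    rwa [Function.update_of_ne (hne hs hr0)]
  | sendM2 sid s0 s' m2 key hs hs' hm hk =>
    refine ⟨s, ?_, hres, rfl, rfl⟩
    simp only [GameState.setSession]
    rwa [Function.update_of_ne]
    rintro rfl
    rw [hr] at hs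
    cases hs
    rw [hres.m2] at hm
    cases hm
  | reveal sid s0 hs hk =>
    simp only [GameState.setSession]
    by_cases h : r = sid
    · subst h
      rw [hr] at hs
      cases hs
      exact ⟨{ s with revealed := true }, by simp, ⟨hres.role, hres.m1, hres.m2⟩, rfl, rfl⟩
    · exact ⟨s, by rwa [Function.update_of_ne h], hres, rfl, rfl⟩
  | _ => exact ⟨s, hr, hres, rfl, rfl⟩

/-- The QKD key of the responder `r` cannot be used for a forgery any more. -/
def GameState.Settled (r : ℕ) (st : P.GameState N) : Prop :=
  ∃ sb m1 m2b, st.sessions r = some sb ∧ sb.Responded m1 m2b ∧ (st.qkd.IsCorrupt m2b.kid ∨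
    (∃ k, st.qkd.keys m2b.kid = some (k, .delivered)) ∧
      ∀ a sa s' m2a, st.sessions a = some sa → sa.InitiatorAccepted s' m2a →
        m2a.kid = m2b.kid → transcript s'.m1 m2a = transcript m1 m2b)

theorem not_forged_of_settled {r : ℕ} {st : P.GameState N} (h : st.Settled r) :
    ¬ st.Forged r := by
  rintro ⟨a, sa, sb', s', m2a, m1', m2b', hr', rb', ha, ra, hkid, hc, ht⟩
  obtain ⟨sb, m1, m2b, hr, rb, h⟩ := h
  rw [hr] at hr'
  cases hr'
  have e1 : m1 = m1' := Option.some_injective _ (rb.m1.symm.trans rb'.m1)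
  have e2 : m2b = m2b' := Option.some_injective _ (rb.m2.symm.trans rb'.m2)
  subst e1 e2
  rcases h with h | ⟨-, h⟩
  · exact hc h
  · exact ht (h _ _ _ _ ha ra hkid)

/-- A delivered key is never handed out again, so it gains no further accepting initiator. It can
still become corrupt, and that is permanent. -/
theorem settled_step {keys : Fin N → P.stat.PK × P.stat.SK} {st st' : P.GameState N}
    {q : Query P N} {r : ℕ} (hb : Basic st) (hs : Step keys st q st') (h : st.Settled r) :
    st'.Settled r := by
  obtain ⟨sb, m1, m2b, hr, rb, h⟩ := h
  obtain ⟨sb', hr', rb', -⟩ := responded_step hb hs hr rb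
  refine ⟨sb', m1, m2b, hr', rb', ?_⟩
  rcases h with h | ⟨⟨k, hk⟩, h⟩
  · exact .inl (isCorrupt_step hb hs h)
  have hlt := hb.kid_lt m2b.kid (by simp [hk])
  clear hr' rb'
  cases hs with
  | noop => exact .inr ⟨⟨k, hk⟩, h⟩
  | est i j =>
    refine .inr ⟨⟨k, hk⟩, fun a sa s' m2a ha ra hkid => ?_⟩
    simp only [Function.update_apply] at ha
    split_ifs at ha with hsid
    · injection ha with ha
      subst ha
      cases ra.role
    · exact h _ _ _ _ ha ra hkid
  | init sid s x hs hr0 hm =>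
    refine .inr ⟨⟨k, hk⟩, fun a sa s' m2a ha ra hkid => ?_⟩
    simp only [GameState.initiated, GameState.setSession, Function.update_apply] at ha
    split_ifs at ha with hsid
    · injection ha with ha
      subst ha
      exact absurd (hb.fresh _ _ hs hr0).2.2 ra.key
    · exact h _ _ _ _ ha ra hkid
  | sendM1 sid s m1' a e k' hs hr0 =>
    refine .inr ⟨⟨k, ?_⟩, fun a sa s' m2a ha ra hkid => ?_⟩
    · simp only [GameState.answer, GameState.setSession, QkdState.set]
      rwa [Function.update_of_ne hlt.ne]
    · simp only [GameState.answer, GameState.setSession, Function.update_apply] at ha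
      split_ifs at ha with hsid
      · injection ha with ha
        subst ha
        cases ra.role
      · exact h _ _ _ _ ha ra hkid
  | sendM2 sid s s' m2 key hs hs' hm hkey =>
    have hget : m2.kid = m2b.kid → (st.qkd.getKeyWithId s.holder s.peer m2.kid).1 = none := by
      intro he
      simp [QkdState.getKeyWithId, he, hk]
    refine .inr ⟨⟨k, ?_⟩, fun a sa s'' m2a ha ra hkid => ?_⟩
    · rcases getKeyWithId_cases st.qkd s.holder s.peer m2.kid with
        ⟨-, hg⟩ | ⟨k', -, -, hg⟩ | ⟨k', hk', -, hg⟩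
      · simpa only [GameState.setSession, hg] using hk
      · simpa only [GameState.setSession, hg] using hk
      · simp only [GameState.setSession, hg, QkdState.set]
        rwa [Function.update_of_ne]
        intro he
        rw [← he, hk] at hk'
        cases hk'
    · simp only [GameState.setSession, Function.update_apply] at ha
      split_ifs at ha with hsid
      · injection ha with ha
        subst ha
        obtain ⟨k', hk', -⟩ := hkey ra.key
        have e2 : m2 = m2a := Option.some_injective _ ra.m2
        subst e2
        rw [hget hkid] at hk'
        cases hk'
      · exact h _ _ _ _ ha ra hkid
  | reveal sid s hs hkey =>
    refine .inr ⟨⟨k, hk⟩, fun a sa s' m2a ha ra hkid => ?_⟩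
    simp only [GameState.setSession, Function.update_apply] at ha
    split_ifs at ha with hsid
    · injection ha with ha
      subst ha
      exact h _ _ _ _ hs ⟨ra.role, ra.state, ra.m2, ra.key⟩ hkid
    · exact h _ _ _ _ ha ra hkid
  | test sid s hs hkey ht => exact .inr ⟨⟨k, hk⟩, h⟩
  | leak kid k' f hk' =>
    by_cases hkid : m2b.kid = kid
    · exact .inl ⟨k', by simp [QkdState.set, hkid]⟩
    · exact .inr ⟨⟨k, by simpa [QkdState.set, hkid] using hk⟩, h⟩
  | override kid k' =>
    by_cases hkid : m2b.kid = kid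
    · exact .inl ⟨k', by simp [QkdState.set, hkid]⟩
    · exact .inr ⟨⟨k, by simpa [QkdState.set, hkid] using hk⟩, h⟩

/-- The probability of a forgery against the responder `r`. -/
abbrev forgeProb (keys : Fin N → P.stat.PK × P.stat.SK) (b : Bool) (r : ℕ)
    (alg : OracleAlg (Query P N) (Response P N) Bool) (st : P.GameState N) : ℝ≥0∞ :=
  ev (alg.run (P.oracle N keys b) st) fun x => ind (x.2.Forged r)

theorem forgeProb_of_settled (keys : Fin N → P.stat.PK × P.stat.SK) (b : Bool) (r : ℕ)
    (alg : OracleAlg (Query P N) (Response P N) Bool) (st : P.GameState N) (hb : Basic st)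
    (h : st.Settled r) : forgeProb keys b r alg st = 0 := by
  refine ev_eq_zero_of_support fun x hx => ind_of_not ?_
  have := OracleAlg.inv_of_mem_support_run (P.oracle N keys b)
    (Inv := fun st => Basic st ∧ st.Settled r)
    (fun q st hst r hr =>
      have := step_of_mem_support_oracle hr
      ⟨basic_step hst.1 this, settled_step hst.1 this hst.2⟩) alg st ⟨hb, h⟩ x hx
  exact not_forged_of_settled this.2

/-! ### Analysis of the forger -/

theorem sessions_shift_zero (h : P.QkdKey → P.QkdKey) (st : P.GameState N) :
    (st.shift κ h (Bits.zero _)).sessions = st.sessions := by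
  funext sid
  rw [sessions_shift]
  cases st.sessions sid <;> simp

/-- An initiator is about to use the QKD key under identifier `κ`. -/
structure ChecksTag (κ : ℕ) (st : P.GameState N) (sid : ℕ) (m2 : P.Msg2) (s : P.Session N)
    (s' : P.IState) : Prop where
  kid : m2.kid = κ
  session : st.sessions sid = some s
  state : s.state = some s'
  m2_none : s.m2 = none
  get : (st.qkd.getKeyWithId s.holder s.peer κ).1 ≠ none

theorem forgerStop_of_checksTag {st : P.GameState N} {sid : ℕ} {m2 : P.Msg2} {s : P.Session N}
    {s' : P.IState} (h : ChecksTag κ st sid m2 s s') :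
    forgerStop κ st (.sendM2 sid m2) =
      some (some ((transcript s'.m1 m2, (s.holder : ℕ), (s.peer : ℕ)), m2.tag1)) := by
  simp only [forgerStop, h.session, h.state]
  rw [if_pos ⟨h.kid, h.m2_none, h.get⟩]

theorem forgerStop_eq_some {st : P.GameState N} {q : Query P N}
    {out : Option ((Transcript P.stat P.eph × ℕ × ℕ) × P.macQkd.Tag)}
    (h : forgerStop κ st q = some out) :
    q = .qkdLeak κ ∨ (∃ k, q = .qkdOverride κ k) ∨ ∃ sid m2 s s', q = .sendM2 sid m2 ∧
      ChecksTag κ st sid m2 s s' ∧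
        out = some ((transcript s'.m1 m2, (s.holder : ℕ), (s.peer : ℕ)), m2.tag1) := by
  cases q with
  | qkdLeak kid =>
    simp only [forgerStop] at h
    split_ifs at h with hk
    exact .inl (by rw [hk])
  | qkdOverride kid k =>
    simp only [forgerStop] at h
    split_ifs at h with hk
    exact .inr (.inl ⟨k, by rw [hk]⟩)
  | sendM2 sid m2 =>
    simp only [forgerStop] at h
    split at h
    · cases h
    · rename_i s hs
      split at h
      · cases h
      · rename_i s' hs'
        split_ifs at h with hc
        injection h with h
        exact .inr (.inr ⟨sid, m2, s, s', rfl, ⟨hc.1, hs, hs', hc.2.1, hc.2.2⟩, h.symm⟩)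
  | _ => cases h

/-- After the responder's reply, the MAC half of its key is needed only for a check by an initiator
or an answer to a leak, and an override would replace the key. The forger stops at all three, so
until then the key may be changed arbitrarily. -/
theorem oracle_shift_of_forgerStop (keys : Fin N → P.stat.PK × P.stat.SK) (b : Bool)
    (h : P.QkdKey → P.QkdKey) (st : P.GameState N) (q : Query P N)
    (hκ : st.qkd.nextKid ≠ κ) (hq : forgerStop κ st q = none) :
    P.oracle N keys b q (st.shift κ h (Bits.zero _)) =
      (P.oracle N keys b q st).map fun r => (r.1, r.2.shift κ h (Bits.zero _)) := by
  cases q with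
  | est i j => exact oracle_est_shift keys b st i j
  | init sid => exact oracle_init_shift keys b st sid
  | sendM1 sid m1 => exact oracle_sendM1_shift_of_ne keys b st sid m1 hκ
  | sendM2 sid m2 =>
    refine oracle_sendM2_shift keys b st sid m2 fun hk => .inr ⟨rfl, fun s s' hs hs' hm => ?_⟩
    by_contra hg
    rw [forgerStop_of_checksTag ⟨hk, hs, hs', hm, hg⟩] at hq
    cases hq
  | reveal sid => exact oracle_reveal_shift keys b st sid (.inl rfl)
  | revState sid => exact oracle_revState_shift keys b st sid
  | corrupt i => exact oracle_corrupt_shift keys b st i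
  | test sid => exact oracle_test_shift keys b st sid (.inl rfl)
  | qkdLeak kid =>
    refine oracle_qkdLeak_shift keys b st kid fun hk => ?_
    simp [forgerStop, hk] at hq
  | qkdOverride kid k =>
    refine oracle_qkdOverride_shift keys b st kid k fun hk => ?_
    simp [forgerStop, hk] at hq

/-- The QKD key under identifier `κ` of the responder `r`, who tagged `msg`, was not used yet. -/
def Awaiting (κ r : ℕ) (msg : Transcript P.stat P.eph × ℕ × ℕ) (st : P.GameState N) : Prop :=
  ∃ sb m1 m2 k, st.sessions r = some sb ∧ sb.Responded m1 m2 ∧ m2.kid = κ ∧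
    msg = (transcript m1 m2, (sb.peer : ℕ), (sb.holder : ℕ)) ∧
      st.qkd.keys κ = some (k, .waiting sb.holder sb.peer)

/-- A query that would retrieve or corrupt the key makes the forger stop, and every other query
leaves the key and its flag alone. -/
theorem awaiting_step {keys : Fin N → P.stat.PK × P.stat.SK} {st st' : P.GameState N}
    {q : Query P N} {r : ℕ} {msg : Transcript P.stat P.eph × ℕ × ℕ} (hb : Basic st)
    (hs : Step keys st q st') (hq : forgerStop κ st q = none) (h : Awaiting κ r msg st) :
    Awaiting κ r msg st' := by
  obtain ⟨sb, m1, m2, k, hr, rb, hkid, hmsg, hk⟩ := h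
  obtain ⟨sb', hr', rb', hh, hp⟩ := responded_step hb hs hr rb
  have hlt := hb.kid_lt κ (by simp [hk])
  refine ⟨sb', m1, m2, k, hr', rb', hkid, by rw [hh, hp, hmsg], ?_⟩
  rw [hh, hp]
  clear hr' rb' hh hp
  cases hs with
  | sendM1 sid s m1' a e k' hs hr0 =>
    simp only [GameState.answer, GameState.setSession, QkdState.set]
    rwa [Function.update_of_ne hlt.ne]
  | sendM2 sid s s' m2' key hs hs' hm hkey =>
    rcases getKeyWithId_cases st.qkd s.holder s.peer m2'.kid with
      ⟨-, hg⟩ | ⟨k', -, -, hg⟩ | ⟨k', hk', hg', hg⟩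
    · simpa only [GameState.setSession, hg] using hk
    · simpa only [GameState.setSession, hg] using hk
    · simp only [GameState.setSession, hg, QkdState.set]
      rwa [Function.update_of_ne]
      intro he
      rw [forgerStop_of_checksTag ⟨he.symm, hs, hs', hm, by rw [he, hg']; simp⟩] at hq
      cases hq
  | leak kid k' f hk' =>
    simp only [QkdState.set]
    rwa [Function.update_of_ne]
    rintro rfl
    simp [forgerStop] at hq
  | override kid k' =>
    simp only [QkdState.set]
    rwa [Function.update_of_ne]
    rintro rfl
    simp [forgerStop] at hq
  | _ => exact hk

/-- An initiator that accepted with an honest key leaves it flagged `delivered`, but this one is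
still `waiting`. -/
theorem not_forged_of_awaiting {keys : Fin N → P.stat.PK × P.stat.SK} {st : P.GameState N}
    {r : ℕ} {msg : Transcript P.stat P.eph × ℕ × ℕ} (hw : WF keys st)
    (h : Awaiting κ r msg st) : ¬ st.Forged r := by
  obtain ⟨sb, m1, m2, k, hr, rb, hkid, hmsg, hk⟩ := h
  rintro ⟨a, sa, sb', s', m2a, m1', m2b, hr', rb', ha, ra, hkid', hc, ht⟩
  rw [hr] at hr'
  cases hr'
  have e2 : m2 = m2b := Option.some_injective _ (rb.m2.symm.trans rb'.m2)
  subst e2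
  have := (hw.acc_tag _ _ _ _ _ _ ha ra ⟨by rw [hkid', hkid]; exact hk, by simp⟩).1
  cases this

theorem awaiting_shift {st : P.GameState N} {h : P.QkdKey → P.QkdKey}
    {r : ℕ} {msg : Transcript P.stat P.eph × ℕ × ℕ} (hst : Awaiting κ r msg st) :
    Awaiting κ r msg (st.shift κ h (Bits.zero _)) := by
  obtain ⟨sb, m1, m2, k, hr, rb, hkid, hmsg, hk⟩ := hst
  exact ⟨sb, m1, m2, h k, by rwa [sessions_shift_zero], rb, hkid, hmsg,
    by simp [GameState.shift, QkdState.shift, hk]⟩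

/-- The game continues after an initiator checked a tag with the key of the responder `r`. -/
theorem forgeProb_sendM2_le {keys : Fin N → P.stat.PK × P.stat.SK} {b : Bool} {st : P.GameState N}
    {r : ℕ} {msg : Transcript P.stat P.eph × ℕ × ℕ} (hw : WF keys st)
    (hst : Awaiting κ r msg st) {km : Bits P.lenMacQkd}
    (hkm : ∀ k f, st.qkd.keys κ = some (k, f) → k.left = km) {sid : ℕ} {m2 : P.Msg2}
    {s : P.Session N} {s' : P.IState} (hc : ChecksTag κ st sid m2 s s')
    (k : Response P N (.sendM2 sid m2) → OracleAlg (Query P N) (Response P N) Bool) :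
    forgeProb keys b r (.ask (.sendM2 sid m2) k) st ≤
      P.macQkd.forgeGain km (some ((transcript s'.m1 m2, (s.holder : ℕ), (s.peer : ℕ)), m2.tag1),
        some (msg, P.macQkd.tag km msg)) := by
  -- If the pair wins, the right side is 1. Otherwise the inner tag is invalid, or the pair is the
  -- one from the tagging oracle. In both cases the check uses up the key without a forgery, and the
  -- left side is 0.
  by_cases hwin : P.macQkd.tag km (transcript s'.m1 m2, (s.holder : ℕ), (s.peer : ℕ)) = m2.tag1 ∧
      (msg, P.macQkd.tag km msg) ≠ ((transcript s'.m1 m2, (s.holder : ℕ), (s.peer : ℕ)), m2.tag1)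
  · rw [MAC.forgeGain, ind_of]
    · exact ev_le_of_support fun _ _ => ind_le_one _
    · exact ⟨_, _, rfl, hwin.1, fun h => hwin.2 (Option.some_injective _ h)⟩
  refine le_of_eq_of_le ?_ zero_le
  rw [forgeProb, OracleAlg.ev_run_ask]
  refine ev_eq_zero_of_support fun x hx => forgeProb_of_settled keys b r _ _
    (basic_step hw.toBasic (step_of_mem_support_oracle hx)) ?_
  obtain ⟨sb, m1, m2b, k0, hr, rb, hkid, rfl, hk0⟩ := hst
  have hstep := step_of_mem_support_oracle hx
  obtain ⟨sb', hr', rb', -⟩ := responded_step hw.toBasic hstep hr rb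
  refine ⟨sb', m1, m2b, hr', rb', .inr ?_⟩
  rw [oracle_sendM2 keys b st sid m2 s s' hc.session hc.state hc.m2_none] at hx
  rw [(PMF.mem_support_pure_iff _ _).1 hx]
  have hget := hc.get
  rcases getKeyWithId_cases st.qkd s.holder s.peer κ with
    ⟨hg, -⟩ | ⟨k', hk', -, -⟩ | ⟨k', hk', hg1, hg2⟩
  · exact absurd hg hget
  · rw [hk0] at hk'
    cases hk'
  have hk0' : k' = k0 := by
    exact (congrArg Prod.fst (Option.some_injective _ (hk0.symm.trans hk'))).symm
  subst hk0'
  refine ⟨⟨k', ?_⟩, fun a sa s'' m2a ha ra hkid' => ?_⟩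
  · simp [GameState.setSession, hc.kid, hg2, hkid, QkdState.set]
  · simp only [GameState.setSession, Function.update_apply] at ha
    split_ifs at ha with hsid
    · injection ha with ha
      subst ha
      have hkey := ra.key
      simp only [sendM2_fst, hc.kid, hg1, Option.bind_some] at hkey
      have hv : s.TagsValid keys s' m2 k' := by
        by_contra hv
        exact hkey (if_neg hv)
      have e1 : s' = s'' := Option.some_injective _ (hc.state.symm.trans ra.state)
      have e2 : m2 = m2a := Option.some_injective _ ra.m2
      subst e1 e2
      by_contra ht
      refine hwin ⟨by rw [← hkm _ _ hk0]; exact hv.1, fun h => ht ?_⟩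
      exact (congrArg (fun x => x.1.1) h).symm
    -- An initiator that had accepted earlier would contradict the flag `waiting` before this check.
    · have := (hw.acc_tag _ _ _ _ _ _ ha ra ⟨by rw [hkid', hkid]; exact hk0, by simp⟩).1
      cases this

/-- The real game and the simulation run in parallel; their states differ by the MAC half of the key
`κ` only, which is `km` in the real one. `WF` is required of the real state alone, since in the
simulated one the responder's tag need not belong to the stored key; there `Basic` suffices. -/
theorem forgeProb_le_forgerAfter (keys : Fin N → P.stat.PK × P.stat.SK) (b : Bool) (r : ℕ)
    (km : Bits P.lenMacQkd) (msg : Transcript P.stat P.eph × ℕ × ℕ)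
    (alg : OracleAlg (Query P N) (Response P N) Bool) :
    ∀ st : P.GameState N, WF keys (st.shift κ (Bits.setLeft km) (Bits.zero _)) → Basic st →
      Awaiting κ r msg st →
      forgeProb keys b r alg (st.shift κ (Bits.setLeft km) (Bits.zero _)) ≤
        ev ((forgerAfter keys b κ alg st).run (P.macQkd.tagOracle km)
          (some (msg, P.macQkd.tag km msg))) (P.macQkd.forgeGain km) := by
  induction alg with
  | done a =>
    intro st hw hb hst
    rw [forgeProb, OracleAlg.ev_run_done,
      ind_of_not (not_forged_of_awaiting hw (awaiting_shift hst))]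
    exact zero_le
  | sample p k ih =>
    intro st hw hb hst
    simp only [forgeProb, forgerAfter, OracleAlg.ev_run_sample]
    exact ev_mono fun x => ih x st hw hb hst
  | ask q k ih =>
    intro st hw hb hst
    cases hq : forgerStop κ st q with
    | none =>
      obtain ⟨sb, m1, m2, k0, -, -, -, -, hk0⟩ := id hst
      have hne : st.qkd.nextKid ≠ κ := (hb.kid_lt κ (by simp [hk0])).ne'
      have ho := oracle_shift_of_forgerStop keys b (Bits.setLeft km) st q hne hq
      simp only [forgeProb, forgerAfter, hq, OracleAlg.ev_run_sample, OracleAlg.ev_run_ask]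
      rw [ho, ev_map]
      refine ev_mono_support fun x hx => ih x.1 x.2 ?_ ?_ ?_
      · refine wf_step hw (step_of_mem_support_oracle (b := b) (q := q)
          (r := (x.1, x.2.shift κ (Bits.setLeft km) (Bits.zero _))) ?_)
        rw [ho]
        exact (PMF.mem_support_map_iff _ _ _).2 ⟨x, hx, rfl⟩
      · exact basic_step hb (step_of_mem_support_oracle hx)
      · exact awaiting_step hb (step_of_mem_support_oracle hx) hq hst
    | some out =>
      simp only [forgerAfter, hq, OracleAlg.ev_run_done]
      -- When the key becomes corrupt, no forgery against `r` is possible any more, so nothing is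
      -- lost when the forger gives up.
      have hcor : ∀ q' : Query P N, (q' = .qkdLeak κ ∨ ∃ k, q' = .qkdOverride κ k) →
          ∀ x ∈ (P.oracle N keys b q' (st.shift κ (Bits.setLeft km) (Bits.zero _))).support,
            Basic x.2 ∧ x.2.Settled r := by
        intro q' hq' x hx
        have hstep := step_of_mem_support_oracle hx
        obtain ⟨sb, m1, m2b, k0, hr, rb, hkid, -, hk0⟩ :=
          awaiting_shift (h := Bits.setLeft km) hst
        obtain ⟨sb', hr', rb', -⟩ := responded_step hw.toBasic hstep hr rb
        refine ⟨basic_step hw.toBasic hstep, sb', m1, m2b, hr', rb', .inl ?_⟩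
        rw [hkid]
        rcases hq' with rfl | ⟨k', rfl⟩
        · simp only [oracle] at hx
          rw [(PMF.mem_support_pure_iff _ _).1 hx]
          exact ⟨k0, by simp [QkdState.leak, hk0, QkdState.set]⟩
        · simp only [oracle] at hx
          rw [(PMF.mem_support_pure_iff _ _).1 hx]
          exact ⟨k', by simp [QkdState.override, QkdState.set]⟩
      have hzero : (q = .qkdLeak κ ∨ ∃ k, q = .qkdOverride κ k) →
          forgeProb keys b r (.ask q k) (st.shift κ (Bits.setLeft km) (Bits.zero _)) = 0 := by
        intro hq'
        rw [forgeProb, OracleAlg.ev_run_ask]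
        exact ev_eq_zero_of_support fun x hx => forgeProb_of_settled keys b r _ _
          (hcor q hq' x hx).1 (hcor q hq' x hx).2
      rcases forgerStop_eq_some hq with hq' | hq' | ⟨sid, m2, s, s', rfl, hc, rfl⟩
      · rw [hzero (.inl hq')]; exact zero_le
      · rw [hzero (.inr hq')]; exact zero_le
      · refine forgeProb_sendM2_le hw (awaiting_shift hst) ?_ ⟨hc.kid, ?_, hc.state, hc.m2_none, ?_⟩ k
        · intro k' f hk'
          simp only [GameState.shift, QkdState.shift, if_true, Option.map_eq_some_iff] at hk'
          obtain ⟨kf, -, he⟩ := hk'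
          injection he with he
          rw [← he, Bits.setLeft, Bits.left_append]
        · rw [sessions_shift_zero]; exact hc.session
        · have := hc.get
          change ((st.qkd.shift κ (Bits.setLeft km)).getKeyWithId _ _ _).1 ≠ none
          rw [QkdState.getKeyWithId_shift]
          simpa using this

/-! ### The forger up to the answer of the attacked responder -/

/-- The session `r` is no responder yet. -/
def Unanswered (r : ℕ) (st : P.GameState N) : Prop :=
  ∀ s, st.sessions r = some s → s.role ≠ some .responder

theorem unanswered_step {keys : Fin N → P.stat.PK × P.stat.SK} {st st' : P.GameState N}
    {q : Query P N} {r : ℕ} (hs : Step keys st q st')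
    (hq : ∀ m1 s, q = .sendM1 r m1 → st.sessions r = some s → s.role ≠ none)
    (h : Unanswered r st) : Unanswered r st' := by
  unfold Unanswered at h ⊢
  cases hs with
  | est i j =>
    simp only [Function.update_apply]
    grind
  | init sid s x hs hr0 hm =>
    simp only [GameState.initiated, GameState.setSession, Function.update_apply]
    grind
  | sendM1 sid s m1 a e k hs hr0 =>
    have : r ≠ sid := by
      rintro rfl
      exact hq m1 s rfl hs hr0
    simp only [GameState.answer, GameState.setSession]
    rwa [Function.update_of_ne this]
  | sendM2 sid s s' m2 key hs hs' hm hk =>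
    simp only [GameState.setSession, Function.update_apply]
    grind
  | reveal sid s hs hk =>
    simp only [GameState.setSession, Function.update_apply]
    grind
  | _ => exact h

/-- The reply and session key depend on the MAC half through the inner tag only, which is why a
single tagging query is enough. -/
theorem responderPost_append (keys : Fin N → P.stat.PK × P.stat.SK) (st : P.GameState N)
    (s : P.Session N) (m1 : Msg1 P.stat P.eph) (a : P.stat.CT × P.stat.Key)
    (e : P.eph.CT × P.eph.Key) (km : Bits P.lenMacQkd) (ks : P.SessKey) :
    responderPost P keys st s m1 a e (km.append ks) = taggedPost P keys st s m1 a e ks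
      (P.macQkd.tag km (⟨m1, a.1, e.1, st.qkd.nextKid⟩, s.peer, s.holder)) := by
  simp only [responderPost, combine, taggedPost, Bits.left_append, Bits.right_append]

theorem forgerBefore_ask_of_not (keys : Fin N → P.stat.PK × P.stat.SK) (b : Bool) (r : ℕ)
    (q : Query P N) (k : Response P N q → OracleAlg (Query P N) (Response P N) Bool)
    (st : P.GameState N)
    (hq : ∀ m1 s, q = .sendM1 r m1 → st.sessions r = some s → s.role ≠ none) :
    forgerBefore keys b r (.ask q k) st =
      .sample (P.oracle N keys b q st) fun x => forgerBefore keys b r (k x.1) x.2 := by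
  cases q with
  | sendM1 sid m1 =>
    rw [forgerBefore, dif_neg]
    rintro ⟨rfl, s, hs, hr⟩
    exact hq m1 s rfl hs hr
  | _ => rw [forgerBefore]; simp

/-- No key is stored under `nextKid` before the answer, so the change affects exactly the new key.
-/
theorem answer_shift {st : P.GameState N} (hst : Basic st) (h : P.QkdKey → P.QkdKey) (sid : ℕ)
    (s : P.Session N) (m1 : Msg1 P.stat P.eph) (post : P.Msg2 × P.SessKey) (k : P.QkdKey) :
    (st.answer sid s m1 post k).shift st.qkd.nextKid h (Bits.zero _) =
      st.answer sid s m1 post (h k) := by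
  have hnone : st.qkd.keys st.qkd.nextKid = none := by
    by_contra hk
    exact (hst.kid_lt _ hk).false
  have hq : st.qkd.shift st.qkd.nextKid h = st.qkd := by
    have : (fun kid => (st.qkd.keys kid).map fun kf =>
        (if kid = st.qkd.nextKid then h kf.1 else kf.1, kf.2)) = st.qkd.keys := by
      funext kid
      by_cases hkid : kid = st.qkd.nextKid
      · rw [hkid, hnone]; rfl
      · cases st.qkd.keys kid <;> simp [hkid]
    simp only [QkdState.shift, this]
  have hs : ∀ qs : P.QkdState, ({ st with qkd := qs } : P.GameState N).shift st.qkd.nextKid h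
      (Bits.zero _) = { st with qkd := qs.shift st.qkd.nextKid h } := by
    intro qs
    have := sessions_shift_zero (κ := st.qkd.nextKid) h ({ st with qkd := qs } : P.GameState N)
    simp only [GameState.shift] at this ⊢
    rw [this]
  rw [GameState.answer, GameState.shift_setSession, Session.shift_zero, hs, QkdState.shift_set,
    if_pos rfl, hq]
  rfl

theorem not_forged_of_unanswered {r : ℕ} {st : P.GameState N} (h : Unanswered r st) :
    ¬ st.Forged r := by
  rintro ⟨-, -, sb, -, -, m1, m2, hr, rb, -⟩
  exact h sb hr rb.role

/-- The forger wins at least with the probability of a forgery in the continuation of a game in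
which the responder `r` used a uniformly random key. -/
theorem forgeProb_answer_le {keys : Fin N → P.stat.PK × P.stat.SK} (b : Bool) {r : ℕ}
    {st : P.GameState N} (hw : WF keys st) {s : P.Session N} (hs : st.sessions r = some s)
    (hr : s.role = none) (m1 : Msg1 P.stat P.eph) (a : P.stat.CT × P.stat.Key)
    (e : P.eph.CT × P.eph.Key) (km : Bits P.lenMacQkd) (ks : P.SessKey)
    (k : Response P N (.sendM1 r m1) → OracleAlg (Query P N) (Response P N) Bool) :
    (forgeProb keys b r
        (k (some (responderPost P keys st s m1 a e (km.append ks)).1))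
        (st.answer r s m1 (responderPost P keys st s m1 a e (km.append ks)) (km.append ks))) ≤
      ev ((forgerAfter keys b st.qkd.nextKid
          (k (some (responderPost P keys st s m1 a e (km.append ks)).1))
          (st.answer r s m1 (responderPost P keys st s m1 a e (km.append ks))
            (Bits.append (Bits.zero _) ks))).run (P.macQkd.tagOracle km)
          (some ((⟨m1, a.1, e.1, st.qkd.nextKid⟩, s.peer, s.holder),
            P.macQkd.tag km (⟨m1, a.1, e.1, st.qkd.nextKid⟩, s.peer, s.holder))))
        (P.macQkd.forgeGain km) := by
  have hw' := wf_sendM1 hw r s m1 a e (km.append ks) hs hr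
  set post := responderPost P keys st s m1 a e (km.append ks) with hpost
  -- The real and the simulated state are obtained from each other by replacing the MAC half of the
  -- new key, in both directions.
  have hshift : ∀ x y : Bits P.lenMacQkd, st.answer r s m1 post (x.append ks) =
      (st.answer r s m1 post (y.append ks)).shift st.qkd.nextKid (Bits.setLeft x)
        (Bits.zero _) := by
    intro x y
    rw [answer_shift hw.toBasic, Bits.setLeft, Bits.right_append]
  rw [hshift km (Bits.zero _)] at hw' ⊢
  refine forgeProb_le_forgerAfter keys b r km _ _ _ hw' ?_ ?_
  · rw [hshift (Bits.zero _) km]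
    refine basic_shift ?_
    rw [hshift km (Bits.zero _)]
    exact hw'.toBasic
  · exact ⟨{ s with
      role := some .responder
      m1 := some m1
      m2 := some post.1
      key := some post.2 }, m1, post.1, Bits.append (Bits.zero _) ks,
      by simp [GameState.answer, GameState.setSession], ⟨rfl, rfl, rfl⟩, rfl, rfl,
      by simp [GameState.answer, GameState.setSession, QkdState.set]⟩

/-- Until session `r` answers, the simulation is the real game and does not involve `km`. At that
moment the uniform QKD key of the game is assembled from the challenger's `km` and the forger's own
`ks`. -/
theorem forgeProb_le_forgerBefore (keys : Fin N → P.stat.PK × P.stat.SK) (b : Bool) (r : ℕ)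
    (alg : OracleAlg (Query P N) (Response P N) Bool) :
    ∀ st : P.GameState N, WF keys st → Unanswered r st →
      forgeProb keys b r alg st ≤ ev (PMF.uniformOfFintype (Bits P.lenMacQkd)) fun km =>
        ev ((forgerBefore keys b r alg st).run (P.macQkd.tagOracle km) none)
          (P.macQkd.forgeGain km) := by
  induction alg with
  | done a =>
    intro st hw hst
    rw [forgeProb, OracleAlg.ev_run_done, ind_of_not (not_forged_of_unanswered hst)]
    exact zero_le
  | sample p k ih =>
    intro st hw hst
    simp only [forgeProb, forgerBefore, OracleAlg.ev_run_sample]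
    rw [ev_comm]
    exact ev_mono fun x => ih x st hw hst
  | ask q k ih =>
    intro st hw hst
    by_cases hq : ∀ m1 s, q = .sendM1 r m1 → st.sessions r = some s → s.role ≠ none
    · rw [forgerBefore_ask_of_not keys b r q k st hq, forgeProb, OracleAlg.ev_run_ask]
      simp only [OracleAlg.ev_run_sample]
      rw [ev_comm]
      refine ev_mono_support fun x hx => ?_
      have hstep := step_of_mem_support_oracle hx
      exact ih x.1 x.2 (wf_step hw hstep) (unanswered_step hstep hq hst)
    · push Not at hq
      obtain ⟨m1, s, rfl, hs, hr⟩ := hq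
      have h : r = r ∧ ∃ s, st.sessions r = some s ∧ s.role = none := ⟨rfl, s, hs, hr⟩
      have hchoose : h.2.choose = s :=
        Option.some_injective _ (h.2.choose_spec.1.symm.trans hs)
      rw [forgerBefore, dif_pos h, forgeProb, OracleAlg.ev_run_ask,
        oracle_sendM1 keys b st r m1 s hs hr]
      simp only [hchoose, OracleAlg.ev_run_sample, OracleAlg.ev_run_ask, MAC.tagOracle, ev_pure]
      -- The challenger draws `km` first, while the game draws it after both encapsulations; the
      -- average over `km` is moved inwards past each of them.
      rw [ev_comm]
      refine le_of_eq_of_le (ev_bind _ _ _) (ev_mono fun a => ?_)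
      rw [ev_comm]
      refine le_of_eq_of_le (ev_bind _ _ _) (ev_mono fun e => ?_)
      refine le_of_eq_of_le (ev_bind _ _ _) ?_
      simp only [← responderPost_append]
      rw [← ev_uniform_prod (Bits.splitEquiv P.lenMacQkd P.lenSess)]
      refine ev_mono fun x => le_of_eq_of_le (ev_pure _ _) ?_
      have := forgeProb_answer_le b hw hs hr m1 a e x.left x.right k
      rw [Bits.append_left_right] at this
      rw [show (Bits.splitEquiv _ _ x).1.append (Bits.splitEquiv _ _ x).2 = x from
        Bits.append_left_right x]
      exact this

end Suite

/-! ### Averaging over the static keys and assembling the bound -/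

/-- The probability that the forger wins, as an extended nonnegative real number. -/
def MAC.winProb {ℓ : ℕ} {M : Type} (mac : MAC ℓ M) (B : mac.Forger) : ℝ≥0∞ :=
  ev (PMF.uniformOfFintype (Bits ℓ)) fun k =>
    ev (B.run (mac.tagOracle k) none) (mac.forgeGain k)

theorem MAC.winProb_le_one {ℓ : ℕ} {M : Type} (mac : MAC ℓ M) (B : mac.Forger) :
    mac.winProb B ≤ 1 :=
  ev_le_of_support fun _ _ => ev_le_of_support fun _ _ => ind_le_one _

theorem MAC.otSufCmaAdv_eq {ℓ : ℕ} {M : Type} (mac : MAC ℓ M) (B : mac.Forger) :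
    mac.otSufCmaAdv B = (mac.winProb B).toReal := by
  simp only [otSufCmaAdv, otSufCmaGame, prTrue_eq_ev, ev_bind, ev_pure, decide_eq_true_eq]
  rfl

theorem KEM.failure_le_one (K : KEM) (ks : K.PK × K.SK) : K.failure ks ≤ 1 :=
  ev_le_of_support fun _ _ => ind_le_one _

theorem KEM.prTrue_decapsFails (K : KEM) (ks : K.PK × K.SK) :
    prTrue (K.decapsFails ks.1 ks.2) = (K.failure ks).toReal := by
  simp only [decapsFails, prTrue_eq_ev, ev_bind, ev_pure, decide_eq_true_eq]
  rfl

theorem KEM.isCorrect_iff (K : KEM) (δ : ℝ) :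
    K.IsCorrect δ ↔ (ev K.keyGen K.failure).toReal ≤ δ := by
  simp only [IsCorrect, decapsFails, prTrue_eq_ev, ev_bind, ev_pure, decide_eq_true_eq]
  rfl

/-- The expected failure probability of the worst of `n` key pairs. -/
def KEM.worstFailure (K : KEM) (n : ℕ) : ℝ≥0∞ :=
  ev (iid K.keyGen n) fun keys => ⨆ j, K.failure (keys j)

theorem KEM.worstFailure_le_one (K : KEM) (n : ℕ) : K.worstFailure n ≤ 1 :=
  ev_le_of_support fun _ _ => iSup_le fun _ => K.failure_le_one _

/-- The maximum is at most the sum, and each of the independent key pairs contributes the average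
failure probability. -/
theorem KEM.worstFailure_le_mul (K : KEM) (n : ℕ) :
    K.worstFailure n ≤ n * ev K.keyGen K.failure := by
  have : ∀ keys : Fin n → K.PK × K.SK, (⨆ j, K.failure (keys j)) ≤ ∑ j, K.failure (keys j) :=
    fun keys => iSup_le fun j => Finset.single_le_sum (f := fun j => K.failure (keys j))
      (fun _ _ => zero_le) (Finset.mem_univ j)
  refine (ev_mono this).trans ?_
  rw [ev_sum]
  simp [ev_iid]

theorem KEM.worstFailure_le_of_isCorrectForEveryKey (K : KEM) (n : ℕ) {δ : ℝ}
    (h : K.IsCorrectForEveryKey δ) : K.worstFailure n ≤ ENNReal.ofReal δ := by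
  refine ev_le_of_support fun keys hkeys => iSup_le fun j => ?_
  have := h (keys j) (mem_support_of_mem_support_iid _ n keys hkeys j)
  rw [K.prTrue_decapsFails] at this
  rwa [ENNReal.le_ofReal_iff_toReal_le (ne_top_of_le_ne_top (by simp) (K.failure_le_one _))]
  exact ENNReal.toReal_nonneg.trans this

namespace Suite

variable {P : Suite} {N : ℕ}

/-- The forger samples all static key pairs itself, so it can also answer every corruption query. -/
theorem ev_forgeProb_le_winProb (A : P.Adversary N) (b : Bool) (r : ℕ) :
    (ev (iid P.stat.keyGen N) fun keys =>
      forgeProb keys b r (A fun i => (keys i).1) (GameState.start P N)) ≤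
        P.macQkd.winProb (forger A b r) := by
  simp only [MAC.winProb, forger, OracleAlg.ev_run_sample]
  rw [ev_comm]
  exact ev_mono fun keys => forgeProb_le_forgerBefore keys b r _ _ (wf_start keys)
    fun s hs => by cases hs

/-- The probability that the adversary wins the game with bit `b`. -/
def gameProb (A : P.Adversary N) (b : Bool) : ℝ≥0∞ :=
  ev (iid P.stat.keyGen N) fun keys =>
    ev ((A fun i => (keys i).1).run (P.oracle N keys b) (GameState.start P N)) fun r =>
      ind (r.1 = true ∧ r.2.Nontrivial)

theorem gameProb_le_one (A : P.Adversary N) (b : Bool) : gameProb A b ≤ 1 :=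
  ev_le_of_support fun _ _ => ev_le_of_support fun _ _ => ind_le_one _

theorem prTrue_indStAAQkdGame (A : P.Adversary N) (b : Bool) :
    prTrue (P.indStAAQkdGame A b) = (gameProb A b).toReal := by
  simp only [indStAAQkdGame, prTrue_eq_ev, ev_bind, ev_pure, Bool.and_eq_true, decide_eq_true_eq]
  rfl

theorem gameProb_le (A : P.Adversary N) {n : ℕ} (hA : A.EstablishesAtMost n) (b b' : Bool) :
    gameProb A b ≤ gameProb A b' + ((∑ r ∈ Finset.range n, P.macQkd.winProb (forger A b r)) +
      (n * P.stat.worstFailure N + n * (n * ev P.eph.keyGen P.eph.failure))) := by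
  refine (ev_mono fun keys => ev_nontrivial_le keys b b' _).trans ?_
  rw [ev_add]
  refine add_le_add le_rfl ((ev_mono fun keys => ev_exposed_le keys b n _ (hA _)).trans ?_)
  rw [ev_add, ev_add, ev_const, ev_sum, ev_const_mul]
  exact add_le_add (Finset.sum_le_sum fun r _ => ev_forgeProb_le_winProb A b r) le_rfl

/-- One forger is at least as good as each of the forgers against the sessions. -/
theorem exists_forger_max (A : P.Adversary N) (n : ℕ) : ∃ B : P.macQkd.Forger,
    ∀ b, ∀ r < n, P.macQkd.winProb (forger A b r) ≤ P.macQkd.winProb B := by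
  rcases n.eq_zero_or_pos with rfl | hn
  · exact ⟨.done none, fun b r hr => absurd hr (Nat.not_lt_zero r)⟩
  obtain ⟨x, -, hx⟩ := Finset.exists_max_image (Finset.univ ×ˢ Finset.range n)
    (fun x : Bool × ℕ => P.macQkd.winProb (forger A x.1 x.2)) ⟨(true, 0), by simp [hn]⟩
  exact ⟨forger A x.1 x.2, fun b r hr => hx (b, r) (by simp [hr])⟩

/-- The one-sided comparison of the games holds with the bits in either order, which bounds the
absolute value without doubling. The forgers differ for the two orders, so `B` has to dominate both.
-/
theorem indStAAQkdAdv_le (A : P.Adversary N) {n : ℕ} (hA : A.EstablishesAtMost n)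
    {B : P.macQkd.Forger}
    (hB : ∀ b, ∀ r < n, P.macQkd.winProb (forger A b r) ≤ P.macQkd.winProb B) :
    P.indStAAQkdAdv A ≤ n * P.macQkd.otSufCmaAdv B + n * (P.stat.worstFailure N).toReal +
      n * (n * (ev P.eph.keyGen P.eph.failure).toReal) := by
  have hsum : ∀ b, (∑ r ∈ Finset.range n, P.macQkd.winProb (forger A b r)) ≤
      n * P.macQkd.winProb B := fun b =>
    (Finset.sum_le_sum fun r hr => hB b r (Finset.mem_range.1 hr)).trans (by simp)
  have hfin : ∀ {x : ℝ≥0∞}, x ≤ 1 → x ≠ ⊤ := fun h => ne_top_of_le_ne_top ENNReal.one_ne_top h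
  have h1 := hfin (P.macQkd.winProb_le_one B)
  have h2 := hfin (P.stat.worstFailure_le_one N)
  have h3 : ev P.eph.keyGen P.eph.failure ≠ ⊤ := ev_ne_top P.eph.failure_le_one
  have key : ∀ b b', (gameProb A b).toReal ≤ (gameProb A b').toReal +
      (n * P.macQkd.otSufCmaAdv B + n * (P.stat.worstFailure N).toReal +
        n * (n * (ev P.eph.keyGen P.eph.failure).toReal)) := by
    intro b b'
    have h := (gameProb_le A hA b b').trans (add_le_add le_rfl (add_le_add (hsum b) le_rfl))
    have hn : (n : ℝ≥0∞) ≠ ⊤ := ENNReal.natCast_ne_top n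
    have h4 := hfin (gameProb_le_one A b')
    have m1 := ENNReal.mul_ne_top hn h1
    have m2 := ENNReal.mul_ne_top hn h2
    have m3 := ENNReal.mul_ne_top hn (ENNReal.mul_ne_top hn h3)
    have := ENNReal.toReal_mono
      (ENNReal.add_ne_top.2 ⟨h4, ENNReal.add_ne_top.2 ⟨m1, ENNReal.add_ne_top.2 ⟨m2, m3⟩⟩⟩) h
    rw [ENNReal.toReal_add h4 (ENNReal.add_ne_top.2 ⟨m1, ENNReal.add_ne_top.2 ⟨m2, m3⟩⟩),
      ENNReal.toReal_add m1 (ENNReal.add_ne_top.2 ⟨m2, m3⟩), ENNReal.toReal_add m2 m3] at this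
    simpa only [ENNReal.toReal_mul, ENNReal.toReal_natCast, MAC.otSufCmaAdv_eq, add_assoc]
      using this
  rw [indStAAQkdAdv, prTrue_indStAAQkdGame, prTrue_indStAAQkdGame, abs_le]
  constructor
  · linarith [key false true]
  · linarith [key true false]

end Suite

end QKDAKE

end

/-! ### The numerical estimates -/

theorem mainTheorem2 (P : QKDAKE.Suite) (δ_stat δ_eph : ℝ)
    (hstat : P.stat.IsCorrect δ_stat) (heph : P.eph.IsCorrect δ_eph)
    (N n_s : ℕ) (A : P.Adversary N) (hA : A.EstablishesAtMost n_s) :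
    ∃ B : P.macQkd.Forger,
      (N ≤ 2 * n_s ∨ P.stat.IsCorrectForEveryKey δ_stat →
        P.indStAAQkdAdv A ≤
          2 * n_s * (n_s * (2 * δ_stat + δ_eph) + P.macQkd.otSufCmaAdv B)) ∧
      P.indStAAQkdAdv A ≤
        2 * n_s * (max (2 * n_s) N * δ_stat + n_s * δ_eph + P.macQkd.otSufCmaAdv B) := by
  obtain ⟨B, hB⟩ := QKDAKE.Suite.exists_forger_max A n_s
  have hadv := QKDAKE.Suite.indStAAQkdAdv_le A hA hB
  have hB0 : 0 ≤ P.macQkd.otSufCmaAdv B := by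
    rw [QKDAKE.MAC.otSufCmaAdv_eq]; exact ENNReal.toReal_nonneg
  rw [QKDAKE.KEM.isCorrect_iff] at hstat heph
  have hs0 : 0 ≤ δ_stat := ENNReal.toReal_nonneg.trans hstat
  have he0 : 0 ≤ δ_eph := ENNReal.toReal_nonneg.trans heph
  have hn0 : (0 : ℝ) ≤ n_s := Nat.cast_nonneg _
  have hE : (n_s : ℝ) * (n_s * (QKDAKE.ev P.eph.keyGen P.eph.failure).toReal) ≤
      n_s * (n_s * δ_eph) := by gcongr
  have hE0 : 0 ≤ (n_s : ℝ) * (n_s * δ_eph) := by positivity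
  have hA0 : 0 ≤ n_s * P.macQkd.otSufCmaAdv B := by positivity
  have hsN : (P.stat.worstFailure N).toReal ≤ N * δ_stat := by
    have h := ENNReal.toReal_mono (ENNReal.mul_ne_top (ENNReal.natCast_ne_top N)
      (QKDAKE.ev_ne_top P.stat.failure_le_one)) (P.stat.worstFailure_le_mul N)
    rw [ENNReal.toReal_mul, ENNReal.toReal_natCast] at h
    exact h.trans (by gcongr)
  refine ⟨B, fun hc => ?_, ?_⟩
  -- The resulting sum is half of the claimed bound, so `linarith` needs the nonnegativity of each
  -- term to absorb the factor 2.
  · have hS : (n_s : ℝ) * (P.stat.worstFailure N).toReal ≤ n_s * (2 * n_s * δ_stat) := by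
      rcases hc with hN | hkey
      · have hN' : (N : ℝ) ≤ 2 * n_s := by exact_mod_cast hN
        have : (N : ℝ) * δ_stat ≤ 2 * n_s * δ_stat := by gcongr
        exact mul_le_mul_of_nonneg_left (hsN.trans this) hn0
      -- The comparison of `δ_stat` with `2 * n_s * δ_stat` needs at least one session; without
      -- sessions both sides vanish.
      · rcases Nat.eq_zero_or_pos n_s with rfl | hpos
        · simp
        have hpos' : (1 : ℝ) ≤ 2 * n_s := by
          have : (1 : ℝ) ≤ n_s := by exact_mod_cast hpos
          linarith
        have h := ENNReal.toReal_mono ENNReal.ofReal_ne_top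
          (P.stat.worstFailure_le_of_isCorrectForEveryKey N hkey)
        rw [ENNReal.toReal_ofReal hs0] at h
        exact mul_le_mul_of_nonneg_left
          (h.trans (le_mul_of_one_le_left hs0 hpos')) hn0
    have hS0 : 0 ≤ (n_s : ℝ) * (2 * n_s * δ_stat) := by positivity
    linarith
  · have hS : (n_s : ℝ) * (P.stat.worstFailure N).toReal ≤
        n_s * (max (2 * n_s) N * δ_stat) := by
      refine mul_le_mul_of_nonneg_left (hsN.trans ?_) hn0
      gcongr
      exact le_max_right _ _
    have hS0 : 0 ≤ (n_s : ℝ) * (max (2 * n_s) N * δ_stat) := by positivity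
    linarith
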